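/- **Setting.** Let $d\in\{2,3\}$, let $k\ge 1$ be an integer, and let $\Omega\subset\mathbb R^d$ be a bounded open set with Lipschitz boundary. Let $\mathcal T_h$ be a conforming triangulation of $\Omega$ into simplices that is shape regular with constant $\gamma$ (every $T\in\mathcal T_h$ contains a ball of some radius $\rho>0$ with $\operatorname{diam}T\le\gamma\rho$) and quasi-uniform with constant $\kappa$ ($h\le\kappa\operatorname{diam}T$ for all $T$), where $h=\max_T\operatorname{diam}T$. Let $\mathcal F_h$ be the set of its facets. For a matrix field $\sigma$ and a unit normal $n$ of a facet put $\sigma_{nt}=\sigma n-(n^{\mathsf T}\sigma n)\,n$. The jump $[\![\sigma_{nt}]\!]$ on a facet shared by two elements is the sum of the values of $\sigma_{nt}$ from the two sides, each with its own outward unit normal. For real $s\ge0$, $H^s$ is the Sobolev(–Slobodeckij) space. Write $\sigma\in H^s(\mathcal T_h,\mathbb R^{d\times d})$ if $\sigma|_T\in H^s(T,\mathbb R^{d\times d})$ for all $T\in\mathcal T_h$, and $\|\sigma\|_{H^s(\mathcal T_h)}^2=\sum_T\|\sigma\|_{H^s(T)}^2$. For a simplex $T$ let $\Sigma_k(T)$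 be the space of trace-free matrix fields on $T$ with entries in $\mathbb P^k(T)$ whose normal-tangential component on every facet $F$ of $T$ has entries in $\mathbb P^{k-1}(F)$, and let $\mathcal B_k(T)$ be the subspace of those with $\tau_{nt}=0$ on $\partial T$. Let $$\Sigma_h=\{\tau:\ \tau|_T\in\Sigma_k(T)\ \text{for all } T\in\mathcal T_h,\ [\![\tau_{nt}]\!]=0\ \text{on all interior facets}\}.$$ For each $T$ fix an affine bijection $\phi_T$ from the unit simplex $\widehat T$ onto $T$, with matrix $F_T=\phi_T'$. The canonical interpolant $I_{\Sigma_h}\sigma$ is the element $\tau\in\Sigma_h$ such that for all $T\in\mathcal T_h$ $$\int_F(\sigma-\tau|_T)_{nt}\cdot r\,ds=0,\qquad \int_T(\sigma-\tau):F_T\,(\hat\eta\circ\phi_T^{-1})\,F_T^{-1}\,dx=0$$ for all facets $F$ of $T$ and all fields $r$ tangential to $F$ with entries in $\mathbb P^{k-1}(F)$, and for all $\hat\eta\in\mathcal B_k(\widehat T)$; here $\sigma_{nt}$ on $F$ is taken from the trace of $\sigma|_T$. **Theorem.** There is a constant $C>0$, depending only on $d,k,\gamma,\kappa$, such that the following holds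 for all such $\Omega$ and $\mathcal T_h$. Let $m\ge1$ be real and let $\sigma\in H^m(\mathcal T_h,\mathbb R^{d\times d})$ with $[\![\sigma_{nt}]\!]=0$ on all interior facets. Then $I_{\Sigma_h}\sigma$ is well defined: the traces of $\sigma|_T$ on the facets of each element exist and are unique, and there is exactly one $\tau\in\Sigma_h$ as above. For all real $s$ with $1\le s\le\min(k,m)$, $$\Big(\sum_{F\in\mathcal F_h}h\,\|(\sigma-I_{\Sigma_h}\sigma)_{nt}\|_F^2\Big)^{1/2}\le C\,h^s\,\|\sigma\|_{H^s(\mathcal T_h)},$$ and if in addition $\operatorname{tr}\sigma=0$ almost everywhere in $\Omega$, then $$\|\sigma-I_{\Sigma_h}\sigma\|_{L^2(\Omega)}+\Big(\sum_{F\in\mathcal F_h}h\,\|(\sigma-I_{\Sigma_h}\sigma)_{nt}\|_F^2\Big)^{1/2}\le C\,h^s\,\|\sigma\|_{H^s(\mathcal T_h)}.$$ -/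

import Mathlib

open MeasureTheory Filter Topology
open scoped ENNReal NNReal ContDiff

noncomputable section

namespace MCS

/-- The Euclidean space of dimension `d`. -/
abbrev Vec (d : ℕ) := EuclideanSpace ℝ (Fin d)

/-- Real `d × d` matrices. -/
abbrev Mat (d : ℕ) := Matrix (Fin d) (Fin d) ℝ

/-- A nondegenerate `d`-simplex in dimension `d`, with a fixed numbering of its vertices. -/
abbrev Simp (d : ℕ) := Affine.Simplex ℝ (Vec d) d

/-- The Frobenius inner product `A : B`. -/
def ddot {d : ℕ} (A B : Mat d) : ℝ := ∑ a, ∑ b, A a b * B a b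

/-- The normal-tangential component `M n - (nᵀ M n) n`, for a unit vector `n`. -/
def nt {d : ℕ} (M : Mat d) (n : Vec d) : Vec d :=
  let w : Vec d := WithLp.toLp 2 (M.mulVec n.ofLp)
  w - (inner ℝ n w : ℝ) • n

/-! ### Sobolev spaces on an open set, of real order -/

/-- `g` is the weak partial derivative of `u` in the `i`-th direction on the open set `U`. -/
def IsWeakPartial {d : ℕ} (U : Set (Vec d)) (i : Fin d) (u g : Vec d → ℝ) : Prop :=
  ∀ φ : Vec d → ℝ, ContDiff ℝ ∞ φ → HasCompactSupport φ → tsupport φ ⊆ U →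
    ∫ x in U, u x * fderiv ℝ φ x (EuclideanSpace.single i 1) = -∫ x in U, g x * φ x

/-- `G j w` is the weak derivative `∂_{w 0} ⋯ ∂_{w (j-1)} u` on `U`, for every `j ≤ n`, and all
these derivatives are square integrable. -/
structure IsWeakJet {d : ℕ} (U : Set (Vec d)) (n : ℕ) (u : Vec d → ℝ)
    (G : (j : ℕ) → (Fin j → Fin d) → Vec d → ℝ) : Prop where
  zero : G 0 Fin.elim0 =ᵐ[volume.restrict U] u
  memLp : ∀ j ≤ n, ∀ w, MemLp (G j w) 2 (volume.restrict U)
  succ : ∀ j < n, ∀ (w : Fin j → Fin d) (i : Fin d),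
    IsWeakPartial U i (G j w) (G (j + 1) (Fin.cons i w : Fin (j + 1) → Fin d))

/-- The squared Gagliardo (Sobolev-Slobodeckij) seminorm of order `θ ∈ (0, 1)` on `U`. -/
def gagliardoSq {d : ℕ} (U : Set (Vec d)) (θ : ℝ) (g : Vec d → ℝ) : ℝ≥0∞ :=
  ∫⁻ x in U, ∫⁻ y in U, ‖g x - g y‖ₑ ^ 2 / ‖x - y‖ₑ ^ ((d : ℝ) + 2 * θ)

open Classical in
/-- The squared norm of the derivatives `G`, in `H^s(U)`, `s ≥ 0`: the squared `L²` norms of all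
derivatives up to order `⌊s⌋` and, when `s` is not an integer, the squared Gagliardo seminorms of
order `s - ⌊s⌋` of the derivatives of order `⌊s⌋`. -/
def jetNormSq {d : ℕ} (U : Set (Vec d)) (s : ℝ)
    (G : (j : ℕ) → (Fin j → Fin d) → Vec d → ℝ) : ℝ≥0∞ :=
  (∑ j ∈ Finset.range (⌊s⌋₊ + 1), ∑ w : Fin j → Fin d, ∫⁻ x in U, ‖G j w x‖ₑ ^ 2) +
    if Int.fract s = 0 then 0
    else ∑ w : Fin ⌊s⌋₊ → Fin d, gagliardoSq U (Int.fract s) (G ⌊s⌋₊ w)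

/-- The squared `H^s(U)` norm, `s ≥ 0`. Weak derivatives are unique up to null sets, so the infimum
is over one value; it is over the empty set, hence `∞`, if `u` lacks the weak derivatives. -/
def sobolevNormSq {d : ℕ} (U : Set (Vec d)) (s : ℝ) (u : Vec d → ℝ) : ℝ≥0∞ :=
  ⨅ (G : (j : ℕ) → (Fin j → Fin d) → Vec d → ℝ) (_ : IsWeakJet U ⌊s⌋₊ u G), jetNormSq U s G

/-- `u ∈ H^s(U)`, `s ≥ 0`. -/
def MemSobolev {d : ℕ} (U : Set (Vec d)) (s : ℝ) (u : Vec d → ℝ) : Prop :=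
  sobolevNormSq U s u < ⊤

/-! ### Simplices, facets, traces -/

/-- The closed simplex as a set. -/
def body {d : ℕ} (S : Simp d) : Set (Vec d) := convexHull ℝ (Set.range S.points)

/-- The facet opposite to the `j`-th vertex, as a closed set. -/
def facet {d : ℕ} (S : Simp d) (j : Fin (d + 1)) : Set (Vec d) := convexHull ℝ (S.points '' {j}ᶜ)

/-- The surface measure on the facet opposite to the `j`-th vertex. -/
def surf {d : ℕ} (S : Simp d) (j : Fin (d + 1)) : Measure (Vec d) :=
  (μHE[d - 1] : Measure (Vec d)).restrict (facet S j)

/-- The outward unit normal on the facet opposite to the `j`-th vertex, namely the normalized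
vector from that vertex to the foot of its altitude. -/
def normal {d : ℕ} [NeZero d] (S : Simp d) (j : Fin (d + 1)) : Vec d :=
  (S.height j)⁻¹ • (S.altitudeFoot j - S.points j)

/-- `g` is the trace of `u ∈ H¹(S)` in `L²` of the facet opposite to the `j`-th vertex: the limit
of the restrictions of smooth functions which converge to `u` in `H¹(S)`. -/
def IsTrace {d : ℕ} (S : Simp d) (j : Fin (d + 1)) (u g : Vec d → ℝ) : Prop :=
  MemLp g 2 (surf S j) ∧
  ∃ φ : ℕ → Vec d → ℝ, (∀ l, ContDiff ℝ ∞ (φ l)) ∧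
    Tendsto (fun l => sobolevNormSq (interior (body S)) 1 (fun x => φ l x - u x)) atTop (𝓝 0) ∧
    Tendsto (fun l => ∫⁻ x, ‖φ l x - g x‖ₑ ^ 2 ∂(surf S j)) atTop (𝓝 0)

open Classical in
/-- The trace of `u ∈ H¹(S)` on a facet (zero if there is no trace). -/
def trace {d : ℕ} (S : Simp d) (j : Fin (d + 1)) (u : Vec d → ℝ) : Vec d → ℝ :=
  if h : ∃ g, IsTrace S j u g then h.choose else 0

/-- The entrywise trace of a matrix field on a facet. -/
def matTrace {d : ℕ} (S : Simp d) (j : Fin (d + 1)) (σ : Vec d → Mat d) (x : Vec d) : Mat d :=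
  Matrix.of fun a b => trace S j (fun y => σ y a b) x

/-! ### The finite element -/

/-- `f` is a polynomial function of degree at most `k`. -/
def IsPoly {d : ℕ} (k : ℕ) (f : Vec d → ℝ) : Prop :=
  ∃ p : MvPolynomial (Fin d) ℝ, p.totalDegree ≤ k ∧ ∀ x, f x = MvPolynomial.eval x.ofLp p

/-- The local space `Σ_k(S)`, `k ≥ 1`: trace-free matrix polynomials of degree at most `k` whose
normal-tangential component on each facet is a polynomial of degree at most `k - 1`. A polynomial
on `S` is identified with its unique polynomial extension to the whole space. -/
structure MemSigma {d : ℕ} [NeZero d] (k : ℕ) (S : Simp d) (τ : Vec d → Mat d) : Prop where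
  poly : ∀ a b, IsPoly k (fun x => τ x a b)
  traceFree : ∀ x, (τ x).trace = 0
  ntPoly : ∀ j, ∃ q : Vec d → Vec d, (∀ a, IsPoly (k - 1) (fun x => q x a)) ∧
    ∀ x ∈ facet S j, nt (τ x) (normal S j) = q x

/-- The bubble space `B_k(S)`: members of `Σ_k(S)` with vanishing normal-tangential component on
the boundary. -/
structure MemBubble {d : ℕ} [NeZero d] (k : ℕ) (S : Simp d) (η : Vec d → Mat d) : Prop where
  mem : MemSigma k S η
  ntZero : ∀ j, ∀ x ∈ facet S j, nt (η x) (normal S j) = 0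

theorem affineIndependent_ref (d : ℕ) : AffineIndependent ℝ
    (Fin.cons 0 fun i => EuclideanSpace.single i 1 : Fin (d + 1) → Vec d) := by
  rw [affineIndependent_iff_linearIndependent_vsub ℝ _ (0 : Fin (d + 1))]
  have h1 : LinearIndependent ℝ fun i : Fin d => (EuclideanSpace.single i (1 : ℝ) : Vec d) := by
    have h := (EuclideanSpace.basisFun (Fin d) ℝ).toBasis.linearIndependent
    have e : (fun i : Fin d => (EuclideanSpace.single i (1 : ℝ) : Vec d)) =
        ⇑(EuclideanSpace.basisFun (Fin d) ℝ).toBasis := by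
      ext i : 1
      simp
    rw [e]
    exact h
  refine (linearIndependent_equiv (finSuccAboveEquiv (0 : Fin (d + 1)))).mp ?_
  have e : ((fun i : {x : Fin (d + 1) // x ≠ 0} =>
      ((Fin.cons 0 fun i => EuclideanSpace.single i 1 : Fin (d + 1) → Vec d) i -ᵥ
        (Fin.cons 0 fun i => EuclideanSpace.single i 1 : Fin (d + 1) → Vec d) 0 : Vec d)) ∘
      finSuccAboveEquiv (0 : Fin (d + 1))) =
      fun i : Fin d => (EuclideanSpace.single i (1 : ℝ) : Vec d) := by
    ext i : 1
    simp [finSuccAboveEquiv]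
  rw [e]
  exact h1

/-- The unit simplex, with vertices `0, e_1, …, e_d`. -/
def refSimplex (d : ℕ) : Simp d where
  points := Fin.cons 0 fun i => EuclideanSpace.single i 1
  independent := affineIndependent_ref d

/-- The matrix `F` of the affine map `x̂ ↦ v_0 + F x̂` from the unit simplex onto `S` which sends
`0, e_1, …, e_d` to the vertices `v_0, v_1, …, v_d` of `S`. -/
def jac {d : ℕ} (S : Simp d) : Mat d :=
  Matrix.of fun a l => (S.points l.succ - S.points 0) a

/-- The inverse of that affine map. -/
def toRef {d : ℕ} (S : Simp d) (x : Vec d) : Vec d :=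
  WithLp.toLp 2 ((jac S)⁻¹.mulVec (x - S.points 0).ofLp)

/-- `τ ∈ Σ_k(S)` has the same degrees of freedom as `σ` on `S`: the facet moments
`∫_F σ_nt · r` for tangential polynomial fields `r` of degree at most `k - 1`, and the interior
moments `∫_S σ : F η̂ F⁻¹` for `η̂` in the bubble space of the unit simplex. -/
structure IsLocalInterpolant {d : ℕ} [NeZero d] (k : ℕ) (S : Simp d) (σ τ : Vec d → Mat d) :
    Prop where
  mem : MemSigma k S τ
  facetDof : ∀ (j : Fin (d + 1)) (r : Vec d → Vec d), (∀ a, IsPoly (k - 1) (fun x => r x a)) →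
    (∀ x ∈ facet S j, inner ℝ (normal S j) (r x) = 0) →
    ∫ x, inner ℝ (nt (matTrace S j σ x - τ x) (normal S j)) (r x) ∂(surf S j) = 0
  interiorDof : ∀ η : Vec d → Mat d, MemBubble k (refSimplex d) η →
    ∫ x in body S, ddot (σ x - τ x) (jac S * η (toRef S x) * (jac S)⁻¹) = 0

/-! ### Domains and triangulations -/

/-- A bounded open set with Lipschitz boundary: near each boundary point it is the region above the
graph of a Lipschitz function `γ`, in the direction of a unit vector `e`. -/
structure IsLipschitzDomain {d : ℕ} (Ω : Set (Vec d)) : Prop where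
  isOpen : IsOpen Ω
  isBounded : Bornology.IsBounded Ω
  lipschitz : ∀ x ∈ frontier Ω, ∃ (e : Vec d) (r : ℝ) (K : ℝ≥0) (γ : Vec d → ℝ),
    ‖e‖ = 1 ∧ 0 < r ∧ LipschitzWith K γ ∧ (∀ (y : Vec d) (t : ℝ), γ (y + t • e) = γ y) ∧
    ∀ y ∈ Metric.ball x r, y ∈ Ω ↔ γ y < inner ℝ e y

/-- A conforming simplicial triangulation of `Ω`. -/
structure Triangulation {d : ℕ} (Ω : Set (Vec d)) where
  N : ℕ
  elem : Fin N → Simp d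
  cover : ⋃ i, body (elem i) = closure Ω
  vertices_ne : ∀ i i', i ≠ i' → Set.range (elem i).points ≠ Set.range (elem i').points
  conforming : ∀ i i', i ≠ i' → body (elem i) ∩ body (elem i') =
    convexHull ℝ (Set.range (elem i).points ∩ Set.range (elem i').points)

namespace Triangulation

variable {d : ℕ} {Ω : Set (Vec d)} (𝒯 : Triangulation Ω)

/-- The mesh size, the maximum of the diameters of the elements. -/
def h : ℝ := ⨆ i, Metric.diam (body (𝒯.elem i))

/-- Shape regularity with constant `γ`: every element `T` contains a ball of radius `ρ > 0` with
`diam T ≤ γ ρ`. -/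
def ShapeRegular (γ : ℝ) : Prop :=
  ∀ i, ∃ (x : Vec d) (ρ : ℝ), 0 < ρ ∧ Metric.closedBall x ρ ⊆ body (𝒯.elem i) ∧
    Metric.diam (body (𝒯.elem i)) ≤ γ * ρ

/-- Quasi-uniformity with constant `κ`. -/
def QuasiUniform (κ : ℝ) : Prop := ∀ i, 𝒯.h ≤ κ * Metric.diam (body (𝒯.elem i))

open Classical in
/-- The set of all facets of the triangulation, each counted once. -/
def facets : Finset (Set (Vec d)) :=
  Finset.univ.image fun q : Fin 𝒯.N × Fin (d + 1) => facet (𝒯.elem q.1) q.2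

/-- The squared norm of `H^s` of the triangulation, `s ≥ 0`, for matrix fields. -/
def brokenNormSq (s : ℝ) (σ : Vec d → Mat d) : ℝ≥0∞ :=
  ∑ i, ∑ a, ∑ b, sobolevNormSq (interior (body (𝒯.elem i))) s (fun x => σ x a b)

/-- `σ` is piecewise `H^s`. -/
def MemBroken (s : ℝ) (σ : Vec d → Mat d) : Prop :=
  ∀ i a b, MemSobolev (interior (body (𝒯.elem i))) s (fun x => σ x a b)

/-- The jump of the normal-tangential component vanishes on interior facets, where `t i j` is the
trace from the `i`-th element on its `j`-th facet. The outward normals of two elements on a common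
facet are opposite, so that the jump is the sum of the two normal-tangential components. -/
def NTContinuous [NeZero d] (t : Fin 𝒯.N → Fin (d + 1) → Vec d → Mat d) : Prop :=
  ∀ i j i' j', i ≠ i' → facet (𝒯.elem i) j = facet (𝒯.elem i') j' →
    ∀ᵐ x ∂(surf (𝒯.elem i) j),
      nt (t i j x) (normal (𝒯.elem i) j) + nt (t i' j' x) (normal (𝒯.elem i') j') = 0

/-- The global space `Σ_h`: `τ i` is the restriction of `τ` to the `i`-th element. -/
structure MemSigmaH [NeZero d] (k : ℕ) (τ : Fin 𝒯.N → Vec d → Mat d) : Prop where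
  mem : ∀ i, MemSigma k (𝒯.elem i) (τ i)
  ntContinuous : 𝒯.NTContinuous fun i _ => τ i

/-- `τ ∈ Σ_h` is the canonical interpolant of `σ`: on each element it has the same degrees of
freedom as `σ`. -/
structure IsInterpolant [NeZero d] (k : ℕ) (σ : Vec d → Mat d) (τ : Fin 𝒯.N → Vec d → Mat d) :
    Prop where
  mem : 𝒯.MemSigmaH k τ
  dof : ∀ i, IsLocalInterpolant k (𝒯.elem i) σ (τ i)

/-- The `L²(Ω)` norm of `σ - τ`. -/
def l2Err (σ : Vec d → Mat d) (τ : Fin 𝒯.N → Vec d → Mat d) : ℝ≥0∞ :=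
  (∑ i, ∑ a, ∑ b, ∫⁻ x in body (𝒯.elem i), ‖σ x a b - τ i x a b‖ₑ ^ 2) ^ (1 / 2 : ℝ)

/-- The squared `L²(F)` norm of `(σ - τ)_nt`, taken from an element having `F` as a facet. If the
jumps vanish, the two elements at an interior facet give the same value. -/
def ntErrSq [NeZero d] (σ : Vec d → Mat d) (τ : Fin 𝒯.N → Vec d → Mat d) (F : Set (Vec d)) :
    ℝ≥0∞ :=
  ⨆ (i : Fin 𝒯.N) (j : Fin (d + 1)) (_ : facet (𝒯.elem i) j = F),
    ∫⁻ x, ‖nt (matTrace (𝒯.elem i) j σ x - τ i x) (normal (𝒯.elem i) j)‖ₑ ^ 2 ∂(surf (𝒯.elem i) j)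

/-- The weighted facet norm `(∑_F h ‖(σ - τ)_nt‖_F²)^(1/2)`. -/
def facetErr [NeZero d] (σ : Vec d → Mat d) (τ : Fin 𝒯.N → Vec d → Mat d) : ℝ≥0∞ :=
  (∑ F ∈ 𝒯.facets, ENNReal.ofReal 𝒯.h * 𝒯.ntErrSq σ τ F) ^ (1 / 2 : ℝ)

end Triangulation

end MCS

end

/-! Everything is local. On an element `S` of diameter at most `h` containing a ball of radius `ρ`,
with `h ≤ Γ ρ`, the facet moments say exactly that the normal-tangential part of the interpolant is
the `L²` projection of that of `σ` onto tangential polynomial fields of degree `k - 1`. The facet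
error is therefore at most the best approximation error. The latter is bounded by a scaled trace
inequality (`nsq_surf_le`, `IsTrace.nsq_sub_le`) and a Bramble-Hilbert estimate for real order `s`
(`exists_poly_scaledSq_le_sobolevNormSq`), itself a consequence of the Poincaré inequality on convex
sets, applied to a polynomial whose derivatives have the same means as those of `σ`. No condition on
the trace of `σ` enters, because the identity matrix has no normal-tangential part.

For the `L²` error let `p` be the approximating polynomial of degree `k - 1` and `q` its trace-free
part, which lies in `Σ_k(S)`. The difference `e = τ - q` is controlled by its facet components and
its interior moments. On the unit simplex this is finite-dimensional linear algebra: the bubbles are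
the kernel of the form given by the facet components, and on them the moments give the full `L²`
norm (`exists_form_le`, `exists_stability_ref`). The map `τ ↦ Fᵀ τ F⁻ᵀ` preserves trace, polynomial
degree and the normal-tangential structure, and is dual to the conjugation `F η F⁻¹` of the test
fields, so the estimate carries over to `S` with constants depending on `Γ` only
(`exists_stability`). If `tr σ = 0`, then `σ - q` is the trace-free part of `σ - p`, hence no larger
than it, and the bound follows.

Unisolvence uses the same structure. The explicit field `ntLift` realises any tangential data on one
facet without disturbing the others, a Gram system on the bubbles adjusts the interior moments
(`exists_isLocalInterpolant`), and a difference of two interpolants is a bubble orthogonal to itself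
(`IsLocalInterpolant.unique`). The local interpolants fit together because projections of opposite
data on a common facet are opposite (`IsLocalInterpolant.nt_jump`).

Traces and the inequalities for weakly differentiable functions come from smooth approximation: on a
convex set, contraction towards an interior point leaves room for mollification
(`IsWeakGrad.exists_smooth_tendsto`). -/

noncomputable section

namespace MCS

/-! ### Polynomial functions -/

namespace IsPoly

variable {d k l : ℕ} {f g : Vec d → ℝ}

theorem mono (hf : IsPoly k f) (h : k ≤ l) : IsPoly l f := by
  obtain ⟨p, hp, hx⟩ := hf
  exact ⟨p, hp.trans h, hx⟩

theorem const (k : ℕ) (c : ℝ) : IsPoly k (fun _ : Vec d => c) :=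
  ⟨MvPolynomial.C c, by simp, by simp⟩

theorem coord (i : Fin d) : IsPoly 1 (fun x : Vec d => x i) :=
  ⟨MvPolynomial.X i, by simp, by simp⟩

theorem add (hf : IsPoly k f) (hg : IsPoly k g) : IsPoly k (fun x => f x + g x) := by
  obtain ⟨p, hp, hx⟩ := hf
  obtain ⟨q, hq, hy⟩ := hg
  exact ⟨p + q, (MvPolynomial.totalDegree_add p q).trans (max_le hp hq), by simp [hx, hy]⟩

theorem mul (hf : IsPoly k f) (hg : IsPoly l g) : IsPoly (k + l) (fun x => f x * g x) := by
  obtain ⟨p, hp, hx⟩ := hf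
  obtain ⟨q, hq, hy⟩ := hg
  exact ⟨p * q, (MvPolynomial.totalDegree_mul p q).trans (add_le_add hp hq), by simp [hx, hy]⟩

theorem const_mul (c : ℝ) (hf : IsPoly k f) : IsPoly k (fun x => c * f x) := by
  simpa using (const 0 c).mul hf

theorem mul_const (c : ℝ) (hf : IsPoly k f) : IsPoly k (fun x => f x * c) := by
  simpa using hf.mul (const 0 c)

theorem neg (hf : IsPoly k f) : IsPoly k (fun x => -f x) := by
  simpa using hf.const_mul (-1)

theorem sub (hf : IsPoly k f) (hg : IsPoly k g) : IsPoly k (fun x => f x - g x) := by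
  simpa [sub_eq_add_neg] using hf.add hg.neg

theorem sum {ι : Type*} (s : Finset ι) {F : ι → Vec d → ℝ} (h : ∀ i ∈ s, IsPoly k (F i)) :
    IsPoly k (fun x => ∑ i ∈ s, F i x) := by
  classical
  induction s using Finset.induction_on with
  | empty => simpa using const (d := d) k 0
  | insert a s ha ih =>
    simp only [Finset.sum_insert ha]
    exact (h a (by simp)).add (ih fun i hi => h i (by simp [hi]))

theorem pow (hf : IsPoly k f) (n : ℕ) : IsPoly (n * k) (fun x => f x ^ n) := by
  induction n with
  | zero => simpa using const (d := d) 0 1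
  | succ n ih => simpa [pow_succ, Nat.succ_mul] using ih.mul hf

theorem prod {ι : Type*} (s : Finset ι) {F : ι → Vec d → ℝ} {K : ι → ℕ}
    (h : ∀ i ∈ s, IsPoly (K i) (F i)) : IsPoly (∑ i ∈ s, K i) (fun x => ∏ i ∈ s, F i x) := by
  classical
  induction s using Finset.induction_on with
  | empty => simpa using const (d := d) 0 1
  | insert a s ha ih =>
    simp only [Finset.sum_insert ha, Finset.prod_insert ha]
    exact (h a (by simp)).mul (ih fun i hi => h i (by simp [hi]))

theorem comp {φ : Vec d → Vec d} (hφ : ∀ a, IsPoly 1 fun x => φ x a) (hf : IsPoly k f) :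
    IsPoly k (fun x => f (φ x)) := by
  obtain ⟨p, hp, hx⟩ := hf
  simp only [hx, MvPolynomial.eval_eq']
  refine sum _ fun m hm => const_mul _ ?_
  refine mono (prod _ fun i _ => (hφ i).pow (m i)) ?_
  refine le_trans ?_ hp
  simpa [Finsupp.sum_fintype] using MvPolynomial.le_totalDegree hm

theorem analyticOnNhd (hf : IsPoly k f) : AnalyticOnNhd ℝ f Set.univ := by
  obtain ⟨p, -, hx⟩ := hf
  have h : f = fun x => MvPolynomial.aeval (fun i => x i) p := by
    ext x
    rw [hx, MvPolynomial.aeval_def, MvPolynomial.eval, MvPolynomial.coe_eval₂Hom]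
    rfl
  rw [h]
  refine AnalyticOnNhd.aeval_mvPolynomial (fun i => ?_) p
  exact (EuclideanSpace.proj (𝕜 := ℝ) i).analyticOnNhd _

theorem contDiff (hf : IsPoly k f) : ContDiff ℝ ∞ f :=
  contDiffOn_univ.1 hf.analyticOnNhd.contDiffOn_of_completeSpace

theorem continuous (hf : IsPoly k f) : Continuous f := hf.contDiff.continuous

/-- The identity theorem for analytic functions. It makes the extension of a polynomial from a
simplex to the whole space unique. -/
theorem eq_zero_of_interior (hf : IsPoly k f) {s : Set (Vec d)} (hs : (interior s).Nonempty)
    (h : ∀ x ∈ s, f x = 0) : f = 0 := by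
  obtain ⟨x, hx⟩ := hs
  refine hf.analyticOnNhd.eq_of_eventuallyEq (g := 0) (fun _ _ => analyticAt_const) (z₀ := x) ?_
  filter_upwards [mem_interior_iff_mem_nhds.1 hx] with y hy using h y hy

end IsPoly

/-- The polynomial functions of degree at most `k`. -/
def polySub (d k : ℕ) : Submodule ℝ (Vec d → ℝ) where
  carrier := {f | IsPoly k f}
  add_mem' hf hg := hf.add hg
  zero_mem' := IsPoly.const k 0
  smul_mem' c _ hf := hf.const_mul c

instance (d k : ℕ) : FiniteDimensional ℝ (polySub d k) := by
  let L : MvPolynomial.restrictTotalDegree (Fin d) ℝ k →ₗ[ℝ] (Vec d → ℝ) :=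
    { toFun := fun p x => MvPolynomial.eval x.ofLp p.1
      map_add' := fun p q => by ext; simp
      map_smul' := fun c p => by ext; simp }
  have h : polySub d k ≤ LinearMap.range L := by
    rintro f ⟨p, hp, hx⟩
    exact ⟨⟨p, (MvPolynomial.mem_restrictTotalDegree _ _ _).2 hp⟩, by ext x; exact (hx x).symm⟩
  exact Submodule.finiteDimensional_of_le h

/-- The vector fields with polynomial entries of degree at most `k`. -/
def polyVec (d k : ℕ) : Submodule ℝ (Vec d → Vec d) where
  carrier := {f | ∀ a, IsPoly k fun x => f x a}
  add_mem' hf hg a := (hf a).add (hg a)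
  zero_mem' _ := IsPoly.const k 0
  smul_mem' c _ hf a := (hf a).const_mul c

instance (d k : ℕ) : FiniteDimensional ℝ (polyVec d k) := by
  let L : polyVec d k →ₗ[ℝ] (Fin d → polySub d k) :=
    { toFun := fun f a => ⟨fun x => f.1 x a, f.2 a⟩
      map_add' := fun p q => rfl
      map_smul' := fun c p => rfl }
  refine FiniteDimensional.of_injective L fun f g h => ?_
  ext x a
  exact congrFun (congrArg Subtype.val (congrFun h a)) x

/-- The matrix fields with polynomial entries of degree at most `k`. -/
def polyMat (d k : ℕ) : Submodule ℝ (Vec d → Mat d) where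
  carrier := {f | ∀ a b, IsPoly k fun x => f x a b}
  add_mem' hf hg a b := (hf a b).add (hg a b)
  zero_mem' _ _ := IsPoly.const k 0
  smul_mem' c _ hf a b := (hf a b).const_mul c

instance (d k : ℕ) : FiniteDimensional ℝ (polyMat d k) := by
  let L : polyMat d k →ₗ[ℝ] (Fin d → Fin d → polySub d k) :=
    { toFun := fun f a b => ⟨fun x => f.1 x a b, f.2 a b⟩
      map_add' := fun p q => rfl
      map_smul' := fun c p => rfl }
  refine FiniteDimensional.of_injective L fun f g h => ?_
  ext x a b
  exact congrFun (congrArg Subtype.val (congrFun (congrFun h a) b)) x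

/-! ### Derivatives of polynomials -/

/-- The polynomial function of a multivariate polynomial. -/
def polyFun {d : ℕ} (p : MvPolynomial (Fin d) ℝ) (x : Vec d) : ℝ := MvPolynomial.eval x.ofLp p

theorem isPoly_polyFun {d k : ℕ} {p : MvPolynomial (Fin d) ℝ} (hp : p.totalDegree ≤ k) :
    IsPoly k (polyFun p) := ⟨p, hp, fun _ => rfl⟩

theorem contDiff_polyFun {d : ℕ} (p : MvPolynomial (Fin d) ℝ) : ContDiff ℝ ∞ (polyFun p) :=
  (isPoly_polyFun le_rfl).contDiff

theorem fderiv_polyFun {d : ℕ} (p : MvPolynomial (Fin d) ℝ) (i : Fin d) (x : Vec d) :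
    fderiv ℝ (polyFun p) x (EuclideanSpace.single i 1) = polyFun (MvPolynomial.pderiv i p) x := by
  have hd : ∀ q : MvPolynomial (Fin d) ℝ, DifferentiableAt ℝ (polyFun q) x := fun q =>
    (contDiff_polyFun q).differentiable (by simp) x
  induction p using MvPolynomial.induction_on with
  | C a =>
    have : polyFun (MvPolynomial.C a) = fun _ : Vec d => a := by ext y; simp [polyFun]
    rw [this]
    simp [polyFun]
  | add p q hp hq =>
    have : polyFun (p + q) = polyFun p + polyFun q := by ext y; simp [polyFun]
    rw [this, fderiv_add (hd p) (hd q)]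
    simp only [add_apply, hp, hq]
    simp [polyFun]
  | mul_X p j hp =>
    have h1 : polyFun (p * MvPolynomial.X j) = fun y : Vec d => polyFun p y * (EuclideanSpace.proj (𝕜 := ℝ) j) y := by
      ext y; simp [polyFun]
    rw [h1, fderiv_fun_mul (hd p) (ContinuousLinearMap.differentiableAt _)]
    simp only [ContinuousLinearMap.fderiv, add_apply,
      smul_apply, hp, smul_eq_mul]
    simp [polyFun, MvPolynomial.pderiv_X, Pi.single_apply]
    split_ifs <;> simp

/-- The iterated partial derivative of a polynomial along a word. -/
def wordDeriv {d : ℕ} : {j : ℕ} → (Fin j → Fin d) → MvPolynomial (Fin d) ℝ →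
    MvPolynomial (Fin d) ℝ
  | 0, _, p => p
  | _ + 1, w, p => MvPolynomial.pderiv (w 0) (wordDeriv (Fin.tail w) p)

theorem wordDeriv_cons {d j : ℕ} (i : Fin d) (w : Fin j → Fin d) (p : MvPolynomial (Fin d) ℝ) :
    wordDeriv (Fin.cons i w : Fin (j + 1) → Fin d) p = MvPolynomial.pderiv i (wordDeriv w p) := by
  simp [wordDeriv]

theorem wordDeriv_add {d j : ℕ} (w : Fin j → Fin d) (p q : MvPolynomial (Fin d) ℝ) :
    wordDeriv w (p + q) = wordDeriv w p + wordDeriv w q := by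
  induction j with
  | zero => rfl
  | succ j ih => simp [wordDeriv, ih]

/-- The multi-index of a word. -/
def wordIndex {d j : ℕ} (w : Fin j → Fin d) : Fin d →₀ ℕ := ∑ i, Finsupp.single (w i) 1

theorem wordIndex_cons {d j : ℕ} (i : Fin d) (w : Fin j → Fin d) :
    wordIndex (Fin.cons i w : Fin (j + 1) → Fin d) = Finsupp.single i 1 + wordIndex w := by
  simp [wordIndex, Fin.sum_univ_succ]

theorem wordIndex_eq_toFinsupp {d j : ℕ} (w : Fin j → Fin d) :
    Multiset.toFinsupp (List.ofFn w : Multiset (Fin d)) = wordIndex w := by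
  induction j with
  | zero => simp [wordIndex]
  | succ j ih =>
    rw [List.ofFn_succ, ← Multiset.cons_coe, ← Multiset.singleton_add, map_add, ih,
      Multiset.toFinsupp_singleton, wordIndex, wordIndex, Fin.sum_univ_succ]

theorem degree_wordIndex {d j : ℕ} (w : Fin j → Fin d) : (wordIndex w).degree = j := by
  simp [wordIndex, map_sum]

theorem exists_word {d j : ℕ} (α : Fin d →₀ ℕ) (h : α.degree = j) :
    ∃ w : Fin j → Fin d, wordIndex w = α := by
  have hl : (Finsupp.toMultiset α).toList.length = j := by
    rw [Multiset.length_toList, Finsupp.card_toMultiset, ← h]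
    rfl
  subst hl
  refine ⟨(Finsupp.toMultiset α).toList.get, ?_⟩
  rw [← wordIndex_eq_toFinsupp, List.ofFn_get]
  simp

/-- A polynomial of degree at most `j` whose derivatives of order `j` take prescribed values. -/
theorem exists_wordDeriv_eq {d j : ℕ} (c : (Fin j → Fin d) → ℝ)
    (hc : ∀ w w', wordIndex w = wordIndex w' → c w = c w') :
    ∃ p : MvPolynomial (Fin d) ℝ, p.totalDegree ≤ j ∧
      (∀ w : Fin j → Fin d, wordDeriv w p = MvPolynomial.C (c w)) ∧
      (∀ m, j < m → ∀ w : Fin m → Fin d, wordDeriv w p = 0) := by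
  classical
  -- The data `c`, which does not see the order of differentiation, is moved from words to
  -- multi-indices and set to zero in degrees other than `j`.
  let b : (Fin d →₀ ℕ) → ℝ := fun α => if h : α.degree = j then c (exists_word α h).choose else 0
  have hb : ∀ w, b (wordIndex w) = c w := fun w => by
    have h := degree_wordIndex w
    simp only [b, h, dif_pos]
    exact hc _ _ (exists_word _ h).choose_spec
  have hb0 : ∀ α : Fin d →₀ ℕ, α.degree ≠ j → b α = 0 := fun α h => by simp [b, h]
  have hfin : {α : Fin d →₀ ℕ | b α ≠ 0}.Finite := by
    refine (Finset.finite_toSet (Finset.finsuppAntidiag Finset.univ j)).subset fun α hα => ?_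
    have : α.degree = j := by
      by_contra h
      exact hα (hb0 α h)
    simp only [Finset.mem_coe, Finset.mem_finsuppAntidiag, Finset.subset_univ, and_true]
    rw [← this, Finsupp.degree_eq_sum]
  -- The weights `1 / α!` compensate `∂^α x^α = α!`.
  let p : MvPolynomial (Fin d) ℝ :=
    ∑ α ∈ hfin.toFinset, MvPolynomial.monomial α (b α / ∏ i, ((α i).factorial : ℝ))
  have hp : ∀ α, MvPolynomial.coeff α p = b α / ∏ i, ((α i).factorial : ℝ) := fun α => by
    by_cases h : b α = 0 <;> simp [p, MvPolynomial.coeff_sum, MvPolynomial.coeff_monomial, h]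
  -- With coefficients `b α / α!`, differentiation is a shift of the multi-index: the factor `α i +
  -- 1` is absorbed by the factorial.
  have key : ∀ m (w : Fin m → Fin d) α, MvPolynomial.coeff α (wordDeriv w p) =
      b (α + wordIndex w) / ∏ i, ((α i).factorial : ℝ) := by
    intro m
    induction m with
    | zero => intro w α; simp [wordDeriv, wordIndex, hp]
    | succ m ih =>
      intro w (α : Fin d →₀ ℕ)
      have hw : wordIndex w = Finsupp.single (w 0) 1 + wordIndex (Fin.tail w) := by
        rw [← wordIndex_cons, Fin.cons_self_tail]
      have hf : (∏ i, (((α + Finsupp.single (w 0) 1 : Fin d →₀ ℕ) i).factorial : ℝ)) =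
          (α (w 0) + 1) * ∏ i, ((α i).factorial : ℝ) := by
        rw [← Finset.mul_prod_erase _ _ (Finset.mem_univ (w 0)),
          ← Finset.mul_prod_erase Finset.univ (fun i => ((α i).factorial : ℝ))
            (Finset.mem_univ (w 0)), ← mul_assoc]
        congr 1
        · simp [Nat.factorial_succ]
        · refine Finset.prod_congr rfl fun i hi => ?_
          simp [(Finset.ne_of_mem_erase hi).symm]
      have h0 : (∏ i, ((α i).factorial : ℝ)) ≠ 0 :=
        Finset.prod_ne_zero_iff.2 fun i _ => by positivity
      have h1 : ((α (w 0) : ℝ) + 1) ≠ 0 := by positivity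
      rw [wordDeriv, MvPolynomial.coeff_pderiv, ih, hf, hw, add_assoc]
      field_simp
  refine ⟨p, ?_, fun w => ?_, fun m hm w => ?_⟩
  · refine Finset.sup_le fun α hα => ?_
    have : b α ≠ 0 := by
      intro h
      rw [MvPolynomial.mem_support_iff, hp, h] at hα
      simp at hα
    have h2 : α.degree = j := by
      by_contra h
      exact this (hb0 α h)
    exact h2.le
  · ext α
    rw [key, MvPolynomial.coeff_C]
    split_ifs with h
    · subst h; simp [hb]
    · rw [hb0, zero_div]
      rw [map_add, degree_wordIndex]
      intro h'
      exact h (((Finsupp.degree_eq_zero_iff α).1 (by omega)).symm)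
  · ext α
    rw [key, hb0, zero_div, MvPolynomial.coeff_zero]
    rw [map_add, degree_wordIndex]
    omega

/-! ### Normals of a simplex -/

/-- The edges at one vertex span the space. Vector identities on a simplex are checked by pairing
with these edges. -/
theorem eq_zero_of_inner_edges {d : ℕ} (S : Simp d) (j : Fin (d + 1)) {v : Vec d}
    (h : ∀ i, i ≠ j → inner ℝ v (S.points i - S.points j) = 0) : v = 0 := by
  have h1 : vectorSpan ℝ (Set.range S.points) = ⊤ :=
    S.independent.vectorSpan_eq_top_of_card_eq_finrank_add_one (by simp)
  rw [vectorSpan_range_eq_span_range_vsub_right_ne ℝ S.points j] at h1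
  have h2 : v ∈ (⊤ : Submodule ℝ (Vec d))ᗮ := by
    rw [← h1, Submodule.mem_orthogonal']
    intro u hu
    induction hu using Submodule.span_induction with
    | mem x hx => obtain ⟨i, rfl⟩ := hx; exact h i.1 i.2
    | zero => simp
    | add x y _ _ hx hy => rw [inner_add_right, hx, hy, add_zero]
    | smul c x _ hx => rw [inner_smul_right, hx, mul_zero]
  simpa using h2

section Normal

variable {d : ℕ} [NeZero d] (S : Simp d)

theorem norm_normal (j : Fin (d + 1)) : ‖normal S j‖ = 1 := by
  have h := S.height_pos j
  have h2 : ‖S.altitudeFoot j - S.points j‖ = S.height j := by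
    rw [← dist_eq_norm, dist_comm]; rfl
  rw [normal, norm_smul, h2, norm_inv, Real.norm_of_nonneg h.le, inv_mul_cancel₀ h.ne']

theorem inner_normal_self (j : Fin (d + 1)) : inner ℝ (normal S j) (normal S j) = 1 := by
  rw [real_inner_self_eq_norm_sq, norm_normal]; norm_num

theorem height_smul_normal (j : Fin (d + 1)) :
    S.height j • normal S j = S.altitudeFoot j - S.points j := by
  rw [normal, smul_inv_smul₀ (S.height_pos j).ne']

theorem inner_normal_foot {i j : Fin (d + 1)} (h : i ≠ j) :
    inner ℝ (normal S j) (S.points i - S.altitudeFoot j) = 0 := by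
  have := S.inner_vsub_altitudeFoot_vsub_altitudeFoot_eq_zero h.symm
  simp only [vsub_eq_sub] at this
  rw [real_inner_comm] at this
  rw [normal, inner_smul_left, ← neg_sub (S.points j), inner_neg_left, this]
  simp

theorem inner_normal_sub {i j : Fin (d + 1)} (h : i ≠ j) :
    inner ℝ (normal S j) (S.points i - S.points j) = S.height j := by
  have e : S.points i - S.points j = (S.points i - S.altitudeFoot j) + S.height j • normal S j := by
    rw [height_smul_normal]; abel
  rw [e, inner_add_right, inner_normal_foot S h, inner_smul_right, inner_normal_self]
  simp

theorem inner_normal_sub_eq_zero {i l j : Fin (d + 1)} (hi : i ≠ j) (hl : l ≠ j) :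
    inner ℝ (normal S j) (S.points i - S.points l) = 0 := by
  have e : S.points i - S.points l = (S.points i - S.points j) - (S.points l - S.points j) := by abel
  rw [e, inner_sub_right, inner_normal_sub S hi, inner_normal_sub S hl, sub_self]

/-- After removal of its normal part, the vector is orthogonal to the normal and to all directions
in the facet. Every edge at the opposite vertex is a sum of such directions, so the remainder
vanishes. -/
theorem exists_eq_smul_normal (j : Fin (d + 1)) {v : Vec d}
    (h : ∀ i l, i ≠ j → l ≠ j → inner ℝ v (S.points i - S.points l) = 0) :
    v = (inner ℝ v (normal S j) : ℝ) • normal S j := by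
  rw [← sub_eq_zero]
  set w := v - (inner ℝ v (normal S j) : ℝ) • normal S j with hw
  obtain ⟨l, hl⟩ : ∃ l, l ≠ j := exists_ne j
  have hwn : inner ℝ w (normal S j) = 0 := by
    rw [hw, inner_sub_left, inner_smul_left, inner_normal_self]; simp
  have hww : ∀ i i', i ≠ j → i' ≠ j → inner ℝ w (S.points i - S.points i') = 0 := fun i i' hi hi' => by
    rw [hw, inner_sub_left, inner_smul_left, h i i' hi hi', inner_normal_sub_eq_zero S hi hi']
    simp
  have hfoot : inner ℝ w (S.points l - S.altitudeFoot j) = 0 := by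
    have hm : S.points l - S.altitudeFoot j ∈ vectorSpan ℝ (S.points '' {j}ᶜ) :=
      vsub_mem_vectorSpan_of_mem_affineSpan_of_mem_affineSpan
        (subset_affineSpan ℝ _ ⟨l, hl, rfl⟩) (S.altitudeFoot_mem_affineSpan_image_compl j)
    rw [vectorSpan_eq_span_vsub_set_right ℝ (show S.points l ∈ S.points '' {j}ᶜ from ⟨l, hl, rfl⟩)] at hm
    generalize S.points l - S.altitudeFoot j = u at hm ⊢
    induction hm using Submodule.span_induction with
    | mem x hx =>
      obtain ⟨_, ⟨i, hi, rfl⟩, rfl⟩ := hx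
      exact hww i l hi hl
    | zero => simp
    | add x y _ _ hx hy => rw [inner_add_right, hx, hy, add_zero]
    | smul c x _ hx => rw [inner_smul_right, hx, mul_zero]
  refine eq_zero_of_inner_edges S j fun i hi => ?_
  have e : S.points i - S.points j = (S.points i - S.points l) + (S.points l - S.altitudeFoot j) +
      S.height j • normal S j := by
    rw [height_smul_normal]; abel
  rw [e, inner_add_right, inner_add_right, hww i l hi hl, hfoot, inner_smul_right, hwn]
  simp

/-- The vectors `-n_i / h_i` with `i ≠ j` are the gradients of the barycentric coordinates, that is,
the basis dual to the edges at the `j`-th vertex. -/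
theorem sum_inner_smul_normal (j : Fin (d + 1)) (t : Vec d) :
    t = -∑ i ∈ Finset.univ.erase j,
      ((inner ℝ t (S.points i - S.points j) : ℝ) / S.height i) • normal S i := by
  rw [← sub_eq_zero, sub_neg_eq_add]
  refine eq_zero_of_inner_edges S j fun l hl => ?_
  rw [inner_add_left, sum_inner, Finset.sum_eq_single_of_mem l (by simp [hl])]
  · have := inner_normal_sub S hl.symm
    rw [← neg_sub, inner_neg_right] at this
    rw [inner_smul_left, show inner ℝ (normal S l) (S.points l - S.points j) = -S.height l by linarith]
    have := (S.height_pos l).ne'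
    simp
    field_simp
    ring
  · intro i hi hil
    rw [inner_smul_left, inner_normal_sub_eq_zero S hil.symm (Finset.ne_of_mem_erase hi).symm]
    simp

end Normal

/-! ### The normal-tangential component -/

section NT

variable {d : ℕ}

/-- The product of a matrix and a vector, in Euclidean space. -/
def mv (M : Mat d) (v : Vec d) : Vec d := WithLp.toLp 2 (M.mulVec v.ofLp)

theorem mv_mul (M N : Mat d) (v : Vec d) : mv (M * N) v = mv M (mv N v) := by
  simp [mv, Matrix.mulVec_mulVec]

theorem mv_add_left (M N : Mat d) (v : Vec d) : mv (M + N) v = mv M v + mv N v := by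
  simp [mv, Matrix.add_mulVec]

theorem mv_smul_left (c : ℝ) (M : Mat d) (v : Vec d) : mv (c • M) v = c • mv M v := by
  simp [mv, Matrix.smul_mulVec]

theorem mv_add (M : Mat d) (v w : Vec d) : mv M (v + w) = mv M v + mv M w := by
  simp [mv, Matrix.mulVec_add]

theorem mv_sub (M : Mat d) (v w : Vec d) : mv M (v - w) = mv M v - mv M w := by
  simp [mv, Matrix.mulVec_sub]

theorem mv_smul (M : Mat d) (c : ℝ) (v : Vec d) : mv M (c • v) = c • mv M v := by
  simp [mv, Matrix.mulVec_smul]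

theorem mv_one (v : Vec d) : mv 1 v = v := by simp [mv]

theorem mv_apply (M : Mat d) (v : Vec d) (a : Fin d) : mv M v a = ∑ b, M a b * v b := by
  simp [mv, Matrix.mulVec, dotProduct]

theorem inner_mv (M : Mat d) (v w : Vec d) : (inner ℝ (mv M v) w : ℝ) = inner ℝ v (mv M.transpose w) := by
  simp only [PiLp.inner_apply, mv_apply, RCLike.inner_apply, conj_trivial, Finset.mul_sum, Matrix.transpose_apply,
    Finset.sum_mul]
  rw [Finset.sum_comm]
  exact Finset.sum_congr rfl fun _ _ => Finset.sum_congr rfl fun _ _ => by ring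

/-- The tangential part of `w`, for a unit normal `n`. -/
def tang (n w : Vec d) : Vec d := w - (inner ℝ n w : ℝ) • n

theorem nt_eq (M : Mat d) (n : Vec d) : nt M n = tang n (mv M n) := rfl

theorem tang_add (n v w : Vec d) : tang n (v + w) = tang n v + tang n w := by
  simp only [tang, inner_add_right, add_smul]; abel

theorem tang_smul (n : Vec d) (c : ℝ) (v : Vec d) : tang n (c • v) = c • tang n v := by
  simp only [tang, inner_smul_right, mul_smul, smul_sub]

theorem tang_self {n : Vec d} (hn : ‖n‖ = 1) : tang n n = 0 := by
  simp [tang, hn]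

theorem inner_tang {n : Vec d} (hn : ‖n‖ = 1) (w : Vec d) : inner ℝ n (tang n w) = (0 : ℝ) := by
  simp [tang, inner_sub_right, inner_smul_right, hn]

theorem tang_of_inner_eq_zero {n w : Vec d} (h : inner ℝ n w = (0 : ℝ)) : tang n w = w := by
  simp [tang, h]

theorem norm_tang_le {n : Vec d} (hn : ‖n‖ = 1) (w : Vec d) : ‖tang n w‖ ≤ ‖w‖ := by
  have h : ‖w‖ ^ 2 = ‖tang n w‖ ^ 2 + (inner ℝ n w : ℝ) ^ 2 := by
    have e : w = tang n w + (inner ℝ n w : ℝ) • n := by simp [tang]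
    have := norm_add_sq_real (tang n w) ((inner ℝ n w : ℝ) • n)
    rw [← e, inner_smul_right, real_inner_comm n, inner_tang hn, norm_smul, hn] at this
    simpa using this
  nlinarith [norm_nonneg w, norm_nonneg (tang n w), sq_nonneg (inner ℝ n w : ℝ)]

theorem nt_add (M N : Mat d) (n : Vec d) : nt (M + N) n = nt M n + nt N n := by
  simp only [nt_eq, mv_add_left, tang_add]

theorem nt_smul (c : ℝ) (M : Mat d) (n : Vec d) : nt (c • M) n = c • nt M n := by
  simp only [nt_eq, mv_smul_left, tang_smul]

theorem nt_zero (n : Vec d) : nt (0 : Mat d) n = 0 := by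
  simpa using nt_smul 0 (0 : Mat d) n

theorem nt_sub (M N : Mat d) (n : Vec d) : nt (M - N) n = nt M n - nt N n := by
  have := nt_add M ((-1 : ℝ) • N) n
  rw [nt_smul] at this
  simpa [sub_eq_add_neg] using this

theorem nt_sum {ι : Type*} (s : Finset ι) (M : ι → Mat d) (n : Vec d) :
    nt (∑ i ∈ s, M i) n = ∑ i ∈ s, nt (M i) n := by
  classical
  induction s using Finset.induction_on with
  | empty => simp [nt_zero]
  | insert a s ha ih => rw [Finset.sum_insert ha, Finset.sum_insert ha, nt_add, ih]

theorem inner_nt {n : Vec d} (hn : ‖n‖ = 1) (M : Mat d) : inner ℝ n (nt M n) = (0 : ℝ) :=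
  inner_tang hn _

theorem nt_one {n : Vec d} (hn : ‖n‖ = 1) : nt (1 : Mat d) n = 0 := by
  rw [nt_eq, mv_one, tang_self hn]

/-- The matrix `v wᵀ`. -/
def outer (v w : Vec d) : Mat d := Matrix.vecMulVec v.ofLp w.ofLp

theorem mv_outer (v w n : Vec d) : mv (outer v w) n = (inner ℝ w n : ℝ) • v := by
  ext a
  simp [mv_apply, outer, Matrix.vecMulVec_apply, PiLp.inner_apply, mul_assoc, ← Finset.mul_sum,
    mul_comm]

theorem nt_outer (v w n : Vec d) : nt (outer v w) n = (inner ℝ w n : ℝ) • tang n v := by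
  rw [nt_eq, mv_outer, tang_smul]

/-- The squared Frobenius norm. -/
def frobSq (M : Mat d) : ℝ := ∑ a, ∑ b, M a b ^ 2

theorem frobSq_nonneg (M : Mat d) : 0 ≤ frobSq M := by unfold frobSq; positivity

theorem norm_sq_eq_sum (v : Vec d) : ‖v‖ ^ 2 = ∑ a, v a ^ 2 := by
  simp [EuclideanSpace.norm_sq_eq]

theorem norm_mv_sq_le (M : Mat d) (v : Vec d) : ‖mv M v‖ ^ 2 ≤ frobSq M * ‖v‖ ^ 2 := by
  rw [norm_sq_eq_sum, norm_sq_eq_sum, frobSq, Finset.sum_mul]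
  refine Finset.sum_le_sum fun a _ => ?_
  rw [mv_apply]
  exact Finset.sum_mul_sq_le_sq_mul_sq _ _ _

theorem norm_nt_sq_le (M : Mat d) {n : Vec d} (hn : ‖n‖ = 1) : ‖nt M n‖ ^ 2 ≤ frobSq M := by
  have h1 : ‖nt M n‖ ≤ ‖mv M n‖ := norm_tang_le hn _
  have h2 := norm_mv_sq_le M n
  rw [hn] at h2
  nlinarith [norm_nonneg (nt M n)]

theorem frobSq_mul_le (M N : Mat d) : frobSq (M * N) ≤ frobSq M * frobSq N := by
  unfold frobSq
  rw [Finset.sum_mul]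
  refine Finset.sum_le_sum fun a _ => ?_
  rw [Finset.sum_comm, Finset.mul_sum]
  refine Finset.sum_le_sum fun b _ => ?_
  rw [Matrix.mul_apply]
  exact Finset.sum_mul_sq_le_sq_mul_sq _ _ _

theorem frobSq_transpose (M : Mat d) : frobSq M.transpose = frobSq M := by
  unfold frobSq
  rw [Finset.sum_comm]
  rfl

theorem ddot_self (M : Mat d) : ddot M M = frobSq M := by
  simp [ddot, frobSq, sq]

theorem ddot_eq_trace (A B : Mat d) : ddot A B = (A * B.transpose).trace := by
  simp [ddot, Matrix.trace, Matrix.mul_apply]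

/-- The adjoint of conjugation for the Frobenius product. It is what makes the test fields `F η F⁻¹`
dual to the pull-back `Fᵀ τ F⁻ᵀ`. -/
theorem ddot_conj (A B P Q : Mat d) : ddot A (P * B * Q) = ddot (P.transpose * A * Q.transpose) B := by
  rw [ddot_eq_trace, ddot_eq_trace, Matrix.transpose_mul, Matrix.transpose_mul]
  simp only [Matrix.mul_assoc]
  rw [Matrix.trace_mul_comm P.transpose]
  simp only [Matrix.mul_assoc]

theorem ddot_sq_le (A B : Mat d) : ddot A B ^ 2 ≤ frobSq A * frobSq B := by
  have h := Finset.sum_mul_sq_le_sq_mul_sq (Finset.univ : Finset (Fin d × Fin d))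
    (fun p => A p.1 p.2) (fun p => B p.1 p.2)
  simpa [ddot, frobSq, Fintype.sum_prod_type] using h

end NT

/-! ### A right inverse of the normal-tangential trace -/

section Lift

variable {d : ℕ} [NeZero d] (S : Simp d)

/-- The trace-free matrix whose normal-tangential component is the tangential part of `t` on the
facet opposite to the `j`-th vertex and zero on the other facets. -/
def ntLift (j : Fin (d + 1)) (t : Vec d) : Mat d :=
  -- The coefficients are those of `t` in the dual basis of normals, divided by `h_j`, which is the
  -- product of each edge at the `j`-th vertex with `n_j`; hence `M n_j = t`.
  let M : Mat d := ∑ i ∈ Finset.univ.erase j,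
    (-(inner ℝ t (S.points i - S.points j) / (S.height i * S.height j)) : ℝ) •
      outer (normal S i) (S.points i - S.points j)
  -- Removal of the trace is free, since the identity has no normal-tangential component.
  M - (M.trace / d) • 1

theorem trace_ntLift (j : Fin (d + 1)) (t : Vec d) : (ntLift S j t).trace = 0 := by
  have : (d : ℝ) ≠ 0 := Nat.cast_ne_zero.2 (NeZero.ne d)
  simp only [ntLift]
  rw [Matrix.trace_sub, Matrix.trace_smul, Matrix.trace_one, Fintype.card_fin, smul_eq_mul,
    div_mul_cancel₀ _ this, sub_self]

theorem nt_ntLift_self (j : Fin (d + 1)) (t : Vec d) :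
    nt (ntLift S j t) (normal S j) = tang (normal S j) t := by
  have hn := norm_normal S j
  rw [ntLift, nt_sub, nt_smul, nt_one hn, smul_zero, sub_zero, nt_sum]
  conv_rhs => rw [sum_inner_smul_normal S j t]
  have : ∀ s : Finset (Fin (d + 1)), ∀ f : Fin (d + 1) → Vec d,
      tang (normal S j) (-∑ i ∈ s, f i) = ∑ i ∈ s, -tang (normal S j) (f i) := by
    intro s f
    simp only [tang, inner_neg_right, inner_sum, Finset.sum_neg_distrib, Finset.sum_sub_distrib,
      Finset.sum_smul, neg_smul]
    abel
  rw [this]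
  refine Finset.sum_congr rfl fun i hi => ?_
  have hi' := Finset.ne_of_mem_erase hi
  rw [nt_smul, nt_outer, real_inner_comm (normal S j), inner_normal_sub S hi', smul_smul, tang_smul, ← neg_smul]
  congr 1
  have := (S.height_pos j).ne'
  field_simp

/-- Edges at the `j`-th vertex other than the one ending in the `l`-th lie in the `l`-th facet and
are annihilated by `n_l`. The one remaining term is a multiple of `n_l`, which has no tangential
part. -/
theorem nt_ntLift_of_ne {j l : Fin (d + 1)} (h : l ≠ j) (t : Vec d) :
    nt (ntLift S j t) (normal S l) = 0 := by
  have hn := norm_normal S l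
  rw [ntLift, nt_sub, nt_smul, nt_one hn, smul_zero, sub_zero, nt_sum]
  refine Finset.sum_eq_zero fun i hi => ?_
  have hi' := Finset.ne_of_mem_erase hi
  rw [nt_smul, nt_outer, real_inner_comm (normal S l)]
  by_cases hil : i = l
  · subst hil
    rw [tang_self hn]; simp
  · rw [inner_normal_sub_eq_zero S hil h.symm]; simp

theorem isPoly_ntLift (j : Fin (d + 1)) {k : ℕ} {q : Vec d → Vec d}
    (hq : ∀ a, IsPoly k fun x => q x a) (a b : Fin d) : IsPoly k fun x => ntLift S j (q x) a b := by
  have h1 : ∀ i, IsPoly k fun x => (inner ℝ (q x) (S.points i - S.points j) : ℝ) := fun i => by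
    simp only [PiLp.inner_apply, RCLike.inner_apply, conj_trivial]
    exact IsPoly.sum _ fun c _ => (hq c).const_mul _
  have h2 : ∀ a b, IsPoly k fun x => (∑ i ∈ Finset.univ.erase j,
    (-(inner ℝ (q x) (S.points i - S.points j) / (S.height i * S.height j)) : ℝ) •
      outer (normal S i) (S.points i - S.points j)) a b := fun a b => by
    simp only [Matrix.sum_apply, Matrix.smul_apply, smul_eq_mul]
    refine IsPoly.sum _ fun i _ => IsPoly.mul_const _ (IsPoly.neg ?_)
    simp only [div_eq_mul_inv]
    exact (h1 i).mul_const _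
  simp only [ntLift, Matrix.sub_apply, Matrix.smul_apply, smul_eq_mul, Matrix.trace, Matrix.diag]
  refine (h2 a b).sub (IsPoly.mul_const _ ?_)
  simp only [div_eq_mul_inv]
  exact IsPoly.mul_const _ (IsPoly.sum _ fun c _ => h2 c c)

end Lift

/-! ### Affine equivalence of simplices -/

/-- A matrix as a linear map of Euclidean space. -/
def mvLin {d : ℕ} (A : Mat d) : Vec d →ₗ[ℝ] Vec d where
  toFun := mv A
  map_add' := mv_add A
  map_smul' := mv_smul A

/-- The affine map which sends the first vertex of `S` to that of `S'`, with linear part `A`. -/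
def affMap {d : ℕ} (S S' : Simp d) (A : Mat d) : Vec d →ᵃ[ℝ] Vec d where
  toFun x := S'.points 0 + mv A (x - S.points 0)
  linear := mvLin A
  map_vadd' p v := by
    change S'.points 0 + mv A (v + p - S.points 0) = mv A v + (S'.points 0 + mv A (p - S.points 0))
    rw [add_sub_assoc, mv_add]
    abel

/-- `A` and `B` are the linear parts of the affine map from `S` to `S'` that respects the
numbering of the vertices, and of its inverse. -/
structure AffPair {d : ℕ} (S S' : Simp d) (A B : Mat d) : Prop where
  mul_inv : A * B = 1
  inv_mul : B * A = 1
  edges : ∀ i, S'.points i - S'.points 0 = mv A (S.points i - S.points 0)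

/-- The pull-back `Aᵀ τ(φ) A⁻ᵀ` of a matrix field, where `B = A⁻¹`. -/
def pull {d : ℕ} (S S' : Simp d) (A B : Mat d) (τ : Vec d → Mat d) (x : Vec d) : Mat d :=
  A.transpose * τ (affMap S S' A x) * B.transpose

section

variable {d : ℕ} {S S' : Simp d} {A B : Mat d}

theorem affMap_apply (x : Vec d) : affMap S S' A x = S'.points 0 + mv A (x - S.points 0) := rfl

theorem isPoly_affMap (a : Fin d) : IsPoly 1 fun x => affMap S S' A x a := by
  simp only [affMap_apply, PiLp.add_apply, mv_apply, PiLp.sub_apply]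
  exact ((IsPoly.const 1 _).add (IsPoly.sum _ fun b _ => IsPoly.const_mul _
    ((IsPoly.coord b).sub (IsPoly.const 1 _))))

theorem continuous_affMap : Continuous (affMap S S' A) :=
  (affMap S S' A).continuous_of_finiteDimensional

theorem trace_conj (h : B * A = 1) (M : Mat d) :
    (A.transpose * M * B.transpose).trace = M.trace := by
  rw [Matrix.trace_mul_comm, ← Matrix.mul_assoc, ← Matrix.transpose_mul,
    mul_eq_one_comm.1 h, Matrix.transpose_one, Matrix.one_mul]

namespace AffPair

theorem symm (H : AffPair S S' A B) : AffPair S' S B A := by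
  refine ⟨H.inv_mul, H.mul_inv, fun i => ?_⟩
  rw [H.edges, ← mv_mul, H.inv_mul, mv_one]

theorem map_point (H : AffPair S S' A B) (i : Fin (d + 1)) : affMap S S' A (S.points i) = S'.points i := by
  rw [affMap_apply, ← H.edges]; abel

theorem left_inv (H : AffPair S S' A B) (x : Vec d) : affMap S' S B (affMap S S' A x) = x := by
  rw [affMap_apply, affMap_apply, add_sub_cancel_left, ← mv_mul, H.inv_mul, mv_one]; abel

theorem image_body (H : AffPair S S' A B) : affMap S S' A '' body S = body S' := by
  rw [body, AffineMap.image_convexHull, ← Set.range_comp]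
  congr 2
  ext i : 1
  exact H.map_point i

theorem image_facet (H : AffPair S S' A B) (j : Fin (d + 1)) : affMap S S' A '' facet S j = facet S' j := by
  rw [facet, AffineMap.image_convexHull, ← Set.image_comp]
  congr 1
  exact Set.image_congr fun i _ => H.map_point i

theorem map_mem_facet (H : AffPair S S' A B) {j : Fin (d + 1)} {x : Vec d} (hx : x ∈ facet S j) :
    affMap S S' A x ∈ facet S' j := by
  rw [← H.image_facet]; exact Set.mem_image_of_mem _ hx

theorem pull_pull (H : AffPair S S' A B) (τ : Vec d → Mat d) : pull S' S B A (pull S S' A B τ) = τ := by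
  ext1 x
  simp only [pull]
  rw [H.symm.left_inv]
  calc _ = (B.transpose * A.transpose) * τ x * (B.transpose * A.transpose) := by
        simp only [Matrix.mul_assoc]
    _ = τ x := by
        rw [← Matrix.transpose_mul, H.mul_inv, Matrix.transpose_one, Matrix.one_mul, Matrix.mul_one]

/-- Normals are covectors: `A⁻ᵀ n = c n'`, because this vector is orthogonal to the image facet.
Applied to `n`, the conjugated matrix gives `c Aᵀ (M n')`. The part of `M n'` along `n'` goes to a
multiple of `n` and is lost in the tangential projection, so only the normal-tangential part of `M`
on the image facet matters. -/
theorem exists_nt_conj (H : AffPair S S' A B) [NeZero d] (j : Fin (d + 1)) : ∃ c : ℝ, c ^ 2 ≤ frobSq B ∧ ∀ M : Mat d,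
    nt (A.transpose * M * B.transpose) (normal S j) =
      c • tang (normal S j) (mv A.transpose (nt M (normal S' j))) := by
  set n := normal S j
  set n' := normal S' j
  have hn' : ‖n'‖ = 1 := norm_normal _ _
  have hn : ‖n‖ = 1 := norm_normal _ _
  have h1 : mv B.transpose n = (inner ℝ (mv B.transpose n) n' : ℝ) • n' := by
    refine exists_eq_smul_normal S' j fun i l hi hl => ?_
    have e : S'.points i - S'.points l = mv A (S.points i - S.points l) := by
      rw [← sub_sub_sub_cancel_right _ _ (S'.points 0), H.edges, H.edges, ← mv_sub,
        sub_sub_sub_cancel_right]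
    rw [inner_mv, e, Matrix.transpose_transpose, ← mv_mul, H.inv_mul, mv_one]
    exact inner_normal_sub_eq_zero S hi hl
  set c : ℝ := inner ℝ (mv B.transpose n) n'
  have h2 : c • mv A.transpose n' = n := by
    rw [← mv_smul, ← h1, ← mv_mul, ← Matrix.transpose_mul, H.inv_mul, Matrix.transpose_one, mv_one]
  refine ⟨c, ?_, fun M => ?_⟩
  · have h3 := norm_mv_sq_le B.transpose n
    rw [h1, norm_smul, hn', hn, frobSq_transpose] at h3
    simpa using h3
  · have e : mv M n' = nt M n' + (inner ℝ n' (mv M n') : ℝ) • n' := by rw [nt_eq, tang]; abel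
    rw [nt_eq, mv_mul, mv_mul, h1, mv_smul, mv_smul, e, mv_add, smul_add, tang_add, mv_smul,
      smul_comm c, h2, tang_smul _ _ n, tang_self hn, smul_zero, add_zero, tang_smul]

theorem norm_nt_conj_sq_le (H : AffPair S S' A B) [NeZero d] (j : Fin (d + 1)) (M : Mat d) :
    ‖nt (A.transpose * M * B.transpose) (normal S j)‖ ^ 2 ≤
      frobSq A * frobSq B * ‖nt M (normal S' j)‖ ^ 2 := by
  obtain ⟨c, hc, h⟩ := H.exists_nt_conj j
  rw [h, norm_smul, mul_pow, Real.norm_eq_abs, sq_abs]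
  have h1 : ‖tang (normal S j) (mv A.transpose (nt M (normal S' j)))‖ ^ 2 ≤
      frobSq A * ‖nt M (normal S' j)‖ ^ 2 := by
    have := norm_mv_sq_le A.transpose (nt M (normal S' j))
    rw [frobSq_transpose] at this
    exact (pow_le_pow_left₀ (norm_nonneg _) (norm_tang_le (norm_normal S j) _) 2).trans this
  calc _ ≤ frobSq B * (frobSq A * ‖nt M (normal S' j)‖ ^ 2) :=
        mul_le_mul hc h1 (sq_nonneg _) (frobSq_nonneg _)
    _ = _ := by ring

theorem isPoly_pull {k : ℕ} {τ : Vec d → Mat d} (hτ : ∀ a b, IsPoly k fun x => τ x a b)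
    (a b : Fin d) : IsPoly k fun x => pull S S' A B τ x a b := by
  simp only [pull, Matrix.mul_apply]
  exact IsPoly.sum _ fun i _ => IsPoly.mul_const _ (IsPoly.sum _ fun l _ =>
    IsPoly.const_mul _ ((hτ l i).comp isPoly_affMap))

theorem memSigma_pull (H : AffPair S S' A B) [NeZero d] {k : ℕ} {τ : Vec d → Mat d} (hτ : MemSigma k S' τ) :
    MemSigma k S (pull S S' A B τ) := by
  refine ⟨isPoly_pull hτ.poly, fun x => ?_, fun j => ?_⟩
  · rw [pull, trace_conj H.inv_mul, hτ.traceFree]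
  · obtain ⟨q, hq, hqx⟩ := hτ.ntPoly j
    obtain ⟨c, -, hc⟩ := H.exists_nt_conj j
    refine ⟨fun x => c • tang (normal S j) (mv A.transpose (q (affMap S S' A x))), fun a => ?_,
      fun x hx => ?_⟩
    · have h1 : ∀ a, IsPoly (k - 1) fun x => mv A.transpose (q (affMap S S' A x)) a := fun a => by
        simp only [mv_apply]
        exact IsPoly.sum _ fun b _ => IsPoly.const_mul _ ((hq b).comp isPoly_affMap)
      simp only [tang, PiLp.smul_apply, PiLp.sub_apply, smul_eq_mul, PiLp.inner_apply,
        RCLike.inner_apply, conj_trivial]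
      exact IsPoly.const_mul _ ((h1 a).sub (IsPoly.mul_const _
        (IsPoly.sum _ fun b _ => (h1 b).mul_const _)))
    · rw [pull, hc, hqx _ (H.map_mem_facet hx)]

theorem memBubble_pull (H : AffPair S S' A B) [NeZero d] {k : ℕ} {τ : Vec d → Mat d} (hτ : MemBubble k S' τ) :
    MemBubble k S (pull S S' A B τ) := by
  refine ⟨H.memSigma_pull hτ.mem, fun j x hx => ?_⟩
  obtain ⟨c, -, hc⟩ := H.exists_nt_conj j
  rw [pull, hc, hτ.ntZero j _ (H.map_mem_facet hx), tang_of_inner_eq_zero] <;> simp [mv]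

theorem det_ne_zero (H : AffPair S S' A B) : A.det ≠ 0 := by
  intro h
  have := congrArg Matrix.det H.mul_inv
  rw [Matrix.det_mul, h, zero_mul, Matrix.det_one] at this
  exact zero_ne_one this

theorem map_volume (H : AffPair S S' A B) : Measure.map (affMap S S' A) volume =
    ENNReal.ofReal |A.det|⁻¹ • (volume : Measure (Vec d)) := by
  have hdet : LinearMap.det (mvLin A) = A.det := by
    have : mvLin A = ((WithLp.linearEquiv 2 ℝ (Fin d → ℝ)).symm.toLinearMap ∘ₗ
        Matrix.toLin' A) ∘ₗ (WithLp.linearEquiv 2 ℝ (Fin d → ℝ)).symm.symm.toLinearMap := by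
      ext; simp [mvLin, mv]
    rw [this, LinearMap.comp_assoc, LinearMap.det_conj, LinearMap.det_toLin']
  have hdet0 : LinearMap.det (mvLin A) ≠ 0 := by rw [hdet]; exact H.det_ne_zero
  have e : (affMap S S' A : Vec d → Vec d) =
      (fun y => (S'.points 0 - mv A (S.points 0)) + y) ∘ mvLin A := by
    ext1 x
    simp only [affMap_apply, Function.comp, mvLin, LinearMap.coe_mk, AddHom.coe_mk, mv_sub]
    abel
  rw [e, ← Measure.map_map (measurable_const_add _)
    (mvLin A).continuous_of_finiteDimensional.measurable,
    Measure.map_linearMap_addHaar_eq_smul_addHaar _ hdet0, Measure.map_smul, map_add_left_eq_self,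
    hdet, abs_inv]

/-- The affine map, as a homeomorphism. -/
def homeo (H : AffPair S S' A B) : Vec d ≃ₜ Vec d where
  toFun := affMap S S' A
  invFun := affMap S' S B
  left_inv := H.left_inv
  right_inv := H.symm.left_inv
  continuous_toFun := continuous_affMap
  continuous_invFun := continuous_affMap

theorem measurableEmbedding (H : AffPair S S' A B) : MeasurableEmbedding (affMap S S' A) :=
  H.homeo.measurableEmbedding

theorem map_volume_body (H : AffPair S S' A B) : Measure.map (affMap S S' A) (volume.restrict (body S)) =
    ENNReal.ofReal |A.det|⁻¹ • (volume : Measure (Vec d)).restrict (body S') := by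
  have h : body S = affMap S S' A ⁻¹' body S' := by
    rw [← H.image_body, Set.preimage_image_eq _ H.measurableEmbedding.injective]
  rw [h, ← H.measurableEmbedding.restrict_map, H.map_volume, Measure.restrict_smul]

theorem integral_body (H : AffPair S S' A B) (f : Vec d → ℝ) : ∫ x in body S, f (affMap S S' A x) =
    |A.det|⁻¹ * ∫ x in body S', f x := by
  rw [← H.measurableEmbedding.integral_map, H.map_volume_body, integral_smul_measure,
    ENNReal.toReal_ofReal (by positivity), smul_eq_mul]

theorem lintegral_body (H : AffPair S S' A B) (f : Vec d → ℝ≥0∞) : ∫⁻ x in body S, f (affMap S S' A x) =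
    ENNReal.ofReal |A.det|⁻¹ * ∫⁻ x in body S', f x := by
  rw [← H.measurableEmbedding.lintegral_map, H.map_volume_body, lintegral_smul_measure, smul_eq_mul]

end AffPair

end

/-! ### The reference simplex -/

section

variable {d : ℕ} (S : Simp d)

theorem refSimplex_zero : (refSimplex d).points 0 = 0 := rfl

theorem refSimplex_succ (l : Fin d) : (refSimplex d).points l.succ = EuclideanSpace.single l 1 := rfl

theorem affPair_ref : AffPair (refSimplex d) S (jac S) (jac S)⁻¹ := by
  have hedge : ∀ i, S.points i - S.points 0 = mv (jac S) ((refSimplex d).points i - 0) := by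
    intro i
    refine Fin.cases ?_ (fun l => ?_) i
    · simp [refSimplex_zero, mv]
    · ext a
      simp [refSimplex_succ, mv_apply, jac]
  have hu : IsUnit (jac S) := by
    rw [← Matrix.linearIndependent_cols_iff_isUnit]
    have h := (affineIndependent_iff_linearIndependent_vsub ℝ S.points 0).1 S.independent
    have h2 := (linearIndependent_equiv (finSuccAboveEquiv (0 : Fin (d + 1)))).2 h
    have h3 := h2.map' (WithLp.linearEquiv 2 ℝ (Fin d → ℝ)).toLinearMap (LinearEquiv.ker _)
    have e : (jac S).col = (WithLp.linearEquiv 2 ℝ (Fin d → ℝ)).toLinearMap ∘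
        (fun i : {x : Fin (d + 1) // x ≠ 0} => S.points i -ᵥ S.points 0) ∘ finSuccAboveEquiv 0 := by
      ext l a
      simp [jac, Matrix.col, finSuccAboveEquiv]
    rw [e]
    exact h3
  have hdet := (Matrix.isUnit_iff_isUnit_det _).1 hu
  refine ⟨Matrix.mul_nonsing_inv _ hdet, Matrix.nonsing_inv_mul _ hdet, fun i => ?_⟩
  rw [hedge, refSimplex_zero]

theorem toRef_eq (x : Vec d) : toRef S x = affMap S (refSimplex d) (jac S)⁻¹ x := by
  rw [affMap_apply, refSimplex_zero, zero_add]; rfl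

theorem body_ref_subset : body (refSimplex d) ⊆ Metric.closedBall 0 1 := by
  refine convexHull_min ?_ (convex_closedBall _ _)
  rintro _ ⟨i, rfl⟩
  refine Fin.cases ?_ (fun l => ?_) i
  · simp [refSimplex_zero]
  · simp [refSimplex_succ]

theorem isCompact_body : IsCompact (body S) := (Set.finite_range _).isCompact_convexHull ℝ

theorem isCompact_facet (j : Fin (d + 1)) : IsCompact (facet S j) :=
  ((Set.toFinite _).image _).isCompact_convexHull ℝ

theorem point_mem_body (i : Fin (d + 1)) : S.points i ∈ body S :=
  subset_convexHull ℝ _ ⟨i, rfl⟩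

theorem facet_subset_body (j : Fin (d + 1)) : facet S j ⊆ body S :=
  convexHull_mono (Set.image_subset_range _ _)

theorem convex_body : Convex ℝ (body S) := convex_convexHull ℝ _

theorem interior_body_nonempty : (interior (body S)).Nonempty := by
  rw [body, interior_convexHull_nonempty_iff_affineSpan_eq_top]
  exact S.independent.affineSpan_eq_top_iff_card_eq_finrank_add_one.2 (by simp)

theorem frobSq_jac_le {h : ℝ} (hS : Metric.diam (body S) ≤ h) : frobSq (jac S) ≤ d * h ^ 2 := by
  have h1 : frobSq (jac S) = ∑ l : Fin d, ‖S.points l.succ - S.points 0‖ ^ 2 := by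
    simp only [norm_sq_eq_sum, frobSq, jac, Matrix.of_apply]
    exact Finset.sum_comm
  rw [h1]
  calc _ ≤ ∑ l : Fin d, h ^ 2 := Finset.sum_le_sum fun l _ => by
        refine pow_le_pow_left₀ (norm_nonneg _) ?_ 2
        rw [← dist_eq_norm]
        exact (Metric.dist_le_diam_of_mem (isCompact_body S).isBounded (point_mem_body S _)
          (point_mem_body S _)).trans hS
    _ = _ := by simp

/-- The inverse map sends `S` into the unit ball. A diameter of the inscribed ball has length `2ρ`
and an image of length at most `2`, so `F⁻¹` has operator norm at most `1 / ρ`; each of its `d`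
columns obeys this bound. -/
theorem frobSq_jac_inv_le {x : Vec d} {ρ : ℝ} (hρ : 0 < ρ)
    (hS : Metric.closedBall x ρ ⊆ body S) : frobSq (jac S)⁻¹ ≤ d / ρ ^ 2 := by
  have H := affPair_ref S
  have h1 : frobSq (jac S)⁻¹ = ∑ l : Fin d, ‖mv (jac S)⁻¹ (EuclideanSpace.single l 1)‖ ^ 2 := by
    simp only [norm_sq_eq_sum, frobSq, mv_apply]
    rw [Finset.sum_comm]
    simp
  have key : ∀ v : Vec d, ‖v‖ = 1 → ‖mv (jac S)⁻¹ v‖ ^ 2 ≤ 1 / ρ ^ 2 := by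
    intro v hv
    have hm : ∀ s : ℝ, |s| = ρ → ‖affMap S (refSimplex d) (jac S)⁻¹ (x + s • v)‖ ≤ 1 := by
      intro s hs
      have : x + s • v ∈ body S := hS (by simp [norm_smul, hv, hs])
      have h2 := body_ref_subset (H.symm.image_body ▸ Set.mem_image_of_mem _ this)
      simpa using h2
    have e : (2 * ρ) • mv (jac S)⁻¹ v = affMap S (refSimplex d) (jac S)⁻¹ (x + ρ • v) -
        affMap S (refSimplex d) (jac S)⁻¹ (x + (-ρ) • v) := by
      rw [affMap_apply, affMap_apply, add_sub_add_left_eq_sub, ← mv_sub, ← mv_smul]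
      congr 1
      module
    have h3 : ‖(2 * ρ) • mv (jac S)⁻¹ v‖ ≤ 2 := by
      rw [e]
      have a1 := hm ρ (abs_of_pos hρ)
      have a2 := hm (-ρ) (by rw [abs_neg, abs_of_pos hρ])
      exact (norm_sub_le _ _).trans (by linarith)
    rw [norm_smul, Real.norm_of_nonneg (by positivity)] at h3
    rw [le_div_iff₀ (by positivity), ← mul_pow]
    exact pow_le_one₀ (by positivity) (by linarith)
  rw [h1]
  calc _ ≤ ∑ l : Fin d, 1 / ρ ^ 2 := Finset.sum_le_sum fun l _ => key _ (by simp)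
    _ = _ := by simp [div_eq_mul_inv]

theorem abs_det_jac_le {h : ℝ} (hS : Metric.diam (body S) ≤ h) :
    |(jac S).det| ≤ d.factorial * h ^ d := by
  have := Matrix.det_le (A := jac S) (abv := AbsoluteValue.abs) (x := h) fun a l => by
    have h1 : |(jac S) a l| ≤ ‖S.points l.succ - S.points 0‖ := by
      simpa [jac] using PiLp.norm_apply_le (S.points l.succ - S.points 0) a
    refine h1.trans ?_
    rw [← dist_eq_norm]
    exact (Metric.dist_le_diam_of_mem (isCompact_body S).isBounded (point_mem_body S _)
      (point_mem_body S _)).trans hS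
  simpa using this

end

/-! ### Coordinates adapted to a hyperplane -/

/-- Dilation by `r ≥ 1/2` has inverse Jacobian at most `2` per dimension. This is the one change of
variables behind the cone, segment and contraction estimates. -/
theorem lintegral_comp_smul_le {E : Type*} [NormedAddCommGroup E] [NormedSpace ℝ E]
    [FiniteDimensional ℝ E] [MeasurableSpace E] [BorelSpace E] (μ : Measure E) [μ.IsAddHaarMeasure]
    {f : E → ℝ≥0∞} (hf : Measurable f) {r : ℝ} (hr : 1 / 2 ≤ r) :
    ∫⁻ y, f (r • y) ∂μ ≤ 2 ^ Module.finrank ℝ E * ∫⁻ y, f y ∂μ := by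
  have hr0 : r ≠ 0 := by linarith
  have h := lintegral_map (μ := μ) hf (measurable_const_smul r)
  rw [Measure.map_addHaar_smul μ hr0, lintegral_smul_measure] at h
  rw [← h, smul_eq_mul]
  gcongr
  rw [← inv_pow, abs_pow, abs_of_nonneg (by positivity)]
  have h2 : r⁻¹ ≤ 2 := by
    rw [inv_le_comm₀ (by linarith) (by norm_num)]; linarith
  refine (ENNReal.ofReal_le_ofReal (pow_le_pow_left₀ (inv_nonneg.2 (by linarith)) h2 _)).trans ?_
  rw [ENNReal.ofReal_pow (by norm_num)]
  simp

section Hyperplane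

variable {d : ℕ}

/-- The hyperplane orthogonal to `n`. -/
abbrev hyp (n : Vec d) : Submodule ℝ (Vec d) := (ℝ ∙ n)ᗮ

theorem finrank_hyp {n : Vec d} (hn : ‖n‖ = 1) : Module.finrank ℝ (hyp n) = d - 1 := by
  have h0 : n ≠ 0 := by rintro rfl; simp at hn
  have h := (ℝ ∙ n).finrank_add_finrank_orthogonal
  rw [finrank_span_singleton h0, finrank_euclideanSpace_fin] at h
  change 1 + Module.finrank ℝ (hyp n) = d at h
  omega

theorem inner_hyp (n : Vec d) (y : hyp n) : inner ℝ n (y : Vec d) = (0 : ℝ) :=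
  Submodule.mem_orthogonal_singleton_iff_inner_right.1 y.2

theorem isometry_hyp (n p : Vec d) : Isometry fun y : hyp n => p + (y : Vec d) :=
  Isometry.of_dist_eq fun x y => by simp [Subtype.dist_eq]

theorem map_hyp {n : Vec d} (hn : ‖n‖ = 1) (p : Vec d) :
    Measure.map (fun y : hyp n => p + (y : Vec d)) volume =
      (μHE[d - 1] : Measure (Vec d)).restrict (Set.range fun y : hyp n => p + (y : Vec d)) := by
  rw [← InnerProductSpace.euclideanHausdorffMeasure_eq_volume, finrank_hyp hn,
    (isometry_hyp n p).map_euclideanHausdorffMeasure]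

theorem mem_range_hyp {n p x : Vec d} :
    (x ∈ Set.range fun y : hyp n => p + (y : Vec d)) ↔ inner ℝ n (x - p) = (0 : ℝ) := by
  rw [← Submodule.mem_orthogonal_singleton_iff_inner_right]
  exact ⟨by rintro ⟨y, rfl⟩; simp, fun h => ⟨⟨x - p, h⟩, by simp⟩⟩

theorem lintegral_eq_lintegral_hyp {n : Vec d} (hn : ‖n‖ = 1) (p : Vec d) {f : Vec d → ℝ≥0∞}
    (hf : Measurable f) : ∫⁻ x, f x = ∫⁻ t : ℝ, ∫⁻ y : hyp n, f (p + t • n + y) := by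
  have h1 := ((ℝ ∙ n).measurePreserving_measurableEquivProd p).symm
  rw [InnerProductSpace.euclideanHausdorffMeasure_eq_volume] at h1
  rw [← h1.lintegral_comp hf]
  have hm : Measurable fun q : (ℝ ∙ n) × hyp n => f (((ℝ ∙ n).measurableEquivProd p).symm q) :=
    hf.comp ((ℝ ∙ n).measurableEquivProd p).symm.measurable
  rw [Measure.volume_eq_prod, lintegral_prod _ hm.aemeasurable]
  have h2 := (LinearIsometryEquiv.toSpanUnitSingleton (𝕜 := ℝ) n hn).measurePreserving
  rw [← h2.lintegral_comp hm.lintegral_prod_right']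
  simp [add_comm, add_left_comm]

end Hyperplane

/-! ### The surface measure of a facet -/

theorem cone_mem_body {d : ℕ} (S : Simp d) (j : Fin (d + 1)) {x : Vec d} (hx : x ∈ facet S j) {t : ℝ} (ht : t ∈ Set.Icc (0 : ℝ) 1) :
    x + t • (S.points j - x) ∈ body S :=
  (convex_body S).add_smul_sub_mem (facet_subset_body S j hx) (point_mem_body S j) ht

section Surf

variable {d : ℕ} [NeZero d] (S : Simp d) (j : Fin (d + 1))

theorem inner_normal_of_mem_affineSpan {x : Vec d} (hx : x ∈ affineSpan ℝ (S.points '' {j}ᶜ)) :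
    inner ℝ (normal S j) (x - S.altitudeFoot j) = (0 : ℝ) := by
  have h := S.altitudeFoot_mem_affineSpan_image_compl j
  obtain ⟨l, hl⟩ : ∃ l, l ≠ j := exists_ne j
  have hm : x - S.altitudeFoot j ∈ vectorSpan ℝ (S.points '' {j}ᶜ) :=
    vsub_mem_vectorSpan_of_mem_affineSpan_of_mem_affineSpan hx h
  rw [vectorSpan_eq_span_vsub_set_right ℝ (show S.points l ∈ S.points '' {j}ᶜ from ⟨l, hl, rfl⟩)] at hm
  generalize x - S.altitudeFoot j = u at hm ⊢
  induction hm using Submodule.span_induction with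
  | mem x hx =>
    obtain ⟨_, ⟨i, hi, rfl⟩, rfl⟩ := hx
    exact inner_normal_sub_eq_zero S hi hl
  | zero => simp
  | add x y _ _ hx hy => rw [inner_add_right, hx, hy, add_zero]
  | smul c x _ hx => rw [inner_smul_right, hx, mul_zero]

theorem facet_subset_range :
    facet S j ⊆ Set.range fun y : hyp (normal S j) => S.altitudeFoot j + (y : Vec d) := fun x hx => by
  rw [mem_range_hyp]
  exact inner_normal_of_mem_affineSpan S j (convexHull_subset_affineSpan _ hx)

/-- The facet, in the coordinates of its hyperplane. -/
def flatFacet : Set (hyp (normal S j)) :=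
  (fun y : hyp (normal S j) => S.altitudeFoot j + (y : Vec d)) ⁻¹' facet S j

theorem surf_eq_map : surf S j =
    Measure.map (fun y : hyp (normal S j) => S.altitudeFoot j + (y : Vec d))
      (volume.restrict (flatFacet S j)) := by
  have hi := isometry_hyp (normal S j) (S.altitudeFoot j)
  rw [flatFacet, ← hi.isClosedEmbedding.measurableEmbedding.restrict_map,
    map_hyp (norm_normal S j), Measure.restrict_restrict_of_subset (facet_subset_range S j), surf]

theorem isCompact_flatFacet : IsCompact (flatFacet S j) :=
  (isometry_hyp (normal S j) (S.altitudeFoot j)).isClosedEmbedding.isCompact_preimage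
    (isCompact_facet S j)

instance : IsFiniteMeasure (surf S j) := by
  rw [surf_eq_map]
  have : IsFiniteMeasure ((volume : Measure (hyp (normal S j))).restrict (flatFacet S j)) :=
    ⟨by simpa using (isCompact_flatFacet S j).measure_lt_top⟩
  infer_instance

theorem flatFacet_eq_convexHull : flatFacet S j = convexHull ℝ
    ((fun y : hyp (normal S j) => S.altitudeFoot j + (y : Vec d)) ⁻¹' (S.points '' {j}ᶜ)) := by
  have hi := (isometry_hyp (normal S j) (S.altitudeFoot j)).injective
  rw [flatFacet, facet]
  let g : hyp (normal S j) →ᵃ[ℝ] Vec d :=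
    (AffineEquiv.constVAdd ℝ (Vec d) (S.altitudeFoot j)).toAffineMap.comp
      (hyp (normal S j)).subtype.toAffineMap
  have hg : (fun y : hyp (normal S j) => S.altitudeFoot j + (y : Vec d)) = g := rfl
  have h : S.points '' {j}ᶜ ⊆ Set.range g :=
    (subset_convexHull ℝ _).trans (hg ▸ facet_subset_range S j)
  rw [hg] at hi ⊢
  conv_lhs => rw [← Set.image_preimage_eq_of_subset h, ← AffineMap.image_convexHull]
  rw [Set.preimage_image_eq _ hi]

/-- A vector of the hyperplane orthogonal to all edges of the facet is a multiple of the normal,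
hence zero; so the vertices of the facet span its hyperplane affinely. -/
theorem interior_flatFacet_nonempty : (interior (flatFacet S j)).Nonempty := by
  rw [flatFacet_eq_convexHull, interior_convexHull_nonempty_iff_affineSpan_eq_top]
  set Y := (fun y : hyp (normal S j) => S.altitudeFoot j + (y : Vec d)) ⁻¹' (S.points '' {j}ᶜ)
  have hY : ∀ i, i ≠ j → ∃ y ∈ Y, S.altitudeFoot j + (y : Vec d) = S.points i := fun i hi => by
    have h : S.points i ∈ facet S j := subset_convexHull ℝ _ ⟨i, hi, rfl⟩
    obtain ⟨y, hy⟩ := facet_subset_range S j h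
    exact ⟨y, ⟨i, hi, hy.symm⟩, hy⟩
  obtain ⟨l, hl⟩ : ∃ l, l ≠ j := exists_ne j
  obtain ⟨yl, hyl, -⟩ := hY l hl
  refine (AffineSubspace.affineSpan_eq_top_iff_vectorSpan_eq_top_of_nonempty ℝ _ _ ⟨yl, hyl⟩).2 ?_
  rw [← Submodule.orthogonal_eq_bot_iff, Submodule.eq_bot_iff]
  intro v hv
  have h1 : (v : Vec d) = (inner ℝ (v : Vec d) (normal S j) : ℝ) • normal S j := by
    refine exists_eq_smul_normal S j fun i i' hi hi' => ?_
    obtain ⟨y, hy, e⟩ := hY i hi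
    obtain ⟨y', hy', e'⟩ := hY i' hi'
    have := Submodule.inner_left_of_mem_orthogonal (vsub_mem_vectorSpan ℝ hy hy') hv
    rw [← e, ← e', add_sub_add_left_eq_sub]
    exact this
  rw [real_inner_comm, inner_hyp, zero_smul] at h1
  exact_mod_cast h1

/-- A convex set with nonempty interior in its hyperplane lies in the closure of that interior. This
turns vanishing in `L²` of a facet into pointwise vanishing of polynomials on it. -/
theorem eqOn_facet_of_ae {E : Type*} [TopologicalSpace E] [T2Space E] {f g : Vec d → E}
    (hf : Continuous f) (hg : Continuous g) (h : f =ᵐ[surf S j] g) : Set.EqOn f g (facet S j) := by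
  have hi := isometry_hyp (normal S j) (S.altitudeFoot j)
  rw [surf_eq_map] at h
  have h1 := ae_of_ae_map hi.continuous.measurable.aemeasurable h
  have h2 := Measure.eqOn_of_ae_eq h1 (hf.comp hi.continuous).continuousOn
    (hg.comp hi.continuous).continuousOn (by
      have hc : Convex ℝ (flatFacet S j) := by
        rw [flatFacet_eq_convexHull]; exact convex_convexHull ℝ _
      rw [hc.closure_interior_eq_closure_of_nonempty_interior (interior_flatFacet_nonempty S j)]
      exact subset_closure)
  intro x hx
  obtain ⟨y, rfl⟩ := facet_subset_range S j hx
  exact h2 hx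

/-- The half of the simplex next to the facet is swept by the rays towards the opposite vertex. In
these coordinates the volume element is `h_j (1 - t)^(d-1)`, which is at least `h_j / 2^(d-1)` as
long as `t ≤ 1/2`. -/
theorem lintegral_cone_le {f : Vec d → ℝ≥0∞} (hf : Measurable f) :
    ∫⁻ x, (∫⁻ t in Set.Icc (0 : ℝ) (1 / 2), f (x + t • (S.points j - x))) ∂(surf S j) ≤
      ENNReal.ofReal (2 ^ (d - 1) / S.height j) * ∫⁻ x in body S, f x := by
  have hh := S.height_pos j
  have hn := norm_normal S j
  set n := normal S j with hndef
  set p := S.altitudeFoot j with hp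
  have hB : MeasurableSet (body S) := (isCompact_body S).isClosed.measurableSet
  set g := (body S).indicator f with hg
  have hgm : Measurable g := hf.indicator hB
  rw [← lintegral_indicator hB, lintegral_eq_lintegral_hyp hn p hgm]
  -- The point at parameter `t` has depth `t h_j` below the facet and footprint `(1 - t) y` about
  -- the foot of the altitude.
  have hpt : ∀ (y : hyp n) (t : ℝ), (p + (y : Vec d)) + t • (S.points j - (p + (y : Vec d))) =
      p + (-(t * S.height j)) • n + (((1 - t) • y : hyp n) : Vec d) := by
    intro y t
    have e : S.points j = p - S.height j • n := by
      rw [hndef, height_smul_normal]; abel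
    rw [e]
    simp only [Submodule.coe_smul]
    module
  have hmeas : Measurable fun z : Vec d => ∫⁻ t in Set.Icc (0 : ℝ) (1 / 2), f (z + t • (S.points j - z)) := by
    refine Measurable.lintegral_prod_right' (f := fun q : Vec d × ℝ => f (q.1 + q.2 • (S.points j - q.1))) ?_
    exact hf.comp (by fun_prop)
  have hGm : Measurable fun s : ℝ => ∫⁻ y : hyp n, g (p + s • n + y) :=
    Measurable.lintegral_prod_right' (f := fun q : ℝ × hyp n => g (p + q.1 • n + q.2))
      (hgm.comp (by fun_prop))
  rw [surf_eq_map, lintegral_map hmeas (by fun_prop)]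
  calc _ ≤ ∫⁻ y in flatFacet S j, ∫⁻ t in Set.Icc (0 : ℝ) (1 / 2),
          g (p + (-(t * S.height j)) • n + (((1 - t) • y : hyp n) : Vec d)) := by
        refine setLIntegral_mono' (isCompact_flatFacet S j).isClosed.measurableSet fun y hy => ?_
        refine setLIntegral_mono' measurableSet_Icc fun t ht => ?_
        rw [← hpt, hg, Set.indicator_of_mem]
        exact cone_mem_body S j hy ⟨ht.1, ht.2.trans (by norm_num)⟩
    _ ≤ ∫⁻ y : hyp n, ∫⁻ t in Set.Icc (0 : ℝ) (1 / 2),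
          g (p + (-(t * S.height j)) • n + (((1 - t) • y : hyp n) : Vec d)) := setLIntegral_le_lintegral _ _
    _ = ∫⁻ t in Set.Icc (0 : ℝ) (1 / 2), ∫⁻ y : hyp n,
          g (p + (-(t * S.height j)) • n + (((1 - t) • y : hyp n) : Vec d)) := by
        refine lintegral_lintegral_swap (Measurable.aemeasurable ?_)
        exact hgm.comp (by fun_prop)
    _ ≤ ∫⁻ t in Set.Icc (0 : ℝ) (1 / 2), 2 ^ (d - 1) * ∫⁻ y : hyp n,
          g (p + (-(t * S.height j)) • n + (y : Vec d)) := by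
        refine setLIntegral_mono' measurableSet_Icc fun t ht => ?_
        have := lintegral_comp_smul_le (volume : Measure (hyp n))
          (f := fun y => g (p + (-(t * S.height j)) • n + (y : Vec d)))
          (hgm.comp (by fun_prop)) (r := 1 - t) (by linarith [ht.2])
        rwa [finrank_hyp hn] at this
    _ ≤ ∫⁻ t : ℝ, 2 ^ (d - 1) * ∫⁻ y : hyp n,
          g (p + (-(t * S.height j)) • n + (y : Vec d)) := setLIntegral_le_lintegral _ _
    _ = 2 ^ (d - 1) * ∫⁻ t : ℝ, ∫⁻ y : hyp n, g (p + ((-S.height j) • t) • n + (y : Vec d)) := by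
        have hc : Measurable fun t : ℝ => ∫⁻ y : hyp n, g (p + (-(t * S.height j)) • n + y) :=
          hGm.comp (by fun_prop : Measurable fun t : ℝ => -(t * S.height j))
        rw [lintegral_const_mul _ hc]
        simp [mul_comm]
    _ = _ := by
        have h1 := lintegral_map (μ := (volume : Measure ℝ)) hGm (measurable_const_smul (-S.height j))
        rw [Measure.map_addHaar_smul _ (by simpa using hh.ne'), lintegral_smul_measure] at h1
        rw [← h1, smul_eq_mul, ← mul_assoc]
        congr 1
        simp only [Module.finrank_self, pow_one, abs_inv, abs_neg, abs_of_pos hh]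
        rw [div_eq_mul_inv, ENNReal.ofReal_mul (by positivity), ENNReal.ofReal_pow (by norm_num)]
        simp

end Surf

/-- An `L`-Lipschitz map enlarges the `(d-1)`-dimensional Hausdorff measure by at most `L^(d-1)`;
here it is the inverse affine map. The one-sided bound replaces the exact surface Jacobian. -/
theorem AffPair.lintegral_surf_le {d : ℕ} {S S' : Simp d} {A B : Mat d} (H : AffPair S S' A B)
    (j : Fin (d + 1)) {f : Vec d → ℝ≥0∞} (hf : Measurable f) {L : ℝ≥0} (hL : frobSq B ≤ L ^ 2) :
    ∫⁻ x, f (affMap S S' A x) ∂(surf S j) ≤ L ^ (d - 1) * ∫⁻ x, f x ∂(surf S' j) := by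
  have hlip : LipschitzWith L (affMap S' S B) := LipschitzWith.of_dist_le_mul fun x y => by
    rw [dist_eq_norm, affMap_apply, affMap_apply, add_sub_add_left_eq_sub, ← mv_sub,
      sub_sub_sub_cancel_right, dist_eq_norm]
    refine le_of_sq_le_sq ?_ (by positivity)
    rw [mul_pow]
    exact (norm_mv_sq_le B _).trans (by gcongr)
  have hμ : Measure.map (affMap S S' A) (surf S j) ≤ ((L : ℝ≥0∞) ^ (d - 1)) • surf S' j := by
    refine Measure.le_iff.2 fun E hE => ?_
    rw [Measure.map_apply continuous_affMap.measurable hE, Measure.smul_apply, smul_eq_mul, surf, surf,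
      Measure.restrict_apply (continuous_affMap.measurable hE), Measure.restrict_apply hE]
    have e : affMap S S' A ⁻¹' E ∩ facet S j = affMap S' S B '' (E ∩ facet S' j) := by
      rw [← H.symm.image_facet]
      ext x
      constructor
      · rintro ⟨hx, y, hy, rfl⟩
        rw [Set.mem_preimage, H.symm.left_inv] at hx
        exact ⟨y, ⟨hx, hy⟩, rfl⟩
      · rintro ⟨y, ⟨hy, hy'⟩, rfl⟩
        exact ⟨by rwa [Set.mem_preimage, H.symm.left_inv], y, hy', rfl⟩
    rw [e, Measure.euclideanHausdorffMeasure_def, Measure.smul_apply, Measure.smul_apply]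
    have h := hlip.hausdorffMeasure_image_le (d := ((d - 1 : ℕ) : ℝ)) (by positivity) (E ∩ facet S' j)
    rw [ENNReal.rpow_natCast] at h
    simp only [ENNReal.smul_def, smul_eq_mul]
    rw [mul_left_comm]
    gcongr
  rw [← lintegral_map hf continuous_affMap.measurable]
  refine (lintegral_mono' hμ le_rfl).trans ?_
  rw [lintegral_smul_measure, smul_eq_mul]

/-! ### Weak derivatives -/

section Weak

variable {d : ℕ} {U : Set (Vec d)}

/-- The squared `L²` norm. -/
def nsq {E : Type*} [MeasurableSpace E] (μ : Measure E) (f : E → ℝ) : ℝ≥0∞ := ∫⁻ x, ‖f x‖ₑ ^ 2 ∂μ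

theorem nsq_congr {E : Type*} [MeasurableSpace E] {μ : Measure E} {f g : E → ℝ} (h : f =ᵐ[μ] g) :
    nsq μ f = nsq μ g :=
  lintegral_congr_ae (h.mono fun x hx => by simp only [hx])

theorem enorm_add_sq_le {F : Type*} [NormedAddCommGroup F] (a b : F) :
    ‖a + b‖ₑ ^ 2 ≤ 2 * ‖a‖ₑ ^ 2 + 2 * ‖b‖ₑ ^ 2 := by
  have h : ‖a + b‖₊ ^ 2 ≤ 2 * ‖a‖₊ ^ 2 + 2 * ‖b‖₊ ^ 2 := by
    rw [← NNReal.coe_le_coe]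
    push_cast
    have := norm_add_le a b
    nlinarith [norm_nonneg (a + b), sq_nonneg (‖a‖ - ‖b‖), norm_nonneg a, norm_nonneg b]
  simp only [enorm_eq_nnnorm]
  exact_mod_cast h

theorem enorm_sub_sq_le {F : Type*} [NormedAddCommGroup F] (a b : F) :
    ‖a - b‖ₑ ^ 2 ≤ 2 * ‖a‖ₑ ^ 2 + 2 * ‖b‖ₑ ^ 2 := by
  simpa [sub_eq_add_neg] using enorm_add_sq_le a (-b)

theorem nsq_add_le {E : Type*} [MeasurableSpace E] {μ : Measure E} {f g : E → ℝ}
    (hf : AEStronglyMeasurable f μ) :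
    nsq μ (fun x => f x + g x) ≤ 2 * nsq μ f + 2 * nsq μ g := by
  unfold nsq
  rw [← lintegral_const_mul' _ _ (by simp), ← lintegral_const_mul' _ _ (by simp),
    ← lintegral_add_left' ((hf.enorm.pow_const 2).const_mul 2)]
  exact lintegral_mono fun x => enorm_add_sq_le _ _

theorem nsq_neg {E : Type*} [MeasurableSpace E] {μ : Measure E} (f : E → ℝ) :
    nsq μ (fun x => -f x) = nsq μ f := by simp [nsq]

theorem nsq_sub_le {E : Type*} [MeasurableSpace E] {μ : Measure E} {f g : E → ℝ}
    (hf : AEStronglyMeasurable f μ) :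
    nsq μ (fun x => f x - g x) ≤ 2 * nsq μ f + 2 * nsq μ g := by
  simpa only [sub_eq_add_neg, nsq_neg] using nsq_add_le (g := fun x => -g x) hf

theorem memLp_two_iff {E : Type*} [MeasurableSpace E] {μ : Measure E} {f : E → ℝ}
    (hf : AEStronglyMeasurable f μ) : MemLp f 2 μ ↔ nsq μ f < ⊤ := by
  rw [MemLp, eLpNorm_lt_top_iff_lintegral_rpow_enorm_lt_top (by simp) (by simp)]
  simp [hf, nsq]

theorem integrable_mul_test {u φ : Vec d → ℝ} (hu : MemLp u 2 (volume.restrict U))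
    (hφ : Continuous φ) (hc : HasCompactSupport φ) :
    Integrable (fun x => u x * φ x) (volume.restrict U) :=
  hu.integrable_mul (q := 2) (hφ.memLp_of_hasCompactSupport hc)

theorem continuous_partial {φ : Vec d → ℝ} (hφ : ContDiff ℝ ∞ φ) (v : Vec d) :
    Continuous fun x => fderiv ℝ φ x v :=
  (hφ.continuous_fderiv (by simp)).clm_apply continuous_const

theorem contDiff_partial {φ : Vec d → ℝ} (hφ : ContDiff ℝ ∞ φ) (v : Vec d) :
    ContDiff ℝ ∞ fun x => fderiv ℝ φ x v :=
  (hφ.fderiv_right (m := ∞) (by simp)).clm_apply contDiff_const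

theorem hasCompactSupport_partial {φ : Vec d → ℝ} (hc : HasCompactSupport φ) (v : Vec d) :
    HasCompactSupport fun x => fderiv ℝ φ x v := hc.fderiv_apply ℝ v

theorem tsupport_partial {φ : Vec d → ℝ} (v : Vec d) :
    tsupport (fun x => fderiv ℝ φ x v) ⊆ tsupport φ := tsupport_fderiv_apply_subset ℝ v

/-- The fundamental lemma of the calculus of variations. Finite volume makes square integrable
functions integrable on `U`. -/
theorem ae_eq_of_test {g g' : Vec d → ℝ} (hU : IsOpen U) (hfin : volume U ≠ ⊤)
    (hg : MemLp g 2 (volume.restrict U)) (hg' : MemLp g' 2 (volume.restrict U))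
    (h : ∀ φ : Vec d → ℝ, ContDiff ℝ ∞ φ → HasCompactSupport φ → tsupport φ ⊆ U →
      ∫ x in U, g x * φ x = ∫ x in U, g' x * φ x) : g =ᵐ[volume.restrict U] g' := by
  have : IsFiniteMeasure (volume.restrict U) := ⟨by simpa using hfin.lt_top⟩
  have hi : IntegrableOn (fun x => g x - g' x) U := (hg.sub hg').integrable (by norm_num)
  have := hU.ae_eq_zero_of_integral_contDiff_smul_eq_zero hi.locallyIntegrableOn
    (fun φ h1 h2 h3 => by
      have e2 : ∫ x in U, φ x • (g x - g' x) = 0 := by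
        simp only [smul_eq_mul, mul_comm (φ _), sub_mul]
        rw [integral_sub (integrable_mul_test hg h1.continuous h2)
          (integrable_mul_test hg' h1.continuous h2), h φ h1 h2 h3, sub_self]
      rw [← e2, setIntegral_eq_integral_of_forall_compl_eq_zero]
      intro x hx
      rw [image_eq_zero_of_notMem_tsupport fun hx' => hx (h3 hx'), zero_smul])
  rw [Filter.EventuallyEq, ae_restrict_iff' hU.measurableSet]
  filter_upwards [this] with x hx hxU
  exact sub_eq_zero.1 (hx hxU)

namespace IsWeakPartial

variable {i : Fin d} {u v g g' : Vec d → ℝ}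

theorem congr (h : IsWeakPartial U i u g) (huv : u =ᵐ[volume.restrict U] v) :
    IsWeakPartial U i v g := fun φ h1 h2 h3 => by
  rw [← h φ h1 h2 h3]
  exact integral_congr_ae (huv.symm.mono fun x hx => by simp only [hx])

theorem ae_eq (hU : IsOpen U) (hfin : volume U ≠ ⊤) (h : IsWeakPartial U i u g)
    (h' : IsWeakPartial U i u g') (hg : MemLp g 2 (volume.restrict U))
    (hg' : MemLp g' 2 (volume.restrict U)) : g =ᵐ[volume.restrict U] g' := by
  refine ae_eq_of_test hU hfin hg hg' fun φ h1 h2 h3 => ?_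
  have e1 := h φ h1 h2 h3
  rw [h' φ h1 h2 h3] at e1
  linarith

theorem sub (h : IsWeakPartial U i u g) (h' : IsWeakPartial U i v g')
    (hu : MemLp u 2 (volume.restrict U)) (hv : MemLp v 2 (volume.restrict U))
    (hg : MemLp g 2 (volume.restrict U)) (hg' : MemLp g' 2 (volume.restrict U)) :
    IsWeakPartial U i (fun x => u x - v x) (fun x => g x - g' x) := fun φ h1 h2 h3 => by
  have e := continuous_partial h1 (EuclideanSpace.single i (1 : ℝ))
  have e' := hasCompactSupport_partial h2 (EuclideanSpace.single i (1 : ℝ))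
  simp only [sub_mul]
  rw [integral_sub (integrable_mul_test hu e e') (integrable_mul_test hv e e'),
    integral_sub (integrable_mul_test hg h1.continuous h2)
      (integrable_mul_test hg' h1.continuous h2), h φ h1 h2 h3, h' φ h1 h2 h3]
  ring

/-- The support of the test function lies in `U`, so both integrals extend to the whole space, where
there is no boundary term. -/
theorem of_contDiff {ψ : Vec d → ℝ} (hψ : ContDiff ℝ ∞ ψ) :
    IsWeakPartial U i ψ (fun x => fderiv ℝ ψ x (EuclideanSpace.single i 1)) := fun φ h1 h2 h3 => by
  set e : Vec d := EuclideanSpace.single i 1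
  have a1 : ∫ x in U, ψ x * fderiv ℝ φ x e = ∫ x, ψ x * fderiv ℝ φ x e :=
    setIntegral_eq_integral_of_forall_compl_eq_zero fun x hx => by
      rw [image_eq_zero_of_notMem_tsupport fun hx' => hx (h3 (tsupport_partial e hx')), mul_zero]
  have a2 : ∫ x in U, fderiv ℝ ψ x e * φ x = ∫ x, fderiv ℝ ψ x e * φ x :=
    setIntegral_eq_integral_of_forall_compl_eq_zero fun x hx => by
      rw [image_eq_zero_of_notMem_tsupport fun hx' => hx (h3 hx'), mul_zero]
  rw [a1, a2]
  refine integral_mul_fderiv_eq_neg_fderiv_mul_of_integrable ?_ ?_ ?_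
    (fun x _ => hψ.differentiable (by simp) x) (fun x _ => h1.differentiable (by simp) x)
  · exact ((continuous_partial hψ e).mul h1.continuous).integrable_of_hasCompactSupport h2.mul_left
  · exact (hψ.continuous.mul (continuous_partial h1 e)).integrable_of_hasCompactSupport
      (hasCompactSupport_partial h2 e).mul_left
  · exact (hψ.continuous.mul h1.continuous).integrable_of_hasCompactSupport h2.mul_left

end IsWeakPartial

/-! ### Functions with a weak gradient -/

/-- `g` is the weak gradient of `u ∈ H¹(U)`. -/
structure IsWeakGrad (U : Set (Vec d)) (u : Vec d → ℝ) (g : Fin d → Vec d → ℝ) : Prop where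
  memLp : MemLp u 2 (volume.restrict U)
  memLp_grad : ∀ i, MemLp (g i) 2 (volume.restrict U)
  weak : ∀ i, IsWeakPartial U i u (g i)

/-- The squared `H¹` norm. -/
def h1Sq (U : Set (Vec d)) (u : Vec d → ℝ) (g : Fin d → Vec d → ℝ) : ℝ≥0∞ :=
  nsq (volume.restrict U) u + ∑ i, nsq (volume.restrict U) (g i)

/-- The classical gradient. -/
def grad (φ : Vec d → ℝ) (i : Fin d) (x : Vec d) : ℝ := fderiv ℝ φ x (EuclideanSpace.single i 1)

theorem IsWeakGrad.sub {u v : Vec d → ℝ} {g g' : Fin d → Vec d → ℝ} (h : IsWeakGrad U u g)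
    (h' : IsWeakGrad U v g') : IsWeakGrad U (fun x => u x - v x) (fun i x => g i x - g' i x) :=
  ⟨h.memLp.sub h'.memLp, fun i => (h.memLp_grad i).sub (h'.memLp_grad i), fun i =>
    (h.weak i).sub (h'.weak i) h.memLp h'.memLp (h.memLp_grad i) (h'.memLp_grad i)⟩

theorem _root_.Continuous.memLp_of_isBounded {φ : Vec d → ℝ} (hφ : Continuous φ)
    (hU : Bornology.IsBounded U) (p : ℝ≥0∞) : MemLp φ p (volume.restrict U) := by
  have hK : IsCompact (closure U) := hU.isCompact_closure
  obtain ⟨C, hC⟩ := hK.exists_bound_of_continuousOn hφ.continuousOn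
  have : IsFiniteMeasure (volume.restrict (closure U)) := ⟨by simpa using hK.measure_lt_top⟩
  have h : MemLp φ p (volume.restrict (closure U)) :=
    MemLp.of_bound hφ.aestronglyMeasurable C
      ((ae_restrict_iff' isClosed_closure.measurableSet).2 (ae_of_all _ hC))
  exact h.mono_measure (Measure.restrict_mono subset_closure le_rfl)

theorem IsWeakGrad.of_contDiff (hU : Bornology.IsBounded U) {φ : Vec d → ℝ} (hφ : ContDiff ℝ ∞ φ) :
    IsWeakGrad U φ (grad φ) :=
  ⟨hφ.continuous.memLp_of_isBounded hU 2, fun _ =>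
    (continuous_partial hφ _).memLp_of_isBounded hU 2, fun _ => IsWeakPartial.of_contDiff hφ⟩

theorem sum_words_succ {M : Type*} [AddCommMonoid M] {j : ℕ} (f : (Fin (j + 1) → Fin d) → M) :
    ∑ w, f w = ∑ i, ∑ w : Fin j → Fin d, f (Fin.cons i w : Fin (j + 1) → Fin d) := by
  rw [← (Fin.consEquiv fun _ => Fin d).sum_comp, Fintype.sum_prod_type]
  rfl

theorem sum_words_zero {M : Type*} [AddCommMonoid M] (f : (Fin 0 → Fin d) → M) :
    ∑ w, f w = f Fin.elim0 := by
  rw [Fintype.sum_unique]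
  exact congrArg f (Subsingleton.elim _ _)

theorem jetNormSq_one (G : (j : ℕ) → (Fin j → Fin d) → Vec d → ℝ) :
    jetNormSq U 1 G = h1Sq U (G 0 Fin.elim0)
      (fun i => G 1 (Fin.cons i Fin.elim0 : Fin 1 → Fin d)) := by
  simp only [jetNormSq, Nat.floor_one, Finset.sum_range_succ, Finset.sum_range_zero, zero_add,
    Int.fract_one, if_true, add_zero, sum_words_succ, sum_words_zero]
  rfl

theorem IsWeakJet.isWeakGrad {n : ℕ} {u : Vec d → ℝ}
    {G : (j : ℕ) → (Fin j → Fin d) → Vec d → ℝ} (h : IsWeakJet U n u G) (hn : 1 ≤ n) :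
    IsWeakGrad U u (fun i => G 1 (Fin.cons i Fin.elim0 : Fin 1 → Fin d)) :=
  ⟨(h.memLp 0 (Nat.zero_le _) _).ae_eq h.zero, fun _ => h.memLp 1 hn _, fun i =>
    (h.succ 0 hn Fin.elim0 i).congr h.zero⟩

/-- Weak partial derivatives are unique almost everywhere, so all admissible jets give the same
value and the infimum is the norm of the gradient at hand. -/
theorem IsWeakGrad.sobolevNormSq_one (hU : IsOpen U) (hfin : volume U ≠ ⊤) {u : Vec d → ℝ}
    {g : Fin d → Vec d → ℝ} (h : IsWeakGrad U u g) : sobolevNormSq U 1 u = h1Sq U u g := by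
  unfold sobolevNormSq
  rw [Nat.floor_one]
  refine le_antisymm ?_ (le_iInf₂ fun G hG => ?_)
  · let G : (j : ℕ) → (Fin j → Fin d) → Vec d → ℝ := fun j w =>
      match j, w with
      | 0, _ => u
      | 1, w => g (w 0)
      | _ + 2, _ => 0
    refine (iInf₂_le G ⟨Filter.EventuallyEq.rfl, ?_, ?_⟩).trans (jetNormSq_one G).le
    · intro j hj w
      interval_cases j
      · exact h.memLp
      · exact h.memLp_grad _
    · intro j hj w i
      interval_cases j
      exact h.weak i
  · rw [jetNormSq_one]
    have hG' := hG.isWeakGrad le_rfl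
    unfold h1Sq
    rw [nsq_congr hG.zero]
    refine le_of_eq (congrArg _ (Finset.sum_congr rfl fun i _ => nsq_congr ?_))
    exact (h.weak i).ae_eq hU hfin (hG'.weak i) (h.memLp_grad i) (hG'.memLp_grad i)

theorem MemSobolev.exists_jet {s : ℝ} {u : Vec d → ℝ} (h : MemSobolev U s u) :
    ∃ G, IsWeakJet U ⌊s⌋₊ u G := by
  by_contra hc
  push Not at hc
  simp [MemSobolev, sobolevNormSq, hc] at h

theorem MemSobolev.exists_grad {s : ℝ} (hs : 1 ≤ s) {u : Vec d → ℝ} (h : MemSobolev U s u) :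
    ∃ g, IsWeakGrad U u g := by
  obtain ⟨G, hG⟩ := h.exists_jet
  exact ⟨_, hG.isWeakGrad (by rwa [Nat.one_le_floor_iff])⟩

/-! ### Symmetry of weak derivatives -/

/-- Both sides are tested with `φ` and both derivatives moved onto it; the second derivatives of the
smooth `φ` commute. -/
theorem IsWeakPartial.swap {i l : Fin d} {u gi gl gil gli : Vec d → ℝ} (hU : IsOpen U)
    (hfin : volume U ≠ ⊤) (hi : IsWeakPartial U i u gi) (hl : IsWeakPartial U l u gl)
    (hil : IsWeakPartial U l gi gil) (hli : IsWeakPartial U i gl gli)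
    (h1 : MemLp gil 2 (volume.restrict U)) (h2 : MemLp gli 2 (volume.restrict U)) :
    gil =ᵐ[volume.restrict U] gli := by
  have key : ∀ φ : Vec d → ℝ, ContDiff ℝ ∞ φ → HasCompactSupport φ → tsupport φ ⊆ U →
      ∫ x in U, gil x * φ x = ∫ x in U, gli x * φ x := by
    intro φ a b c
    have e1 := hil φ a b c
    have e2 := hi _ (contDiff_partial a (EuclideanSpace.single l 1))
      (hasCompactSupport_partial b _) ((tsupport_partial _).trans c)
    have e3 := hli φ a b c
    have e4 := hl _ (contDiff_partial a (EuclideanSpace.single i 1))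
      (hasCompactSupport_partial b _) ((tsupport_partial _).trans c)
    have e5 : ∀ x, fderiv ℝ (fun x => fderiv ℝ φ x (EuclideanSpace.single l 1)) x
        (EuclideanSpace.single i 1) = fderiv ℝ (fun x => fderiv ℝ φ x (EuclideanSpace.single i 1)) x
        (EuclideanSpace.single l 1) := fun x => by
      have hd : DifferentiableAt ℝ (fderiv ℝ φ) x :=
        (a.fderiv_right (m := ∞) (by simp)).differentiable (by simp) x
      rw [fderiv_clm_apply hd (differentiableAt_const _), fderiv_clm_apply hd (differentiableAt_const _)]
      simpa using (a.contDiffAt.isSymmSndFDerivAt (by simpa using ENat.LEInfty.out)) _ _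
    simp only [e5] at e2
    linarith
  exact ae_eq_of_test hU hfin h1 h2 key

/-- Words are handled as lists to allow induction over permutations. A transposition of the two
outermost letters is the symmetry of second weak derivatives; a common outermost letter is treated
by uniqueness of weak partials. -/
theorem IsWeakJet.ae_eq_of_perm (hU : IsOpen U) (hfin : volume U ≠ ⊤) {n : ℕ} {u : Vec d → ℝ}
    {G : (j : ℕ) → (Fin j → Fin d) → Vec d → ℝ} (h : IsWeakJet U n u G) {l l' : List (Fin d)}
    (hl : l.Perm l') : ∀ j ≤ n, ∀ w w' : Fin j → Fin d, List.ofFn w = l → List.ofFn w' = l' →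
      G j w =ᵐ[volume.restrict U] G j w' := by
  induction hl with
  | nil =>
    intro j hj w w' hw hw'
    have : j = 0 := by simpa using hw
    subst this
    rw [Subsingleton.elim w w']
  | @cons x l1 l2 _ ih =>
    intro j hj w w' hw hw'
    cases j with
    | zero => simp at hw
    | succ j =>
      rw [List.ofFn_succ, List.cons.injEq] at hw hw'
      have e := ih j (by omega) (Fin.tail w) (Fin.tail w') hw.2 hw'.2
      have a := h.succ j (by omega) (Fin.tail w) x
      have a' := h.succ j (by omega) (Fin.tail w') x
      have := a.ae_eq hU hfin (a'.congr e.symm) (h.memLp _ hj _) (h.memLp _ hj _)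
      rwa [← hw.1, Fin.cons_self_tail, hw.1, ← hw'.1, Fin.cons_self_tail] at this
  | @swap x y l =>
    intro j hj w w' hw hw'
    cases j with
    | zero => simp at hw
    | succ j =>
    cases j with
    | zero => simp [List.ofFn_succ] at hw
    | succ j =>
      rw [List.ofFn_succ, List.cons.injEq, List.ofFn_succ, List.cons.injEq] at hw hw'
      have e : Fin.tail (Fin.tail w) = Fin.tail (Fin.tail w') :=
        List.ofFn_injective (hw.2.2.trans hw'.2.2.symm)
      have a1 := h.succ j (by omega) (Fin.tail (Fin.tail w)) x
      have a2 := h.succ j (by omega) (Fin.tail (Fin.tail w)) y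
      have b1 := h.succ (j + 1) (by omega) (Fin.cons x (Fin.tail (Fin.tail w))) y
      have b2 := h.succ (j + 1) (by omega) (Fin.cons y (Fin.tail (Fin.tail w))) x
      have := a1.swap hU hfin a2 b1 b2 (h.memLp _ hj _) (h.memLp _ hj _)
      have ew : w = Fin.cons y (Fin.cons x (Fin.tail (Fin.tail w)) : Fin (j + 1) → Fin d) := by
        rw [← hw.1, ← hw.2.1]
        exact ((congrArg _ (Fin.cons_self_tail (Fin.tail w))).trans (Fin.cons_self_tail w)).symm
      have ew' : w' = Fin.cons x (Fin.cons y (Fin.tail (Fin.tail w)) : Fin (j + 1) → Fin d) := by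
        rw [e, ← hw'.1, ← hw'.2.1]
        exact ((congrArg _ (Fin.cons_self_tail (Fin.tail w'))).trans (Fin.cons_self_tail w')).symm
      rw [ew, ew']
      exact this
  | @trans l1 l2 l3 h12 _ ih1 ih2 =>
    intro j hj w w' hw hw'
    have hlen : l2.length = j := by rw [← h12.length_eq, ← hw, List.length_ofFn]
    subst hlen
    exact (ih1 _ hj w l2.get hw (List.ofFn_get _)).trans (ih2 _ hj l2.get w' (List.ofFn_get _) hw')

theorem IsWeakJet.ae_eq_of_wordIndex (hU : IsOpen U) (hfin : volume U ≠ ⊤) {n : ℕ} {u : Vec d → ℝ}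
    {G : (j : ℕ) → (Fin j → Fin d) → Vec d → ℝ} (h : IsWeakJet U n u G) {j : ℕ} (hj : j ≤ n)
    {w w' : Fin j → Fin d} (hw : wordIndex w = wordIndex w') :
    G j w =ᵐ[volume.restrict U] G j w' := by
  rw [← wordIndex_eq_toFinsupp, ← wordIndex_eq_toFinsupp] at hw
  exact h.ae_eq_of_perm hU hfin (Multiset.coe_eq_coe.1 (Multiset.toFinsupp.injective hw)) j hj w w'
    rfl rfl

end Weak

/-! ### Density of smooth functions -/

section Density

open scoped Convolution

theorem sq_lintegral_le {E : Type*} [MeasurableSpace E] (ν : Measure E) {f : E → ℝ≥0∞}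
    (hf : AEMeasurable f ν) : (∫⁻ x, f x ∂ν) ^ 2 ≤ ν Set.univ * ∫⁻ x, f x ^ 2 ∂ν := by
  have h := ENNReal.lintegral_mul_le_Lp_mul_Lq ν Real.HolderConjugate.two_two hf
    (aemeasurable_const (b := (1 : ℝ≥0∞)))
  simp only [Pi.mul_apply, mul_one, ENNReal.rpow_ofNat, one_pow, lintegral_one] at h
  refine (pow_le_pow_left₀ zero_le h 2).trans (le_of_eq ?_)
  rw [mul_pow, ← ENNReal.rpow_natCast, ← ENNReal.rpow_mul, ← ENNReal.rpow_natCast, ← ENNReal.rpow_mul]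
  norm_num
  rw [mul_comm]

variable {d : ℕ}

/-- A bump function with support in the ball of radius `ε`. -/
def mol (d : ℕ) {ε : ℝ} (hε : 0 < ε) : ContDiffBump (0 : Vec d) :=
  ⟨ε / 2, ε, half_pos hε, half_lt_self hε⟩

/-- Convolution with a bump function. -/
def mollify {ε : ℝ} (hε : 0 < ε) (f : Vec d → ℝ) : Vec d → ℝ :=
  (mol d hε).normed volume ⋆[ContinuousLinearMap.lsmul ℝ ℝ, volume] f

theorem mollify_apply {ε : ℝ} (hε : 0 < ε) (f : Vec d → ℝ) (x : Vec d) :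
    mollify hε f x = ∫ t, (mol d hε).normed volume t * f (x - t) := rfl

theorem mollify_apply_swap {ε : ℝ} (hε : 0 < ε) (f : Vec d → ℝ) (x : Vec d) :
    mollify hε f x = ∫ y, f y * (mol d hε).normed volume (x - y) := by
  rw [mollify_apply, ← integral_sub_left_eq_self _ volume x]
  simp [mul_comm]

theorem contDiff_mollify {ε : ℝ} (hε : 0 < ε) {f : Vec d → ℝ} (hf : LocallyIntegrable f) :
    ContDiff ℝ ∞ (mollify hε f) :=
  (mol d hε).hasCompactSupport_normed.contDiff_convolution_left _ (mol d hε).contDiff_normed hf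

theorem mollify_sub {ε : ℝ} (hε : 0 < ε) {f g : Vec d → ℝ} (hf : LocallyIntegrable f)
    (hg : LocallyIntegrable g) (x : Vec d) :
    mollify hε (fun y => f y - g y) x = mollify hε f x - mollify hε g x := by
  have hc := (mol d hε).hasCompactSupport_normed (μ := volume)
  have hcont := (mol d hε).continuous_normed (μ := volume)
  have h1 := hc.convolutionExists_left (ContinuousLinearMap.lsmul ℝ ℝ) hcont hf x
  have h2 := hc.convolutionExists_left (ContinuousLinearMap.lsmul ℝ ℝ) hcont hg x
  have := integral_sub h1 h2
  simp only [mollify_apply]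
  simpa [mul_sub] using this

/-- The mollifier is a probability density: Cauchy-Schwarz for this measure at each point, then
Tonelli and translation invariance. -/
theorem nsq_mollify_le {ε : ℝ} (hε : 0 < ε) {f : Vec d → ℝ} (hf : AEStronglyMeasurable f) :
    nsq volume (mollify hε f) ≤ nsq volume f := by
  set φ := (mol d hε).normed volume
  have hφm : Measurable fun t => ENNReal.ofReal (φ t) :=
    ENNReal.measurable_ofReal.comp ((mol d hε).continuous_normed (μ := volume)).measurable
  set ν : Measure (Vec d) := volume.withDensity fun t => ENNReal.ofReal (φ t) with hν
  have hν1 : ν Set.univ = 1 := by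
    rw [hν, withDensity_apply _ MeasurableSet.univ, Measure.restrict_univ,
      ← ofReal_integral_eq_lintegral_ofReal (mol d hε).integrable_normed
        (ae_of_all _ (mol d hε).nonneg_normed), (mol d hε).integral_normed, ENNReal.ofReal_one]
  have hνac : ν ≪ volume := withDensity_absolutelyContinuous _ _
  have hpt : ∀ x, ‖mollify hε f x‖ₑ ^ 2 ≤ ∫⁻ t, ENNReal.ofReal (φ t) * ‖f (x - t)‖ₑ ^ 2 := by
    intro x
    have hfm : AEMeasurable (fun t => f (x - t)) volume :=
      (hf.comp_quasiMeasurePreserving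
        (quasiMeasurePreserving_sub_left_of_right_invariant volume x)).aemeasurable
    have h1 : ‖mollify hε f x‖ₑ ≤ ∫⁻ t, ‖f (x - t)‖ₑ ∂ν := by
      rw [mollify_apply]
      refine (enorm_integral_le_lintegral_enorm _).trans (le_of_eq ?_)
      rw [hν, lintegral_withDensity_eq_lintegral_mul₀ hφm.aemeasurable hfm.enorm]
      refine lintegral_congr fun t => ?_
      rw [enorm_mul, Pi.mul_apply, Real.enorm_eq_ofReal ((mol d hε).nonneg_normed t)]
    refine (pow_le_pow_left₀ zero_le h1 2).trans ?_
    refine (sq_lintegral_le ν (hfm.enorm.mono_ac hνac)).trans (le_of_eq ?_)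
    rw [hν1, one_mul, hν, lintegral_withDensity_eq_lintegral_mul₀ hφm.aemeasurable (hfm.enorm.pow_const 2)]
    rfl
  calc nsq volume (mollify hε f)
      ≤ ∫⁻ x, ∫⁻ t, ENNReal.ofReal (φ t) * ‖f (x - t)‖ₑ ^ 2 := lintegral_mono hpt
    _ = ∫⁻ t, ∫⁻ x, ENNReal.ofReal (φ t) * ‖f (x - t)‖ₑ ^ 2 := by
        refine lintegral_lintegral_swap ?_
        refine (hφm.comp measurable_snd).aemeasurable.mul (AEMeasurable.pow_const ?_ 2)
        exact (hf.comp_quasiMeasurePreserving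
          (quasiMeasurePreserving_sub volume volume)).enorm
    _ = ∫⁻ t, ENNReal.ofReal (φ t) * nsq volume f := by
        refine lintegral_congr fun t => ?_
        rw [lintegral_const_mul' _ _ ENNReal.ofReal_ne_top,
          lintegral_sub_right_eq_self (fun x => ‖f x‖ₑ ^ 2) t]
        rfl
    _ = nsq volume f := by
        rw [lintegral_mul_const _ hφm]
        have : ∫⁻ t, ENNReal.ofReal (φ t) = ν Set.univ := by
          rw [hν, withDensity_apply _ MeasurableSet.univ, Measure.restrict_univ]
        rw [this, hν1, one_mul]

/-- The mollification of the `l`-th contraction towards `x₀`. -/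
def approx (x₀ : Vec d) {r : ℝ} (hr : 0 < r) (l : ℕ) (f : Vec d → ℝ) (x : Vec d) : ℝ :=
  mollify (ε := (1 / ((l : ℝ) + 2)) * r) (by positivity) f (x₀ + (1 - 1 / ((l : ℝ) + 2)) • (x - x₀))

/-- Since `1 / (l + 2) ≤ 1/2`, the contraction ratio is at least `1/2` and the change of variables
costs at most `2^d`, uniformly in `l`. -/
theorem nsq_approx_le (x₀ : Vec d) {r : ℝ} (hr : 0 < r) (l : ℕ) {f : Vec d → ℝ}
    (hf : LocallyIntegrable f) : nsq volume (approx x₀ hr l f) ≤ 2 ^ d * nsq volume f := by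
  have hδ : (0 : ℝ) < 1 / ((l : ℝ) + 2) := by positivity
  have hδ2 : 1 / ((l : ℝ) + 2) ≤ 1 / 2 := by
    apply one_div_le_one_div_of_le <;> [norm_num; linarith [Nat.cast_nonneg (α := ℝ) l]]
  set δ := 1 / ((l : ℝ) + 2)
  set v := mollify (ε := δ * r) (by positivity) f with hv
  have hvc : Continuous v := (contDiff_mollify (ε := δ * r) (by positivity) hf).continuous
  have h1 : nsq volume (approx x₀ hr l f) = ∫⁻ x, ‖v (x₀ + (1 - δ) • x)‖ₑ ^ 2 :=
    lintegral_sub_right_eq_self (fun x => ‖v (x₀ + (1 - δ) • x)‖ₑ ^ 2) x₀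
  rw [h1]
  refine (lintegral_comp_smul_le volume (f := fun x => ‖v (x₀ + x)‖ₑ ^ 2)
    ((hvc.measurable.comp (measurable_const_add x₀)).enorm.pow_const 2) (r := 1 - δ)
    (by linarith)).trans ?_
  rw [lintegral_add_left_eq_self (fun x => ‖v x‖ₑ ^ 2) x₀, finrank_euclideanSpace_fin]
  gcongr
  exact nsq_mollify_le _ hf.aestronglyMeasurable

/-- With `δ = 1 / (l + 2)`, the contraction moves a point of `U` by at most `δ |R|` and the
mollifier averages over radius `δ r`. Uniform continuity of `f` then gives uniform convergence on
the bounded set `U`. -/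
theorem tendsto_nsq_approx_of_continuous (x₀ : Vec d) {r : ℝ} (hr : 0 < r) {U : Set (Vec d)}
    (hUb : Bornology.IsBounded U) (hUm : MeasurableSet U) {f : Vec d → ℝ} (hf : Continuous f)
    (hc : HasCompactSupport f) :
    Tendsto (fun l => nsq (volume.restrict U) fun x => approx x₀ hr l f x - f x) atTop (𝓝 0) := by
  obtain ⟨R, hR⟩ := hUb.subset_closedBall x₀
  have huc := hc.uniformContinuous_of_continuous hf
  have hvol : volume U ≠ ⊤ := hUb.measure_lt_top.ne
  rw [ENNReal.tendsto_atTop_zero]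
  intro e he
  obtain ⟨η, hη, hηe⟩ : ∃ η : ℝ, 0 < η ∧ ENNReal.ofReal ((2 * η) ^ 2) * volume U ≤ e := by
    have ht : Tendsto (fun η : ℝ => ENNReal.ofReal ((2 * η) ^ 2) * volume U) (𝓝[>] 0) (𝓝 0) := by
      have : Tendsto (fun η : ℝ => ENNReal.ofReal ((2 * η) ^ 2) * volume U) (𝓝 0)
          (𝓝 (ENNReal.ofReal ((2 * 0) ^ 2) * volume U)) :=
        ENNReal.Tendsto.mul_const (ENNReal.tendsto_ofReal
          ((by fun_prop : Continuous fun η : ℝ => (2 * η) ^ 2).tendsto 0)) (Or.inr hvol)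
      simp only [mul_zero, ne_eq, OfNat.ofNat_ne_zero, not_false_eq_true, zero_pow,
        ENNReal.ofReal_zero, zero_mul] at this
      exact this.mono_left nhdsWithin_le_nhds
    obtain ⟨η, h1, h2⟩ := ((ht.eventually (ge_mem_nhds he)).and self_mem_nhdsWithin).exists
    exact ⟨η, h2, h1⟩
  obtain ⟨s, hs, hsu⟩ := Metric.uniformContinuous_iff.1 huc η hη
  have hlim : Tendsto (fun l : ℕ => 1 / ((l : ℝ) + 2) * (|R| + r)) atTop (𝓝 0) := by
    have h1 : Tendsto (fun l : ℕ => 1 / ((l : ℝ) + 2)) atTop (𝓝 0) := by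
      have := (tendsto_add_atTop_iff_nat 1).2 (tendsto_one_div_add_atTop_nhds_zero_nat (𝕜 := ℝ))
      refine this.congr fun l => ?_
      push_cast; ring_nf
    simpa using h1.mul_const (|R| + r)
  obtain ⟨N, hN⟩ := (hlim.eventually (gt_mem_nhds hs)).exists_forall_of_atTop
  refine ⟨N, fun l hl => ?_⟩
  have hsl := hN l hl
  have hδ : (0 : ℝ) < 1 / ((l : ℝ) + 2) := by positivity
  set δ := 1 / ((l : ℝ) + 2) with hδdef
  refine le_trans ?_ hηe
  unfold nsq
  rw [← setLIntegral_const]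
  refine setLIntegral_mono' hUm fun x hx => ?_
  have hxR : ‖x - x₀‖ ≤ |R| := by
    have := hR hx
    rw [Metric.mem_closedBall, dist_eq_norm] at this
    exact this.trans (le_abs_self R)
  set y := x₀ + (1 - δ) • (x - x₀) with hy
  have hyx : dist y x ≤ δ * |R| := by
    rw [dist_eq_norm]
    have : y - x = (-δ) • (x - x₀) := by rw [hy]; module
    rw [this, norm_smul, norm_neg, Real.norm_of_nonneg hδ.le]
    gcongr
  have h1 : dist (approx x₀ hr l f x) (f y) ≤ η := by
    refine (mol d (ε := δ * r) (by positivity)).dist_normed_convolution_le hf.aestronglyMeasurable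
      fun z hz => (hsu ?_).le
    rw [Metric.mem_ball] at hz
    change dist z y < δ * r at hz
    nlinarith [abs_nonneg R]
  have h2 : dist (f y) (f x) ≤ η := (hsu (by nlinarith)).le
  have h3 : ‖approx x₀ hr l f x - f x‖ ≤ 2 * η := by
    rw [← dist_eq_norm]
    exact (dist_triangle _ (f y) _).trans (by linarith)
  rw [← ofReal_norm, ← ENNReal.ofReal_pow (norm_nonneg _)]
  exact ENNReal.ofReal_le_ofReal (pow_le_pow_left₀ (norm_nonneg _) h3 2)

theorem nsq_mono_measure {E : Type*} [MeasurableSpace E] {μ ν : Measure E} (h : μ ≤ ν) (f : E → ℝ) :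
    nsq μ f ≤ nsq ν f := lintegral_mono' h le_rfl

/-- Compactly supported continuous functions are dense in `L²`, and the approximation operators are
bounded uniformly in `l`. -/
theorem tendsto_nsq_approx (x₀ : Vec d) {r : ℝ} (hr : 0 < r) {U : Set (Vec d)}
    (hUb : Bornology.IsBounded U) (hUm : MeasurableSet U) {f : Vec d → ℝ} (hf : MemLp f 2) :
    Tendsto (fun l => nsq (volume.restrict U) fun x => approx x₀ hr l f x - f x) atTop (𝓝 0) := by
  rw [ENNReal.tendsto_atTop_zero]
  intro e he
  -- The factor of `ε²` left by two applications of `(a + b)² ≤ 2a² + 2b²`: `2^d` from the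
  -- approximation of `f - g` and `1` from `f - g` itself.
  set K : ℝ≥0∞ := 4 * 2 ^ d + 4 with hK
  have hK0 : K ≠ 0 := by simp [hK]
  have hKt : K ≠ ⊤ := by finiteness
  obtain ⟨ε, hε, hεe⟩ : ∃ ε : ℝ≥0∞, ε ≠ 0 ∧ K * ε ^ 2 ≤ e / 2 := by
    have ht : Tendsto (fun ε : ℝ≥0∞ => K * ε ^ 2) (𝓝[>] 0) (𝓝 0) := by
      have := ENNReal.Tendsto.const_mul (a := K) (((ENNReal.continuous_pow 2).tendsto 0)) (Or.inr hKt)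
      simp only [ne_eq, OfNat.ofNat_ne_zero, not_false_eq_true, zero_pow, mul_zero] at this
      exact this.mono_left nhdsWithin_le_nhds
    have he2 : (0 : ℝ≥0∞) < e / 2 := ENNReal.half_pos he.ne'
    obtain ⟨ε, h1, h2⟩ := ((ht.eventually (ge_mem_nhds he2)).and self_mem_nhdsWithin).exists
    exact ⟨ε, (ne_of_gt h2), h1⟩
  obtain ⟨g, hgc, hfg, hgcont, hgL⟩ := hf.exists_hasCompactSupport_eLpNorm_sub_le (by simp) hε
  have hnsq : nsq volume (fun x => f x - g x) ≤ ε ^ 2 := by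
    have h1 : nsq volume (fun x => f x - g x) = eLpNorm (f - g) 2 volume ^ 2 := by
      rw [eLpNorm_eq_lintegral_rpow_enorm_toReal (by simp) (by simp), ← ENNReal.rpow_natCast, ← ENNReal.rpow_mul]
      simp [nsq]
    rw [h1]
    gcongr
  have hfl : LocallyIntegrable f := hf.locallyIntegrable (by norm_num)
  have hgl : LocallyIntegrable g := hgL.locallyIntegrable (by norm_num)
  have h0 := tendsto_nsq_approx_of_continuous x₀ hr hUb hUm hgcont hgc
  have he4 : (0 : ℝ≥0∞) < e / 4 := ENNReal.div_pos he.ne' (by simp)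
  obtain ⟨N, hN⟩ := ENNReal.tendsto_atTop_zero.1 h0 (e / 4) he4
  refine ⟨N, fun l hl => ?_⟩
  have hsub : ∀ x, approx x₀ hr l f x - approx x₀ hr l g x =
      approx x₀ hr l (fun y => f y - g y) x := fun x => (mollify_sub _ hfl hgl _).symm
  have hcont : ∀ w : Vec d → ℝ, LocallyIntegrable w → Continuous (approx x₀ hr l w) := fun w hw => by
    unfold approx
    exact (contDiff_mollify _ hw).continuous.comp (by fun_prop)
  have hfgm : AEStronglyMeasurable (fun x => f x - g x) (volume.restrict U) :=
    (hf.1.sub hgL.1).restrict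
  calc nsq (volume.restrict U) (fun x => approx x₀ hr l f x - f x)
      = nsq (volume.restrict U) (fun x => (approx x₀ hr l g x - g x) +
          (approx x₀ hr l (fun y => f y - g y) x - (f x - g x))) := by
        congr 1; ext x; rw [← hsub]; ring
    _ ≤ 2 * nsq (volume.restrict U) (fun x => approx x₀ hr l g x - g x) +
        2 * nsq (volume.restrict U) (fun x => approx x₀ hr l (fun y => f y - g y) x - (f x - g x)) :=
        nsq_add_le ((hcont g hgl).sub hgcont).aestronglyMeasurable
    _ ≤ 2 * (e / 4) + 2 * (2 * (2 ^ d * ε ^ 2) + 2 * ε ^ 2) := by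
        gcongr
        · exact hN l hl
        · refine (nsq_sub_le (hcont _ (hfl.sub hgl)).aestronglyMeasurable).trans ?_
          gcongr
          · refine (nsq_mono_measure Measure.restrict_le_self _).trans
              ((nsq_approx_le x₀ hr l (hfl.sub hgl)).trans ?_)
            gcongr
            exact hnsq
          · exact (nsq_mono_measure Measure.restrict_le_self _).trans hnsq
    _ = e / 2 + K * ε ^ 2 := by
        rw [hK]
        have : 2 * (e / 4) = e / 2 := by
          rw [show (4 : ℝ≥0∞) = 2 * 2 by norm_num, ← mul_div_assoc,
            ENNReal.mul_div_mul_left _ _ (by simp) (by simp)]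
        rw [this]; ring
    _ ≤ e / 2 + e / 2 := by gcongr
    _ = e := ENNReal.add_halves e

/-- The derivative falls on the bump function. Centred at `x`, the reflected bump is supported in
the closed ball of radius `ε`, hence in `U`, and is a legitimate test function for the weak
derivative. -/
theorem grad_mollify {U : Set (Vec d)} (hU : IsOpen U) {u : Vec d → ℝ} {g : Fin d → Vec d → ℝ}
    (h : IsWeakGrad U u g) {ε : ℝ} (hε : 0 < ε) {x : Vec d} (hx : Metric.closedBall x ε ⊆ U)
    (i : Fin d) : fderiv ℝ (mollify hε (U.indicator u)) x (EuclideanSpace.single i 1) =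
      mollify hε (U.indicator (g i)) x := by
  set φ := (mol d hε).normed volume with hφ
  have hφs : ContDiff ℝ ∞ φ := (mol d hε).contDiff_normed
  have hφc : HasCompactSupport φ := (mol d hε).hasCompactSupport_normed
  have hul : LocallyIntegrable (U.indicator u) :=
    ((memLp_indicator_iff_restrict hU.measurableSet).2 h.memLp).locallyIntegrable (by norm_num)
  set e : Vec d := EuclideanSpace.single i 1
  have h1 : fderiv ℝ (mollify hε (U.indicator u)) x e =
      ∫ t, fderiv ℝ φ t e * U.indicator u (x - t) := by
    have hd := hφc.hasFDerivAt_convolution_left (ContinuousLinearMap.lsmul ℝ ℝ)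
      (hφs.of_le (by simp)) hul x
    have hex := (hφc.fderiv ℝ).convolutionExists_left
      ((ContinuousLinearMap.lsmul ℝ ℝ).precompL (Vec d)) (hφs.continuous_fderiv (by simp)) hul x
    have hd' : fderiv ℝ (mollify hε (U.indicator u)) x = _ := hd.fderiv
    rw [hd', convolution_def, ContinuousLinearMap.integral_apply hex]
    rfl
  set ψ : Vec d → ℝ := fun y => φ (x - y) with hψ
  have hψs : ContDiff ℝ ∞ ψ := hφs.comp (contDiff_const.sub contDiff_id)
  have hψsub : tsupport ψ ⊆ Metric.closedBall x ε := by
    refine closure_minimal (fun y hy => ?_) Metric.isClosed_closedBall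
    have : x - y ∈ Function.support φ := hy
    rw [hφ, (mol d hε).support_normed_eq, mem_ball_zero_iff] at this
    rw [Metric.mem_closedBall, dist_comm, dist_eq_norm]
    exact this.le
  have hψc : HasCompactSupport ψ :=
    (isCompact_closedBall x ε).of_isClosed_subset (isClosed_tsupport _) hψsub
  have hψd : ∀ y, fderiv ℝ ψ y e = -fderiv ℝ φ (x - y) e := fun y => by
    have := ((hφs.differentiable (by simp) (x - y)).hasFDerivAt.comp y
      ((hasFDerivAt_id y).const_sub x)).fderiv
    simp only [Function.comp_def] at this
    rw [hψ, this]
    simp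
  have key := h.weak i ψ hψs hψc (hψsub.trans hx)
  have hind : ∀ w θ : Vec d → ℝ, ∫ y, U.indicator w y * θ y = ∫ y in U, w y * θ y := fun w θ => by
    rw [← integral_indicator hU.measurableSet]
    congr 1; ext y
    by_cases hy : y ∈ U <;> simp [hy]
  rw [h1, mollify_apply_swap, hind, ← integral_sub_left_eq_self _ volume x]
  rw [show (∫ y in U, g i y * φ (x - y)) = -∫ y in U, u y * fderiv ℝ ψ y e by rw [key, neg_neg]]
  rw [← hind, ← integral_neg]
  congr 1; ext y
  rw [hψd]
  simp [mul_comm]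

/-- Contraction by `1 - δ` towards an interior point moves each point of `U` to distance more than
`δ r` from the complement, so mollification at radius `δ r` commutes with the weak gradient there.
No extension operator is needed. -/
theorem IsWeakGrad.exists_smooth_tendsto {U : Set (Vec d)} (hU : IsOpen U)
    (hUb : Bornology.IsBounded U) (hUc : Convex ℝ U) (hne : U.Nonempty) {u : Vec d → ℝ}
    {g : Fin d → Vec d → ℝ} (h : IsWeakGrad U u g) :
    ∃ φ : ℕ → Vec d → ℝ, (∀ l, ContDiff ℝ ∞ (φ l)) ∧
      Tendsto (fun l => h1Sq U (fun x => φ l x - u x) (fun i x => grad (φ l) i x - g i x))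
        atTop (𝓝 0) := by
  obtain ⟨x₀, hx₀⟩ := hne
  obtain ⟨r, hr, hball⟩ := Metric.nhds_basis_closedBall.mem_iff.1 (hU.mem_nhds hx₀)
  have hL : ∀ {w : Vec d → ℝ}, MemLp w 2 (volume.restrict U) → MemLp (U.indicator w) 2 := fun hw =>
    (memLp_indicator_iff_restrict hU.measurableSet).2 hw
  have hul : LocallyIntegrable (U.indicator u) := (hL h.memLp).locallyIntegrable (by norm_num)
  refine ⟨fun l => approx x₀ hr l (U.indicator u), fun l => ?_, ?_⟩
  · exact (contDiff_mollify _ hul).comp (by fun_prop)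
  have hae : ∀ w : Vec d → ℝ, U.indicator w =ᵐ[volume.restrict U] w := fun w =>
    (ae_restrict_iff' hU.measurableSet).2 (ae_of_all _ fun x hx => Set.indicator_of_mem hx w)
  have hlim : ∀ w : Vec d → ℝ, MemLp w 2 (volume.restrict U) → Tendsto (fun l =>
      nsq (volume.restrict U) fun x => approx x₀ hr l (U.indicator w) x - w x) atTop (𝓝 0) := by
    intro w hw
    refine (tendsto_nsq_approx x₀ hr hUb hU.measurableSet (hL hw)).congr fun l => ?_
    exact nsq_congr ((hae w).mono fun x hx => by simp only [hx])
  have hgrad : ∀ l i x, x ∈ U → grad (approx x₀ hr l (U.indicator u)) i x =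
      (1 - 1 / ((l : ℝ) + 2)) * approx x₀ hr l (U.indicator (g i)) x := by
    intro l i x hx
    have hδ : (0 : ℝ) < 1 / ((l : ℝ) + 2) := by positivity
    have hδ1 : 1 / ((l : ℝ) + 2) ≤ 1 := by
      rw [div_le_one (by positivity)]; linarith [Nat.cast_nonneg (α := ℝ) l]
    unfold grad approx
    set δ := 1 / ((l : ℝ) + 2)
    -- A point of this ball is `(1 - δ) x + δ b` with `b` in the ball of radius `r` about `x₀`,
    -- which lies in the convex set `U`.
    have hsub : Metric.closedBall (x₀ + (1 - δ) • (x - x₀)) (δ * r) ⊆ U := by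
      intro z hz
      have hb : x₀ + δ⁻¹ • (z - (x₀ + (1 - δ) • (x - x₀))) ∈ U := by
        refine hball ?_
        rw [Metric.mem_closedBall, dist_eq_norm] at hz ⊢
        rw [add_sub_cancel_left, norm_smul, norm_inv, Real.norm_of_nonneg hδ.le,
          inv_mul_le_iff₀ hδ]
        exact hz
      have := hUc hx hb (a := 1 - δ) (b := δ) (by linarith) hδ.le (by ring)
      convert this using 1
      rw [smul_add, smul_smul, mul_inv_cancel₀ hδ.ne']
      module
    rw [← grad_mollify hU h _ hsub]
    have hd : DifferentiableAt ℝ (mollify (ε := δ * r) (by positivity) (U.indicator u))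
        (x₀ + (1 - δ) • (x - x₀)) := (contDiff_mollify _ hul).differentiable (by simp) _
    have hin : HasFDerivAt (fun y : Vec d => x₀ + (1 - δ) • (y - x₀))
        ((1 - δ) • ContinuousLinearMap.id ℝ (Vec d)) x :=
      (((hasFDerivAt_id x).sub_const x₀).const_smul (1 - δ)).const_add x₀
    have := (hd.hasFDerivAt.comp x hin).fderiv
    simp only [Function.comp_def] at this
    rw [this]
    exact map_smul (fderiv ℝ (mollify (ε := δ * r) (by positivity) (U.indicator u))
      (x₀ + (1 - δ) • (x - x₀))) (1 - δ) (EuclideanSpace.single i 1)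
  unfold h1Sq
  rw [show (0 : ℝ≥0∞) = 0 + ∑ i : Fin d, 0 by simp]
  refine (hlim u h.memLp).add (tendsto_finsetSum _ fun i _ => ?_)
  have hgi := h.memLp_grad i
  have hfin : nsq (volume.restrict U) (g i) ≠ ⊤ := ((memLp_two_iff hgi.1).1 hgi).ne
  have hgl : LocallyIntegrable (U.indicator (g i)) := (hL hgi).locallyIntegrable (by norm_num)
  -- The chain rule multiplies the gradient by `1 - δ`. The first term is the approximation error of
  -- `g i`, the second the defect `δ g i`.
  have hup : Tendsto (fun l : ℕ => 2 * nsq (volume.restrict U)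
      (fun x => approx x₀ hr l (U.indicator (g i)) x - g i x) +
      2 * (ENNReal.ofReal ((1 / ((l : ℝ) + 2)) ^ 2) * nsq (volume.restrict U) (g i))) atTop (𝓝 0) := by
    have h1 : Tendsto (fun l : ℕ => (1 / ((l : ℝ) + 2)) ^ 2) atTop (𝓝 0) := by
      have := (tendsto_add_atTop_iff_nat 1).2 (tendsto_one_div_add_atTop_nhds_zero_nat (𝕜 := ℝ))
      have h2 : Tendsto (fun l : ℕ => 1 / ((l : ℝ) + 2)) atTop (𝓝 0) :=
        this.congr fun l => by push_cast; ring_nf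
      simpa using h2.pow 2
    have h2 := ENNReal.Tendsto.mul_const (ENNReal.tendsto_ofReal h1) (Or.inr hfin)
    have h3 := (ENNReal.Tendsto.const_mul (a := 2) (hlim _ hgi) (Or.inr (by simp))).add
      (ENNReal.Tendsto.const_mul (a := 2) h2 (Or.inr (by simp)))
    simpa using h3
  refine tendsto_of_tendsto_of_tendsto_of_le_of_le tendsto_const_nhds hup (fun _ => zero_le) fun l => ?_
  set δ := 1 / ((l : ℝ) + 2)
  have hδ : (0 : ℝ) < δ := by positivity
  have hδ1 : δ ≤ 1 := by
    change 1 / ((l : ℝ) + 2) ≤ 1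
    rw [div_le_one (by positivity)]; linarith [Nat.cast_nonneg (α := ℝ) l]
  have hcont : Continuous (approx x₀ hr l (U.indicator (g i))) :=
    ((contDiff_mollify _ hgl).comp (by fun_prop) : ContDiff ℝ ∞ (approx x₀ hr l _)).continuous
  calc nsq (volume.restrict U) (fun x => grad (approx x₀ hr l (U.indicator u)) i x - g i x)
      = nsq (volume.restrict U) (fun x => (1 - δ) * (approx x₀ hr l (U.indicator (g i)) x - g i x) +
          -(δ * g i x)) := by
        refine nsq_congr ((ae_restrict_iff' hU.measurableSet).2 (ae_of_all _ fun x hx => ?_))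
        beta_reduce
        rw [hgrad l i x hx]
        change (1 - δ) * _ - _ = _
        ring
    _ ≤ 2 * nsq (volume.restrict U) (fun x => (1 - δ) * (approx x₀ hr l (U.indicator (g i)) x - g i x)) +
        2 * nsq (volume.restrict U) (fun x => -(δ * g i x)) :=
        nsq_add_le ((hcont.aestronglyMeasurable.sub hgi.1).const_mul _)
    _ ≤ _ := by
        gcongr
        · unfold nsq
          refine lintegral_mono fun x => ?_
          gcongr
          rw [enorm_mul]
          refine mul_le_of_le_one_left zero_le ?_
          rw [Real.enorm_eq_ofReal (by linarith), ENNReal.ofReal_le_one]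
          linarith
        · rw [nsq_neg]
          unfold nsq
          rw [← lintegral_const_mul' _ _ ENNReal.ofReal_ne_top]
          refine lintegral_mono fun x => le_of_eq ?_
          rw [enorm_mul, mul_pow, Real.enorm_eq_ofReal hδ.le, ENNReal.ofReal_pow hδ.le]

end Density

/-! ### The Poincaré inequality on convex sets -/

section Poincare

variable {d : ℕ}

theorem enorm_sq_eq_ofReal (a : ℝ) : ‖a‖ₑ ^ 2 = ENNReal.ofReal (a ^ 2) := by
  rw [← ofReal_norm, ← ENNReal.ofReal_pow (norm_nonneg _), Real.norm_eq_abs, sq_abs]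

/-- The squared length of the gradient. -/
def gradSq (φ : Vec d → ℝ) (x : Vec d) : ℝ≥0∞ := ∑ i, ‖grad φ i x‖ₑ ^ 2

theorem continuous_grad {φ : Vec d → ℝ} (hφ : ContDiff ℝ ∞ φ) (i : Fin d) : Continuous (grad φ i) :=
  continuous_partial hφ _

theorem measurable_gradSq {φ : Vec d → ℝ} (hφ : ContDiff ℝ ∞ φ) : Measurable (gradSq φ) :=
  Finset.measurable_sum _ fun i _ => ((continuous_grad hφ i).measurable.enorm.pow_const 2)

theorem lintegral_gradSq {φ : Vec d → ℝ} (hφ : ContDiff ℝ ∞ φ) (μ : Measure (Vec d)) :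
    ∫⁻ x, gradSq φ x ∂μ = ∑ i, nsq μ (grad φ i) :=
  lintegral_finsetSum _ fun i _ => ((continuous_grad hφ i).measurable.enorm.pow_const 2)

theorem enorm_fderiv_sq_le (φ : Vec d → ℝ) (x w : Vec d) {h : ℝ} (hw : ‖w‖ ≤ h) :
    ‖fderiv ℝ φ x w‖ₑ ^ 2 ≤ ENNReal.ofReal (h ^ 2) * gradSq φ x := by
  have e : fderiv ℝ φ x w = ∑ i, w i * grad φ i x := by
    conv_lhs => rw [← (EuclideanSpace.basisFun (Fin d) ℝ).sum_repr w]
    simp [grad]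
  have h1 : (fderiv ℝ φ x w) ^ 2 ≤ h ^ 2 * ∑ i, grad φ i x ^ 2 := by
    rw [e]
    refine (Finset.sum_mul_sq_le_sq_mul_sq _ _ _).trans ?_
    rw [← norm_sq_eq_sum]
    gcongr
  simp only [gradSq, enorm_sq_eq_ofReal]
  rw [← ENNReal.ofReal_sum_of_nonneg fun _ _ => sq_nonneg _, ← ENNReal.ofReal_mul (sq_nonneg _)]
  exact ENNReal.ofReal_le_ofReal h1

/-- The fundamental theorem of calculus along a segment, followed by Cauchy-Schwarz in the
parameter. -/
theorem enorm_sub_sq_le_lintegral {φ : Vec d → ℝ} (hφ : ContDiff ℝ ∞ φ) (x w : Vec d) {h : ℝ}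
    (hw : ‖w‖ ≤ h) {T : ℝ} (hT : 0 ≤ T) :
    ‖φ (x + T • w) - φ x‖ₑ ^ 2 ≤
      ENNReal.ofReal T * (ENNReal.ofReal (h ^ 2) * ∫⁻ t in Set.Icc 0 T, gradSq φ (x + t • w)) := by
  have hd : ∀ t : ℝ, HasDerivAt (fun t : ℝ => φ (x + t • w)) (fderiv ℝ φ (x + t • w) w) t := by
    intro t
    have h1 : HasDerivAt (fun t : ℝ => x + t • w) w t := by
      simpa using ((hasDerivAt_id t).smul_const w).const_add x
    exact (hφ.differentiable (by simp) _).hasFDerivAt.comp_hasDerivAt t h1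
  have hc : Continuous fun t : ℝ => fderiv ℝ φ (x + t • w) w :=
    (continuous_partial hφ w).comp (by fun_prop)
  have hftc : ∫ t in (0 : ℝ)..T, fderiv ℝ φ (x + t • w) w = φ (x + T • w) - φ x := by
    rw [intervalIntegral.integral_eq_sub_of_hasDerivAt (fun t _ => hd t) (hc.intervalIntegrable _ _)]
    simp
  rw [← hftc, intervalIntegral.integral_of_le hT, ← integral_Icc_eq_integral_Ioc]
  refine (pow_le_pow_left₀ zero_le (enorm_integral_le_lintegral_enorm _) 2).trans ?_
  refine (sq_lintegral_le _ hc.measurable.enorm.aemeasurable).trans ?_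
  rw [Measure.restrict_apply_univ, Real.volume_Icc, sub_zero]
  refine mul_le_mul' le_rfl ?_
  rw [← lintegral_const_mul' _ _ ENNReal.ofReal_ne_top]
  exact lintegral_mono fun t => enorm_fderiv_sq_le φ _ w hw

/-- The point is `(1 - t) x + t y`. One of the two weights is at least `1/2`, and the variable
carrying it is integrated first; the other contributes the volume of `U`. -/
theorem lintegral_segment_le {U : Set (Vec d)} {F : Vec d → ℝ≥0∞} (hF : Measurable F) {t : ℝ} :
    ∫⁻ x in U, ∫⁻ y in U, F (x + t • (y - x)) ≤ 2 ^ d * volume U * ∫⁻ x, F x := by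
  have key : ∀ (s : ℝ) (z : Vec d), 1 / 2 ≤ s → ∫⁻ y in U, F (z + s • y) ≤ 2 ^ d * ∫⁻ x, F x := by
    intro s z hs
    refine (setLIntegral_le_lintegral _ _).trans ?_
    have := lintegral_comp_smul_le volume (f := fun y => F (z + y)) (by fun_prop) hs
    rwa [finrank_euclideanSpace_fin, lintegral_add_left_eq_self (fun y => F y) z] at this
  by_cases ht : 1 / 2 ≤ t
  · calc _ ≤ ∫⁻ x in U, 2 ^ d * ∫⁻ x, F x := by
          refine lintegral_mono fun x => ?_
          refine le_trans (le_of_eq (lintegral_congr fun y => ?_)) (key t (x - t • x) ht)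
          congr 1; module
      _ = _ := by rw [setLIntegral_const]; ring
  · rw [lintegral_lintegral_swap (by
      refine Measurable.aemeasurable ?_
      exact hF.comp (by fun_prop))]
    calc _ ≤ ∫⁻ x in U, 2 ^ d * ∫⁻ x, F x := by
          refine lintegral_mono fun y => ?_
          refine le_trans (le_of_eq (lintegral_congr fun x => ?_)) (key (1 - t) (t • y) (by linarith))
          congr 1; module
      _ = _ := by rw [setLIntegral_const]; ring

theorem lintegral_sub_sq_le_of_contDiff {U : Set (Vec d)} (hUm : MeasurableSet U)
    (hUc : Convex ℝ U) {h : ℝ} (hd : ∀ x ∈ U, ∀ y ∈ U, ‖y - x‖ ≤ h) {φ : Vec d → ℝ}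
    (hφ : ContDiff ℝ ∞ φ) :
    ∫⁻ x in U, ∫⁻ y in U, ‖φ x - φ y‖ₑ ^ 2 ≤
      ENNReal.ofReal (h ^ 2) * (2 ^ d * volume U * ∑ i, nsq (volume.restrict U) (grad φ i)) := by
  set F := U.indicator (gradSq φ)
  have hF : Measurable F := (measurable_gradSq hφ).indicator hUm
  calc _ ≤ ∫⁻ x in U, ∫⁻ y in U, ENNReal.ofReal (h ^ 2) *
          ∫⁻ t in Set.Icc (0 : ℝ) 1, F (x + t • (y - x)) := by
        refine setLIntegral_mono' hUm fun x hx => setLIntegral_mono' hUm fun y hy => ?_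
        have := enorm_sub_sq_le_lintegral hφ x (y - x) (hd x hx y hy) zero_le_one
        rw [one_smul, add_sub_cancel, ENNReal.ofReal_one, one_mul, ← enorm_neg, neg_sub] at this
        refine this.trans (le_of_eq ?_)
        congr 1
        refine setLIntegral_congr_fun measurableSet_Icc fun t ht => ?_
        exact (Set.indicator_of_mem (hUc.add_smul_sub_mem hx hy ht) _).symm
    _ = ENNReal.ofReal (h ^ 2) * ∫⁻ t in Set.Icc (0 : ℝ) 1, ∫⁻ x in U, ∫⁻ y in U,
          F (x + t • (y - x)) := by
        simp only [lintegral_const_mul' _ _ ENNReal.ofReal_ne_top]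
        congr 1
        have e1 : ∀ x : Vec d, ∫⁻ y in U, ∫⁻ t in Set.Icc (0 : ℝ) 1, F (x + t • (y - x)) =
            ∫⁻ t in Set.Icc (0 : ℝ) 1, ∫⁻ y in U, F (x + t • (y - x)) := fun x =>
          lintegral_lintegral_swap (Measurable.aemeasurable (hF.comp (by fun_prop)))
        simp only [e1]
        refine lintegral_lintegral_swap (Measurable.aemeasurable ?_)
        exact Measurable.lintegral_prod_right' (f := fun q : (Vec d × ℝ) × Vec d =>
          F (q.1.1 + q.1.2 • (q.2 - q.1.1))) (hF.comp (by fun_prop))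
    _ ≤ ENNReal.ofReal (h ^ 2) * ∫⁻ t in Set.Icc (0 : ℝ) 1, 2 ^ d * volume U * ∫⁻ x, F x := by
        gcongr with t
        exact lintegral_segment_le hF
    _ = _ := by
        rw [setLIntegral_const, Real.volume_Icc, sub_zero, ENNReal.ofReal_one, mul_one,
          lintegral_indicator hUm, lintegral_gradSq hφ]

theorem h1Sq_comm {U : Set (Vec d)} (u v : Vec d → ℝ) (g g' : Fin d → Vec d → ℝ) :
    h1Sq U (fun x => u x - v x) (fun i x => g i x - g' i x) =
      h1Sq U (fun x => v x - u x) (fun i x => g' i x - g i x) := by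
  simp only [h1Sq, nsq, enorm_sub_rev]

/-- Only `F` must be measurable: additivity of the lower integral needs one measurable summand. Thus
`a`, which comes from a merely almost everywhere measurable function, may be arbitrary. -/
theorem lintegral_lintegral_add_add {E : Type*} [MeasurableSpace E] {μ : Measure E} [SFinite μ]
    (hμ : μ Set.univ ≠ ⊤) {F : E × E → ℝ≥0∞} (hF : Measurable F) (a : E → ℝ≥0∞) :
    ∫⁻ x, ∫⁻ y, (2 * F (x, y) + (4 * a x + 4 * a y)) ∂μ ∂μ =
      2 * (∫⁻ x, ∫⁻ y, F (x, y) ∂μ ∂μ) + 8 * (μ Set.univ * ∫⁻ x, a x ∂μ) := by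
  have e1 : ∀ x, ∫⁻ y, (2 * F (x, y) + (4 * a x + 4 * a y)) ∂μ =
      2 * (∫⁻ y, F (x, y) ∂μ) + (4 * μ Set.univ * a x + 4 * ∫⁻ y, a y ∂μ) := by
    intro x
    have hFx : Measurable fun y => 2 * F (x, y) := (hF.comp measurable_prodMk_left).const_mul 2
    rw [lintegral_add_left hFx, lintegral_const_mul' _ _ (by simp),
      lintegral_add_left measurable_const, lintegral_const, lintegral_const_mul' _ _ (by simp)]
    ring
  have hm : Measurable fun x => 2 * ∫⁻ y, F (x, y) ∂μ := hF.lintegral_prod_right'.const_mul 2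
  simp only [e1]
  rw [lintegral_add_left hm, lintegral_const_mul' _ _ (by simp),
    lintegral_add_right _ measurable_const, lintegral_const,
    lintegral_const_mul' _ _ (ENNReal.mul_ne_top (by simp) hμ)]
  ring

/-- The smooth estimate is passed to the limit. Two uses of `(a + b)² ≤ 2a² + 2b²`, for the
differences and for the gradients, raise the constant from `2^d` to `2^(d+2)`. -/
theorem IsWeakGrad.lintegral_sub_sq_le {U : Set (Vec d)} (hU : IsOpen U)
    (hUb : Bornology.IsBounded U) (hUc : Convex ℝ U) {h : ℝ}
    (hd : ∀ x ∈ U, ∀ y ∈ U, ‖y - x‖ ≤ h) {u : Vec d → ℝ} {g : Fin d → Vec d → ℝ}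
    (hu : IsWeakGrad U u g) :
    ∫⁻ x in U, ∫⁻ y in U, ‖u x - u y‖ₑ ^ 2 ≤
      ENNReal.ofReal (h ^ 2) * (2 ^ (d + 2) * volume U * ∑ i, nsq (volume.restrict U) (g i)) := by
  rcases U.eq_empty_or_nonempty with rfl | hne
  · simp
  have hvol : volume U ≠ ⊤ := hUb.measure_lt_top.ne
  obtain ⟨φ, hφ, hlim⟩ := hu.exists_smooth_tendsto hU hUb hUc hne
  set E : ℕ → ℝ≥0∞ := fun l => h1Sq U (fun x => φ l x - u x) (fun i x => grad (φ l) i x - g i x)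
  set A : ℝ≥0∞ := ENNReal.ofReal (h ^ 2) * (2 ^ d * volume U) with hA
  have hAt : A ≠ ⊤ := ENNReal.mul_ne_top ENNReal.ofReal_ne_top (ENNReal.mul_ne_top (by finiteness) hvol)
  set N := ∑ i, nsq (volume.restrict U) (g i)
  have hstep : ∀ l, ∫⁻ x in U, ∫⁻ y in U, ‖u x - u y‖ₑ ^ 2 ≤
      2 * (A * (2 * N + 2 * E l)) + 8 * (volume U * E l) := by
    intro l
    have hEu : nsq (volume.restrict U) (fun x => u x - φ l x) ≤ E l := by
      simp only [E]
      rw [h1Sq_comm]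
      exact le_self_add
    have hpt : ∀ x y, ‖u x - u y‖ₑ ^ 2 ≤ 2 * ‖φ l x - φ l y‖ₑ ^ 2 +
        (4 * ‖u x - φ l x‖ₑ ^ 2 + 4 * ‖u y - φ l y‖ₑ ^ 2) := by
      intro x y
      have e : u x - u y = (φ l x - φ l y) + ((u x - φ l x) - (u y - φ l y)) := by ring
      rw [e]
      refine (enorm_add_sq_le _ _).trans ?_
      gcongr
      refine (mul_le_mul_right (enorm_sub_sq_le _ _) 2).trans (le_of_eq ?_)
      ring
    have hcm : Measurable fun q : Vec d × Vec d => ‖φ l q.1 - φ l q.2‖ₑ ^ 2 :=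
      (((hφ l).continuous.comp continuous_fst).sub
        ((hφ l).continuous.comp continuous_snd)).measurable.enorm.pow_const 2
    calc _ ≤ ∫⁻ x in U, ∫⁻ y in U, (2 * ‖φ l x - φ l y‖ₑ ^ 2 +
          (4 * ‖u x - φ l x‖ₑ ^ 2 + 4 * ‖u y - φ l y‖ₑ ^ 2)) :=
          lintegral_mono fun x => lintegral_mono fun y => hpt x y
      _ = 2 * (∫⁻ x in U, ∫⁻ y in U, ‖φ l x - φ l y‖ₑ ^ 2) +
          8 * (volume U * nsq (volume.restrict U) (fun x => u x - φ l x)) := by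
          have := lintegral_lintegral_add_add (μ := volume.restrict U) (by simpa using hvol) hcm
            (fun x => ‖u x - φ l x‖ₑ ^ 2)
          rw [this, Measure.restrict_apply_univ, nsq]
      _ ≤ 2 * (A * (2 * N + 2 * E l)) + 8 * (volume U * E l) := by
          gcongr
          refine (lintegral_sub_sq_le_of_contDiff hU.measurableSet hUc hd (hφ l)).trans ?_
          rw [hA, mul_assoc (ENNReal.ofReal _)]
          gcongr
          calc ∑ i, nsq (volume.restrict U) (grad (φ l) i)
              ≤ ∑ i, (2 * nsq (volume.restrict U) (g i) +
                2 * nsq (volume.restrict U) (fun x => grad (φ l) i x - g i x)) := by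
                refine Finset.sum_le_sum fun i _ => ?_
                refine le_trans (le_of_eq ?_) (nsq_add_le (hu.memLp_grad i).1)
                congr 1; ext x; ring
            _ ≤ _ := by
                rw [Finset.sum_add_distrib, ← Finset.mul_sum, ← Finset.mul_sum]
                gcongr
                exact le_add_self
  have hlim2 : Tendsto (fun l => 2 * (A * (2 * N + 2 * E l)) + 8 * (volume U * E l)) atTop
      (𝓝 (2 * (A * (2 * N + 2 * 0)) + 8 * (volume U * 0))) := by
    refine Tendsto.add ?_ ?_
    · refine ENNReal.Tendsto.const_mul ?_ (Or.inr (by simp))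
      refine ENNReal.Tendsto.const_mul ?_ (Or.inr hAt)
      exact tendsto_const_nhds.add (ENNReal.Tendsto.const_mul hlim (Or.inr (by simp)))
    · exact ENNReal.Tendsto.const_mul (ENNReal.Tendsto.const_mul hlim (Or.inr hvol)) (Or.inr (by simp))
  refine (ge_of_tendsto' hlim2 hstep).trans (le_of_eq ?_)
  rw [hA, pow_add]
  ring

/-- For mean zero the cross term drops out: the inner integral equals `μ(E) u(x)² + ∫ u²`. -/
theorem nsq_le_of_integral_eq_zero {E : Type*} [MeasurableSpace E] {μ : Measure E}
    [IsFiniteMeasure μ] {u : E → ℝ} (hu : MemLp u 2 μ) (h0 : ∫ x, u x ∂μ = 0) :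
    μ Set.univ * nsq μ u ≤ ∫⁻ x, ∫⁻ y, ‖u x - u y‖ₑ ^ 2 ∂μ ∂μ := by
  unfold nsq
  rw [← lintegral_const_mul' _ _ (measure_ne_top _ _)]
  refine lintegral_mono fun x => ?_
  have hi : Integrable u μ := hu.integrable (by norm_num)
  have h2 : Integrable (fun y => u y ^ 2) μ := hu.integrable_sq
  have h3 : Integrable (fun y => (u x - u y) ^ 2) μ := ((memLp_const (u x)).sub hu).integrable_sq
  simp only [enorm_sq_eq_ofReal]
  rw [← ofReal_integral_eq_lintegral_ofReal h3 (ae_of_all _ fun y => sq_nonneg _)]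
  have e : ∫ y, (u x - u y) ^ 2 ∂μ = μ.real Set.univ * u x ^ 2 + ∫ y, u y ^ 2 ∂μ := by
    have : ∀ y, (u x - u y) ^ 2 = (u x ^ 2 - 2 * u x * u y) + u y ^ 2 := fun y => by ring
    simp only [this]
    have hA : Integrable (fun y => u x ^ 2 - 2 * u x * u y) μ :=
      (integrable_const _).sub (hi.const_mul _)
    rw [integral_add hA h2,
      integral_sub (integrable_const _) (hi.const_mul _), integral_const, integral_const_mul, h0]
    simp
  have hp : 0 ≤ ∫ y, u y ^ 2 ∂μ := integral_nonneg fun y => sq_nonneg _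
  rw [e, ← ENNReal.ofReal_toReal (measure_ne_top μ Set.univ), ← ENNReal.ofReal_mul ENNReal.toReal_nonneg]
  exact ENNReal.ofReal_le_ofReal (le_add_of_nonneg_right hp)

theorem IsWeakGrad.poincare {U : Set (Vec d)} (hU : IsOpen U)
    (hUb : Bornology.IsBounded U) (hUc : Convex ℝ U) {h : ℝ}
    (hd : ∀ x ∈ U, ∀ y ∈ U, ‖y - x‖ ≤ h) {u : Vec d → ℝ} {g : Fin d → Vec d → ℝ}
    (hu : IsWeakGrad U u g) (h0 : ∫ x in U, u x = 0) :
    nsq (volume.restrict U) u ≤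
      ENNReal.ofReal (h ^ 2) * (2 ^ (d + 2) * ∑ i, nsq (volume.restrict U) (g i)) := by
  have hvol : volume U ≠ ⊤ := hUb.measure_lt_top.ne
  have : IsFiniteMeasure (volume.restrict U) := ⟨by simpa using hvol.lt_top⟩
  rcases eq_or_ne (volume U) 0 with h00 | h00
  · simp [nsq, Measure.restrict_eq_zero.2 h00]
  have h1 := nsq_le_of_integral_eq_zero hu.memLp h0
  rw [Measure.restrict_apply_univ] at h1
  have h2 := h1.trans (hu.lintegral_sub_sq_le hU hUb hUc hd)
  rw [← ENNReal.mul_le_mul_iff_right h00 hvol]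
  refine h2.trans (le_of_eq ?_)
  ring

end Poincare

/-! ### Traces -/

section Trace

variable {d : ℕ} (S : Simp d) (j : Fin (d + 1))

/-- The scaled squared `H¹` norm. -/
def scaledSq (U : Set (Vec d)) (h : ℝ) (u : Vec d → ℝ) (g : Fin d → Vec d → ℝ) : ℝ≥0∞ :=
  nsq (volume.restrict U) u + ENNReal.ofReal (h ^ 2) * ∑ i, nsq (volume.restrict U) (g i)

theorem scaledSq_le (U : Set (Vec d)) (h : ℝ) (u : Vec d → ℝ) (g : Fin d → Vec d → ℝ) :
    scaledSq U h u g ≤ (1 + ENNReal.ofReal (h ^ 2)) * h1Sq U u g := by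
  unfold scaledSq h1Sq
  rw [add_mul, one_mul]
  gcongr
  · exact le_self_add
  · exact le_add_self

theorem scaledSq_sub_le {U : Set (Vec d)} (h : ℝ) {u v w : Vec d → ℝ} {g g' g'' : Fin d → Vec d → ℝ}
    (hu : IsWeakGrad U u g) (hv : IsWeakGrad U v g') :
    scaledSq U h (fun x => u x - w x) (fun i x => g i x - g'' i x) ≤
      2 * scaledSq U h (fun x => u x - v x) (fun i x => g i x - g' i x) +
      2 * scaledSq U h (fun x => v x - w x) (fun i x => g' i x - g'' i x) := by
  have key : ∀ {a b c : Vec d → ℝ}, AEStronglyMeasurable (fun x => a x - b x) (volume.restrict U) →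
      nsq (volume.restrict U) (fun x => a x - c x) ≤ 2 * nsq (volume.restrict U) (fun x => a x - b x) +
        2 * nsq (volume.restrict U) (fun x => b x - c x) := by
    intro a b c hm
    refine le_trans (le_of_eq ?_) (nsq_add_le hm)
    congr 1; ext x; ring
  unfold scaledSq
  calc _ ≤ (2 * nsq (volume.restrict U) (fun x => u x - v x) +
        2 * nsq (volume.restrict U) (fun x => v x - w x)) + ENNReal.ofReal (h ^ 2) *
        ∑ i, (2 * nsq (volume.restrict U) (fun x => g i x - g' i x) +
        2 * nsq (volume.restrict U) (fun x => g' i x - g'' i x)) := by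
        gcongr with i
        · exact key (hu.memLp.1.sub hv.memLp.1)
        · exact key ((hu.memLp_grad i).1.sub (hv.memLp_grad i).1)
    _ = _ := by
        rw [Finset.sum_add_distrib, ← Finset.mul_sum, ← Finset.mul_sum]
        ring

/-- The boundary of a convex set is a null set. Sobolev norms live on the open simplex, moments and
errors on the closed one. -/
theorem restrict_interior_body :
    (volume : Measure (Vec d)).restrict (interior (body S)) = volume.restrict (body S) := by
  refine Measure.restrict_congr_set ?_
  exact interior_ae_eq_of_null_frontier ((convex_body S).addHaar_frontier volume)

theorem norm_sub_le_of_diam {h : ℝ} (hS : Metric.diam (body S) ≤ h) {x y : Vec d}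
    (hx : x ∈ body S) (hy : y ∈ body S) : ‖y - x‖ ≤ h := by
  rw [← dist_eq_norm]
  exact (Metric.dist_le_diam_of_mem (isCompact_body S).isBounded hy hx).trans hS

theorem isBounded_interior_body : Bornology.IsBounded (interior (body S)) :=
  (isCompact_body S).isBounded.subset interior_subset

theorem volume_interior_body_ne_top : volume (interior (body S)) ≠ ⊤ :=
  (isBounded_interior_body S).measure_lt_top.ne

theorem nsq_eq_eLpNorm_sq {E : Type*} [MeasurableSpace E] {μ : Measure E} (f : E → ℝ) :
    nsq μ f = eLpNorm f 2 μ ^ 2 := by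
  rw [eLpNorm_eq_lintegral_rpow_enorm_toReal (by simp) (by simp), ← ENNReal.rpow_natCast,
    ← ENNReal.rpow_mul]
  simp [nsq]

theorem tendsto_scaledSq {U : Set (Vec d)} (h : ℝ) {u : Vec d → ℝ} {g : Fin d → Vec d → ℝ}
    {φ : ℕ → Vec d → ℝ} (hlim : Tendsto (fun l => h1Sq U (fun x => φ l x - u x)
      (fun i x => grad (φ l) i x - g i x)) atTop (𝓝 0)) :
    Tendsto (fun l => scaledSq U h (fun x => φ l x - u x)
      (fun i x => grad (φ l) i x - g i x)) atTop (𝓝 0) := by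
  have h1 : Tendsto (fun l => (1 + ENNReal.ofReal (h ^ 2)) * h1Sq U (fun x => φ l x - u x)
      (fun i x => grad (φ l) i x - g i x)) atTop (𝓝 0) := by
    simpa using ENNReal.Tendsto.const_mul (a := 1 + ENNReal.ofReal (h ^ 2)) hlim
      (Or.inr (by finiteness))
  exact tendsto_of_tendsto_of_tendsto_of_le_of_le tendsto_const_nhds h1 (fun _ => zero_le)
    fun l => scaledSq_le _ _ _ _

theorem grad_sub {φ ψ : Vec d → ℝ} (hφ : ContDiff ℝ ∞ φ) (hψ : ContDiff ℝ ∞ ψ) :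
    grad (fun x => φ x - ψ x) = fun i x => grad φ i x - grad ψ i x := by
  ext i x
  have := fderiv_fun_sub (hφ.differentiable (by simp) x) (hψ.differentiable (by simp) x)
  simp [grad, this]

theorem scaledSq_comm {U : Set (Vec d)} (h : ℝ) (u v : Vec d → ℝ) (g g' : Fin d → Vec d → ℝ) :
    scaledSq U h (fun x => u x - v x) (fun i x => g i x - g' i x) =
      scaledSq U h (fun x => v x - u x) (fun i x => g' i x - g i x) := by
  simp only [scaledSq, nsq, enorm_sub_rev]

variable [NeZero d]

/-- The constant of the trace inequality. -/
def traceConst : ℝ≥0∞ := 4 * ENNReal.ofReal (2 ^ (d - 1) / S.height j)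

theorem traceConst_ne_top : traceConst S j ≠ ⊤ := ENNReal.mul_ne_top (by simp) ENNReal.ofReal_ne_top

/-- Along the ray from a facet point to the opposite vertex, the facet value is compared with the
values at parameters `t ≤ 1/2` by the fundamental theorem of calculus. The average over `t` is
integrated over the facet with the cone estimate. -/
theorem nsq_surf_le {h : ℝ} (hS : Metric.diam (body S) ≤ h) {φ : Vec d → ℝ} (hφ : ContDiff ℝ ∞ φ) :
    nsq (surf S j) φ ≤ traceConst S j * scaledSq (interior (body S)) h φ (grad φ) := by
  set f : Vec d → ℝ≥0∞ := fun x => ‖φ x‖ₑ ^ 2 + ENNReal.ofReal (h ^ 2) * gradSq φ x with hf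
  have hφm : Measurable fun x => ‖φ x‖ₑ ^ 2 := hφ.continuous.measurable.enorm.pow_const 2
  have hgm := measurable_gradSq hφ
  have hfm : Measurable f := hφm.add (hgm.const_mul _)
  have hpt : ∀ x ∈ facet S j, ‖φ x‖ₑ ^ 2 ≤
      4 * ∫⁻ t in Set.Icc (0 : ℝ) (1 / 2), f (x + t • (S.points j - x)) := by
    intro x hx
    set w := S.points j - x
    have hw : ‖w‖ ≤ h := norm_sub_le_of_diam S hS (facet_subset_body S j hx) (point_mem_body S j)
    set I := ∫⁻ t in Set.Icc (0 : ℝ) (1 / 2), gradSq φ (x + t • w)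
    have hgw : Measurable fun t : ℝ => gradSq φ (x + t • w) := hgm.comp (by fun_prop)
    have hφw : Measurable fun t : ℝ => ‖φ (x + t • w)‖ₑ ^ 2 := hφm.comp (by fun_prop)
    have h1 : ∀ t ∈ Set.Icc (0 : ℝ) (1 / 2), ‖φ x‖ₑ ^ 2 ≤
        2 * ‖φ (x + t • w)‖ₑ ^ 2 + ENNReal.ofReal (h ^ 2) * I := by
      intro t ht
      have e : φ x = φ (x + t • w) - (φ (x + t • w) - φ x) := by ring
      rw [e]
      refine (enorm_sub_sq_le _ _).trans ?_
      refine add_le_add le_rfl ?_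
      calc 2 * ‖φ (x + t • w) - φ x‖ₑ ^ 2
          ≤ 2 * (ENNReal.ofReal (1 / 2) * (ENNReal.ofReal (h ^ 2) * I)) := by
            refine mul_le_mul' le_rfl ((enorm_sub_sq_le_lintegral hφ x w hw ht.1).trans ?_)
            exact mul_le_mul' (ENNReal.ofReal_le_ofReal ht.2) (mul_le_mul' le_rfl
              (lintegral_mono_set (Set.Icc_subset_Icc_right ht.2)))
        _ = (2 * ENNReal.ofReal (1 / 2)) * (ENNReal.ofReal (h ^ 2) * I) := by ring
        _ = _ := by
            rw [show (2 : ℝ≥0∞) = ENNReal.ofReal 2 by simp, ← ENNReal.ofReal_mul (by norm_num)]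
            norm_num
    -- Integration of `h1` over the parameter interval, whose length is `1/2`.
    have h2 : ENNReal.ofReal (1 / 2) * ‖φ x‖ₑ ^ 2 ≤
        2 * ∫⁻ t in Set.Icc (0 : ℝ) (1 / 2), f (x + t • w) := by
      calc _ = ∫⁻ t in Set.Icc (0 : ℝ) (1 / 2), ‖φ x‖ₑ ^ 2 := by
            rw [setLIntegral_const, Real.volume_Icc, sub_zero, mul_comm]
        _ ≤ ∫⁻ t in Set.Icc (0 : ℝ) (1 / 2), (2 * ‖φ (x + t • w)‖ₑ ^ 2 + ENNReal.ofReal (h ^ 2) * I) :=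
            setLIntegral_mono' measurableSet_Icc h1
        _ = 2 * (∫⁻ t in Set.Icc (0 : ℝ) (1 / 2), ‖φ (x + t • w)‖ₑ ^ 2) +
            ENNReal.ofReal (1 / 2) * (ENNReal.ofReal (h ^ 2) * I) := by
            rw [lintegral_add_right _ measurable_const, setLIntegral_const, Real.volume_Icc, sub_zero,
              lintegral_const_mul' _ _ (by simp), mul_comm (ENNReal.ofReal (1 / 2))]
        _ ≤ 2 * (∫⁻ t in Set.Icc (0 : ℝ) (1 / 2), ‖φ (x + t • w)‖ₑ ^ 2) +
            2 * (ENNReal.ofReal (h ^ 2) * I) := by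
            gcongr
            rw [show (2 : ℝ≥0∞) = ENNReal.ofReal 2 by simp]
            exact ENNReal.ofReal_le_ofReal (by norm_num)
        _ = _ := by
            rw [← mul_add, hf, lintegral_add_left hφw, lintegral_const_mul _ hgw]
    calc ‖φ x‖ₑ ^ 2 = 2 * (ENNReal.ofReal (1 / 2) * ‖φ x‖ₑ ^ 2) := by
          rw [← mul_assoc, show (2 : ℝ≥0∞) = ENNReal.ofReal 2 by simp, ← ENNReal.ofReal_mul (by norm_num)]
          norm_num
      _ ≤ 2 * (2 * ∫⁻ t in Set.Icc (0 : ℝ) (1 / 2), f (x + t • w)) := by gcongr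
      _ = _ := by ring
  calc nsq (surf S j) φ ≤ ∫⁻ x, 4 * (∫⁻ t in Set.Icc (0 : ℝ) (1 / 2), f (x + t • (S.points j - x)))
        ∂(surf S j) := setLIntegral_mono' (isCompact_facet S j).isClosed.measurableSet hpt
    _ = 4 * ∫⁻ x, (∫⁻ t in Set.Icc (0 : ℝ) (1 / 2), f (x + t • (S.points j - x)))
        ∂(surf S j) := lintegral_const_mul' _ _ (by simp)
    _ ≤ 4 * (ENNReal.ofReal (2 ^ (d - 1) / S.height j) * ∫⁻ x in body S, f x) := by
        gcongr
        exact lintegral_cone_le S j hfm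
    _ = _ := by
        rw [traceConst, scaledSq, restrict_interior_body, hf, lintegral_add_left hφm,
          lintegral_const_mul _ hgm, lintegral_gradSq hφ, nsq]
        ring

variable {S j}

/-- The trace inequality, applied to differences of smooth approximations, makes their restrictions
a Cauchy sequence in `L²` of the facet. -/
theorem IsWeakGrad.exists_isTrace {u : Vec d → ℝ} {g : Fin d → Vec d → ℝ}
    (hu : IsWeakGrad (interior (body S)) u g) : ∃ t, IsTrace S j u t := by
  obtain ⟨φ, hφ, hlim⟩ := hu.exists_smooth_tendsto isOpen_interior (isBounded_interior_body S)
    (convex_body S).interior (interior_body_nonempty S)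
  set h := Metric.diam (body S)
  have hlim' := tendsto_scaledSq h hlim
  set E : ℕ → ℝ≥0∞ := fun l => scaledSq (interior (body S)) h (fun x => φ l x - u x)
    (fun i x => grad (φ l) i x - g i x)
  have hgr : ∀ l, IsWeakGrad (interior (body S)) (φ l) (grad (φ l)) := fun l =>
    IsWeakGrad.of_contDiff (isBounded_interior_body S) (hφ l)
  have hdiff : ∀ l m, nsq (surf S j) (fun x => φ l x - φ m x) ≤
      traceConst S j * (2 * E l + 2 * E m) := by
    intro l m
    refine (nsq_surf_le S j (le_refl h) ((hφ l).sub (hφ m))).trans ?_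
    rw [grad_sub (hφ l) (hφ m)]
    gcongr
    refine (scaledSq_sub_le h (hgr l) hu).trans ?_
    gcongr
    exact (scaledSq_comm h _ _ _ _).le
  have hmem : ∀ l, MemLp (φ l) 2 (surf S j) := fun l => by
    obtain ⟨C, hC⟩ := (isCompact_facet S j).exists_bound_of_continuousOn (hφ l).continuous.continuousOn
    exact MemLp.of_bound (hφ l).continuous.aestronglyMeasurable C
      ((ae_restrict_iff' (isCompact_facet S j).isClosed.measurableSet).2 (ae_of_all _ hC))
  let f : ℕ → Lp ℝ 2 (surf S j) := fun l => (hmem l).toLp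
  have hcauchy : CauchySeq f := by
    rw [EMetric.cauchySeq_iff]
    intro ε hε
    have hc : Tendsto (fun l => traceConst S j * (2 * E l)) atTop (𝓝 0) := by
      have := ENNReal.Tendsto.const_mul (a := traceConst S j)
        (ENNReal.Tendsto.const_mul (a := 2) hlim' (Or.inr (by simp)))
        (Or.inr (traceConst_ne_top S j))
      simpa using this
    have hε2 : 0 < ε ^ 2 / 2 := ENNReal.half_pos (pow_ne_zero 2 hε.ne')
    rcases eq_or_ne ε ⊤ with rfl | hεt
    · exact ⟨0, fun m _ n _ => edist_lt_top _ _⟩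
    obtain ⟨N, hN⟩ := (hc.eventually (gt_mem_nhds hε2)).exists_forall_of_atTop
    refine ⟨N, fun m hm n hn => ?_⟩
    rw [Lp.edist_toLp_toLp]
    have h1 : eLpNorm (φ m - φ n) 2 (surf S j) ^ 2 < ε ^ 2 := by
      rw [← nsq_eq_eLpNorm_sq]
      refine (hdiff m n).trans_lt ?_
      rw [mul_add, ← ENNReal.add_halves (ε ^ 2)]
      exact ENNReal.add_lt_add (hN m hm) (hN n hn)
    exact lt_of_not_ge fun h => h1.not_ge (pow_le_pow_left₀ zero_le h 2)
  obtain ⟨t, ht⟩ := cauchySeq_tendsto_of_complete hcauchy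
  refine ⟨t, Lp.memLp t, φ, hφ, ?_, ?_⟩
  · refine hlim.congr fun l => ?_
    exact (((hgr l).sub hu).sobolevNormSq_one isOpen_interior (volume_interior_body_ne_top S)).symm
  · rw [tendsto_iff_edist_tendsto_0] at ht
    have h2 := (ENNReal.continuous_pow 2).tendsto 0 |>.comp ht
    simp only [ne_eq, OfNat.ofNat_ne_zero, not_false_eq_true, zero_pow] at h2
    refine h2.congr fun l => ?_
    change edist (f l) t ^ 2 = nsq (surf S j) (fun x => φ l x - t x)
    rw [nsq_eq_eLpNorm_sq, Lp.edist_def]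
    congr 1
    exact eLpNorm_congr_ae (((hmem l).coeFn_toLp).sub (Filter.EventuallyEq.refl _ _))

/-- The trace inequality for the smooth functions `φ l - ψ`, passed to the limit. The factor `4`
comes from two splittings of squares, on the facet and in the interior. -/
theorem IsTrace.nsq_sub_le {u t : Vec d → ℝ} {g : Fin d → Vec d → ℝ}
    (hu : IsWeakGrad (interior (body S)) u g) (ht : IsTrace S j u t) {h : ℝ}
    (hS : Metric.diam (body S) ≤ h) {ψ : Vec d → ℝ} (hψ : ContDiff ℝ ∞ ψ) :
    nsq (surf S j) (fun x => t x - ψ x) ≤ 4 * (traceConst S j *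
      scaledSq (interior (body S)) h (fun x => u x - ψ x) (fun i x => g i x - grad ψ i x)) := by
  obtain ⟨htm, φ, hφ, hlim, hlim2⟩ := ht
  have hgr : ∀ l, IsWeakGrad (interior (body S)) (φ l) (grad (φ l)) := fun l =>
    IsWeakGrad.of_contDiff (isBounded_interior_body S) (hφ l)
  have hlim3 := tendsto_scaledSq (U := interior (body S)) h (u := u) (g := g) (φ := φ)
    (hlim.congr fun l => ((hgr l).sub hu).sobolevNormSq_one isOpen_interior
      (volume_interior_body_ne_top S))
  set E : ℕ → ℝ≥0∞ := fun l => scaledSq (interior (body S)) h (fun x => φ l x - u x)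
    (fun i x => grad (φ l) i x - g i x)
  set R := scaledSq (interior (body S)) h (fun x => u x - ψ x) (fun i x => g i x - grad ψ i x)
  set N : ℕ → ℝ≥0∞ := fun l => ∫⁻ x, ‖φ l x - t x‖ₑ ^ 2 ∂(surf S j)
  have hstep : ∀ l, nsq (surf S j) (fun x => t x - ψ x) ≤
      2 * N l + 2 * (traceConst S j * (2 * E l + 2 * R)) := by
    intro l
    have e : (fun x => t x - ψ x) = fun x => (t x - φ l x) + (φ l x - ψ x) := by ext x; ring
    rw [e]
    refine (nsq_add_le (htm.1.sub (hφ l).continuous.aestronglyMeasurable)).trans ?_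
    gcongr
    · refine le_of_eq (lintegral_congr fun x => ?_)
      rw [enorm_sub_rev]
      rfl
    · refine (nsq_surf_le S j hS ((hφ l).sub hψ)).trans ?_
      rw [grad_sub (hφ l) hψ]
      gcongr
      exact scaledSq_sub_le h (hgr l) hu
  have hlim4 : Tendsto (fun l => 2 * N l + 2 * (traceConst S j * (2 * E l + 2 * R))) atTop
      (𝓝 (2 * 0 + 2 * (traceConst S j * (2 * 0 + 2 * R)))) := by
    refine (ENNReal.Tendsto.const_mul hlim2 (Or.inr (by simp))).add ?_
    refine ENNReal.Tendsto.const_mul (ENNReal.Tendsto.const_mul ?_ (Or.inr (traceConst_ne_top S j)))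
      (Or.inr (by simp))
    exact (ENNReal.Tendsto.const_mul hlim3 (Or.inr (by simp))).add tendsto_const_nhds
  refine (ge_of_tendsto' hlim4 hstep).trans (le_of_eq ?_)
  ring

/-- The smooth functions defining `t'` converge to `u`, so by the preceding estimate their
restrictions also converge to `t`. -/
theorem IsTrace.ae_eq {u t t' : Vec d → ℝ} {g : Fin d → Vec d → ℝ}
    (hu : IsWeakGrad (interior (body S)) u g) (ht : IsTrace S j u t) (ht' : IsTrace S j u t') :
    t' =ᵐ[surf S j] t := by
  have hmain := @IsTrace.nsq_sub_le d S j _ u t g hu ht _ le_rfl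
  obtain ⟨htm', φ, hφ, hlim, hlim2⟩ := ht'
  have htm := ht.1
  have hgr : ∀ l, IsWeakGrad (interior (body S)) (φ l) (grad (φ l)) := fun l =>
    IsWeakGrad.of_contDiff (isBounded_interior_body S) (hφ l)
  have hlim3 := tendsto_scaledSq (U := interior (body S)) (Metric.diam (body S)) (u := u) (g := g)
    (φ := φ) (hlim.congr fun l => ((hgr l).sub hu).sobolevNormSq_one isOpen_interior
      (volume_interior_body_ne_top S))
  have hstep : ∀ l, nsq (surf S j) (fun x => t' x - t x) ≤
      2 * (∫⁻ x, ‖φ l x - t' x‖ₑ ^ 2 ∂(surf S j)) + 2 * (4 * (traceConst S j *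
        scaledSq (interior (body S)) (Metric.diam (body S)) (fun x => φ l x - u x)
          (fun i x => grad (φ l) i x - g i x))) := by
    intro l
    have e : (fun x => t' x - t x) = fun x => (t' x - φ l x) + (φ l x - t x) := by ext x; ring
    rw [e]
    refine (nsq_add_le (htm'.1.sub (hφ l).continuous.aestronglyMeasurable)).trans ?_
    gcongr
    · refine le_of_eq (lintegral_congr fun x => ?_)
      rw [enorm_sub_rev]
      rfl
    · rw [scaledSq_comm]
      refine le_trans (le_of_eq (lintegral_congr fun x => ?_)) (hmain (hφ l))
      rw [enorm_sub_rev]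
  have hlim4 := (ENNReal.Tendsto.const_mul (a := 2) hlim2 (Or.inr (by simp))).add
    (ENNReal.Tendsto.const_mul (a := 2) (ENNReal.Tendsto.const_mul (a := 4)
      (ENNReal.Tendsto.const_mul (a := traceConst S j) hlim3 (Or.inr (traceConst_ne_top S j)))
      (Or.inr (by simp))) (Or.inr (by simp)))
  have h0 : nsq (surf S j) (fun x => t' x - t x) = 0 := by
    have := ge_of_tendsto' hlim4 hstep
    simpa using this
  have hm : AEMeasurable (fun x => ‖t' x - t x‖ₑ ^ 2) (surf S j) :=
    (htm'.1.sub htm.1).enorm.pow_const 2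
  filter_upwards [(lintegral_eq_zero_iff' hm).1 h0] with x hx
  simpa [sub_eq_zero] using hx

theorem IsWeakGrad.isTrace_trace {u : Vec d → ℝ} {g : Fin d → Vec d → ℝ}
    (hu : IsWeakGrad (interior (body S)) u g) (j : Fin (d + 1)) : IsTrace S j u (trace S j u) := by
  have h : ∃ t, IsTrace S j u t := hu.exists_isTrace
  rw [trace, dif_pos h]
  exact h.choose_spec

end Trace

/-! ### Polynomial approximation -/

section BrambleHilbert

variable {d : ℕ} {U : Set (Vec d)} {n : ℕ} {u : Vec d → ℝ}
  {G : (j : ℕ) → (Fin j → Fin d) → Vec d → ℝ}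

theorem grad_polyFun (p : MvPolynomial (Fin d) ℝ) (i : Fin d) :
    grad (polyFun p) i = polyFun (MvPolynomial.pderiv i p) :=
  funext fun x => fderiv_polyFun p i x

/-- The commutator of two derivations is a derivation, and this one vanishes on the variables. -/
theorem pderiv_comm (i l : Fin d) (q : MvPolynomial (Fin d) ℝ) :
    MvPolynomial.pderiv i (MvPolynomial.pderiv l q) =
      MvPolynomial.pderiv l (MvPolynomial.pderiv i q) := by
  have h : ⁅(MvPolynomial.pderiv i : Derivation ℝ (MvPolynomial (Fin d) ℝ) (MvPolynomial (Fin d) ℝ)),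
      (MvPolynomial.pderiv l : Derivation ℝ (MvPolynomial (Fin d) ℝ) (MvPolynomial (Fin d) ℝ))⁆ = 0 := by
    refine MvPolynomial.derivation_ext fun a => ?_
    simp [Derivation.commutator_apply, MvPolynomial.pderiv_X, Pi.single_apply, apply_ite]
  have := DFunLike.congr_fun h q
  simpa [Derivation.commutator_apply, sub_eq_zero] using this

theorem wordDeriv_eq_of_wordIndex {j : ℕ} {w w' : Fin j → Fin d} (h : wordIndex w = wordIndex w')
    (p : MvPolynomial (Fin d) ℝ) : wordDeriv w p = wordDeriv w' p := by
  have key : ∀ {l l' : List (Fin d)}, l.Perm l' → ∀ (j : ℕ) (w w' : Fin j → Fin d),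
      List.ofFn w = l → List.ofFn w' = l' → wordDeriv w p = wordDeriv w' p := by
    intro l l' hp
    induction hp with
    | nil =>
      intro j w w' hw hw'
      have : j = 0 := by simpa using hw
      subst this
      rfl
    | @cons x l1 l2 _ ih =>
      intro j w w' hw hw'
      cases j with
      | zero => simp at hw
      | succ j =>
        rw [List.ofFn_succ, List.cons.injEq] at hw hw'
        simp only [wordDeriv]
        rw [hw.1, hw'.1, ih j (Fin.tail w) (Fin.tail w') hw.2 hw'.2]
    | @swap x y l =>
      intro j w w' hw hw'
      cases j with
      | zero => simp at hw
      | succ j =>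
      cases j with
      | zero => simp [List.ofFn_succ] at hw
      | succ j =>
        rw [List.ofFn_succ, List.cons.injEq, List.ofFn_succ, List.cons.injEq] at hw hw'
        have e : Fin.tail (Fin.tail w) = Fin.tail (Fin.tail w') :=
          List.ofFn_injective (hw.2.2.trans hw'.2.2.symm)
        have a1 : Fin.tail w 0 = x := hw.2.1
        have a2 : Fin.tail w' 0 = y := hw'.2.1
        simp only [wordDeriv]
        rw [hw.1, hw'.1, e, a1, a2, pderiv_comm]
    | @trans l1 l2 l3 h12 _ ih1 ih2 =>
      intro j w w' hw hw'
      have hlen : l2.length = j := by rw [← h12.length_eq, ← hw, List.length_ofFn]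
      subst hlen
      exact (ih1 _ w l2.get hw (List.ofFn_get _)).trans (ih2 _ l2.get w' (List.ofFn_get _) hw')
  rw [← wordIndex_eq_toFinsupp, ← wordIndex_eq_toFinsupp] at h
  exact key (Multiset.coe_eq_coe.1 (Multiset.toFinsupp.injective h)) j w w' rfl rfl

/-- There is a polynomial whose derivatives have the same averages as those of `u`. -/
theorem IsWeakJet.exists_poly (hU : IsOpen U) (hUb : Bornology.IsBounded U) (hne : U.Nonempty)
    (hG : IsWeakJet U n u G) {N : ℕ} (hN : N ≤ n) :
    ∃ p : MvPolynomial (Fin d) ℝ, p.totalDegree ≤ N ∧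
      (∀ j, N < j → ∀ w : Fin j → Fin d, wordDeriv w p = 0) ∧
      (∀ w : Fin N → Fin d, ∃ c, wordDeriv w p = MvPolynomial.C c) ∧
      ∀ j ≤ N, ∀ w : Fin j → Fin d, ∫ x in U, (G j w x - polyFun (wordDeriv w p) x) = 0 := by
  have hvol : volume U ≠ ⊤ := hUb.measure_lt_top.ne
  have hpos : 0 < volume.real U := ENNReal.toReal_pos (hU.measure_pos volume hne).ne' hvol
  have : IsFiniteMeasure (volume.restrict U) := ⟨by simpa using hvol.lt_top⟩
  have hw0 : ∀ {j : ℕ} (w : Fin j → Fin d), wordDeriv w (0 : MvPolynomial (Fin d) ℝ) = 0 := by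
    intro j w
    induction j with
    | zero => rfl
    | succ j ih => simp [wordDeriv, ih]
  have hpi : ∀ q : MvPolynomial (Fin d) ℝ, Integrable (polyFun q) (volume.restrict U) := fun q =>
    ((contDiff_polyFun q).continuous.memLp_of_isBounded hUb 2).integrable (by norm_num)
  -- Downward induction on the order of differentiation: after `m` steps the means of the top `m`
  -- orders agree.
  have key : ∀ m ≤ N + 1, ∃ p : MvPolynomial (Fin d) ℝ, p.totalDegree ≤ N ∧
      (∀ j, N < j → ∀ w : Fin j → Fin d, wordDeriv w p = 0) ∧
      (∀ w : Fin N → Fin d, ∃ c, wordDeriv w p = MvPolynomial.C c) ∧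
      ∀ j, N + 1 ≤ j + m → j ≤ N → ∀ w : Fin j → Fin d,
        ∫ x in U, (G j w x - polyFun (wordDeriv w p) x) = 0 := by
    intro m
    induction m with
    | zero =>
      intro _
      exact ⟨0, by simp, fun j _ w => hw0 w, fun w => ⟨0, by simp [hw0]⟩,
        fun j h1 h2 => absurd h1 (by omega)⟩
    | succ m ih =>
      intro hm
      obtain ⟨p, hp1, hp2, hp3, hp4⟩ := ih (by omega)
      set j := N - m with hj
      have hGi : ∀ w : Fin j → Fin d, Integrable (G j w) (volume.restrict U) := fun w =>
        (hG.memLp j (by omega) w).integrable (by norm_num)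
      -- The remaining mean discrepancy at order `j`. By symmetry of weak derivatives it depends
      -- only on the multi-index, so it is realised by a polynomial of degree at most `j`, whose
      -- higher derivatives vanish and leave the orders already matched alone.
      let c : (Fin j → Fin d) → ℝ := fun w =>
        (volume.real U)⁻¹ * ∫ x in U, (G j w x - polyFun (wordDeriv w p) x)
      have hc : ∀ w w', wordIndex w = wordIndex w' → c w = c w' := by
        intro w w' h
        refine congrArg ((volume.real U)⁻¹ * ·) (integral_congr_ae ?_)
        filter_upwards [hG.ae_eq_of_wordIndex hU hvol (show j ≤ n by omega) h] with x hx
        rw [hx, wordDeriv_eq_of_wordIndex h]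
      obtain ⟨q, hq1, hq2, hq3⟩ := exists_wordDeriv_eq c hc
      refine ⟨p + q, (MvPolynomial.totalDegree_add _ _).trans (max_le hp1 (by omega)), ?_, ?_, ?_⟩
      · intro i hi w
        rw [wordDeriv_add, hp2 i hi, hq3 i (by omega), add_zero]
      · intro w
        obtain ⟨c1, hc1⟩ := hp3 w
        rcases (show j ≤ N by omega).lt_or_eq with h | h
        · exact ⟨c1, by rw [wordDeriv_add, hc1, hq3 N h, add_zero]⟩
        · have : ∀ (i : ℕ) (w : Fin i → Fin d), j = i → ∃ c, wordDeriv w q = MvPolynomial.C c := by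
            rintro i w rfl
            exact ⟨_, hq2 w⟩
          obtain ⟨c2, hc2⟩ := this N w h
          exact ⟨c1 + c2, by rw [wordDeriv_add, hc1, hc2, MvPolynomial.C_add]⟩
      · intro i h1 h2 w
        rcases (show j ≤ i by omega).lt_or_eq with h | h
        · rw [wordDeriv_add, hq3 i h, add_zero]
          exact hp4 i (by omega) h2 w
        · subst h
          rw [wordDeriv_add, hq2 w]
          have e : ∀ x, G j w x - polyFun (wordDeriv w p + MvPolynomial.C (c w)) x =
              (G j w x - polyFun (wordDeriv w p) x) - c w := by
            intro x
            simp only [polyFun, map_add, MvPolynomial.eval_C]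
            ring
          simp only [e]
          have hint : Integrable (fun x => G j w x - polyFun (wordDeriv w p) x) (volume.restrict U) :=
            (hGi w).sub (hpi _)
          rw [integral_sub hint (integrable_const _), integral_const]
          simp only [measureReal_restrict_apply_univ, smul_eq_mul, c]
          field_simp
          ring
  obtain ⟨p, h1, h2, h3, h4⟩ := key (N + 1) le_rfl
  exact ⟨p, h1, h2, h3, fun j hj w => h4 j (by omega) hj w⟩

/-- The squared norm of the derivatives of order `j` of `u - p`. -/
def diffSq (U : Set (Vec d)) (G : (j : ℕ) → (Fin j → Fin d) → Vec d → ℝ)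
    (p : MvPolynomial (Fin d) ℝ) (j : ℕ) : ℝ≥0∞ :=
  ∑ w : Fin j → Fin d, nsq (volume.restrict U) (fun x => G j w x - polyFun (wordDeriv w p) x)

/-- The Poincaré inequality for each derivative of order `j` of `u - p`; its gradient consists of
derivatives of order `j + 1`. -/
theorem IsWeakJet.diffSq_le (hU : IsOpen U) (hUb : Bornology.IsBounded U) (hUc : Convex ℝ U)
    {h : ℝ} (hd : ∀ x ∈ U, ∀ y ∈ U, ‖y - x‖ ≤ h) (hG : IsWeakJet U n u G)
    {p : MvPolynomial (Fin d) ℝ} {j : ℕ} (hj : j < n)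
    (h0 : ∀ w : Fin j → Fin d, ∫ x in U, (G j w x - polyFun (wordDeriv w p) x) = 0) :
    diffSq U G p j ≤ ENNReal.ofReal (h ^ 2) * 2 ^ (d + 2) * diffSq U G p (j + 1) := by
  unfold diffSq
  rw [sum_words_succ, Finset.sum_comm, Finset.mul_sum]
  refine Finset.sum_le_sum fun w _ => ?_
  have h1 : IsWeakGrad U (G j w) (fun i => G (j + 1) (Fin.cons i w : Fin (j + 1) → Fin d)) :=
    ⟨hG.memLp j hj.le w, fun i => hG.memLp _ hj _, fun i => hG.succ j hj w i⟩
  have h2 := h1.sub (IsWeakGrad.of_contDiff hUb (contDiff_polyFun (wordDeriv w p)))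
  refine (h2.poincare hU hUb hUc hd (h0 w)).trans (le_of_eq ?_)
  rw [mul_assoc]
  congr 3
  ext i
  rw [grad_polyFun, wordDeriv_cons]

theorem IsWeakJet.diffSq_le_pow (hU : IsOpen U) (hUb : Bornology.IsBounded U) (hUc : Convex ℝ U)
    {h : ℝ} (hd : ∀ x ∈ U, ∀ y ∈ U, ‖y - x‖ ≤ h) (hG : IsWeakJet U n u G)
    {p : MvPolynomial (Fin d) ℝ} (h0 : ∀ j < n, ∀ w : Fin j → Fin d,
      ∫ x in U, (G j w x - polyFun (wordDeriv w p) x) = 0) {j : ℕ} (hj : j ≤ n) :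
    diffSq U G p j ≤ (ENNReal.ofReal (h ^ 2) * 2 ^ (d + 2)) ^ (n - j) * diffSq U G p n := by
  induction hj using Nat.decreasingInduction with
  | self => simp
  | of_succ j hj ih =>
    refine (hG.diffSq_le hU hUb hUc hd hj (h0 j hj)).trans ?_
    refine (mul_le_mul' le_rfl ih).trans (le_of_eq ?_)
    rw [← mul_assoc, ← pow_succ']
    congr 2
    omega

/-- On `U` the denominator of the Gagliardo integrand is at most `h^(d + 2θ)`. On the diagonal,
where it vanishes, so does the difference. -/
theorem lintegral_sub_sq_le_gagliardoSq {h : ℝ} (hU : MeasurableSet U)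
    (hd : ∀ x ∈ U, ∀ y ∈ U, ‖y - x‖ ≤ h) {θ : ℝ} (hθ : 0 ≤ θ) (g : Vec d → ℝ) :
    ∫⁻ x in U, ∫⁻ y in U, ‖g x - g y‖ₑ ^ 2 ≤
      ENNReal.ofReal h ^ ((d : ℝ) + 2 * θ) * gagliardoSq U θ g := by
  have he : (0 : ℝ) ≤ (d : ℝ) + 2 * θ := by positivity
  have hH : ENNReal.ofReal h ^ ((d : ℝ) + 2 * θ) ≠ ⊤ := by finiteness
  unfold gagliardoSq
  rw [← lintegral_const_mul' _ _ hH]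
  refine setLIntegral_mono' hU fun x hx => ?_
  rw [← lintegral_const_mul' _ _ hH]
  refine setLIntegral_mono' hU fun y hy => ?_
  have h1 : ‖x - y‖ₑ ^ ((d : ℝ) + 2 * θ) ≤ ENNReal.ofReal h ^ ((d : ℝ) + 2 * θ) := by
    refine ENNReal.rpow_le_rpow ?_ he
    rw [← ofReal_norm]
    exact ENNReal.ofReal_le_ofReal (hd y hy x hx)
  rcases eq_or_ne x y with rfl | hxy
  · simp
  have h2 : ‖x - y‖ₑ ^ ((d : ℝ) + 2 * θ) ≠ 0 := by
    have hxy' : ‖x - y‖ₑ ≠ 0 := by simpa [sub_eq_zero] using hxy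
    simp [ENNReal.rpow_eq_zero_iff, hxy']
  have h3 : ‖x - y‖ₑ ^ ((d : ℝ) + 2 * θ) ≠ ⊤ := (h1.trans_lt hH.lt_top).ne
  calc ‖g x - g y‖ₑ ^ 2 = ‖x - y‖ₑ ^ ((d : ℝ) + 2 * θ) *
        (‖g x - g y‖ₑ ^ 2 / ‖x - y‖ₑ ^ ((d : ℝ) + 2 * θ)) := (ENNReal.mul_div_cancel h2 h3).symm
    _ ≤ _ := mul_le_mul' h1 le_rfl

/-- With `n = ⌊s⌋`, repeated Poincaré inequalities reduce orders `0` and `1` to order `n`, at a gain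
of `h²` in the squared norm per order. Order `n` is treated directly for integer `s`, and by a
fractional Poincaré inequality otherwise. -/
theorem IsWeakJet.exists_poly_scaledSq_le (hU : IsOpen U) (hUb : Bornology.IsBounded U)
    (hUc : Convex ℝ U) (hne : U.Nonempty) {h : ℝ} (h0 : 0 < h)
    (hd : ∀ x ∈ U, ∀ y ∈ U, ‖y - x‖ ≤ h) {K : ℝ} (hK : 1 ≤ K)
    (hvol : ENNReal.ofReal (h ^ d) ≤ ENNReal.ofReal K * volume U) {s : ℝ} {k : ℕ} (hs : 1 ≤ s)
    (hsk : s ≤ k) (hG : IsWeakJet U ⌊s⌋₊ u G) :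
    ∃ p : MvPolynomial (Fin d) ℝ, p.totalDegree ≤ k - 1 ∧
      scaledSq U h (fun x => u x - polyFun p x)
        (fun i x => G 1 (Fin.cons i Fin.elim0 : Fin 1 → Fin d) x - grad (polyFun p) i x) ≤
      ENNReal.ofReal (2 * (2 ^ (d + 2)) ^ k * K * h ^ (2 * s)) * jetNormSq U s G := by
  set n := ⌊s⌋₊ with hn
  have hn1 : 1 ≤ n := (Nat.one_le_floor_iff _).2 hs
  have hnk : n ≤ k := Nat.floor_le_of_le hsk
  have hns : (n : ℝ) ≤ s := Nat.floor_le (by linarith)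
  have hvt : volume U ≠ ⊤ := hUb.measure_lt_top.ne
  have hv0 : volume U ≠ 0 := (hU.measure_pos volume hne).ne'
  have : IsFiniteMeasure (volume.restrict U) := ⟨by simpa using hvt.lt_top⟩
  have hfr : Int.fract s = s - n := by
    rw [Int.fract, ← natCast_floor_eq_intCast_floor (by linarith)]
  -- reduction to a bound of the derivatives of order `n`
  have main : ∀ p : MvPolynomial (Fin d) ℝ, (∀ j < n, ∀ w : Fin j → Fin d,
      ∫ x in U, (G j w x - polyFun (wordDeriv w p) x) = 0) →
      diffSq U G p n ≤ ENNReal.ofReal (K * h ^ (2 * (s - n))) * jetNormSq U s G →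
      scaledSq U h (fun x => u x - polyFun p x)
        (fun i x => G 1 (Fin.cons i Fin.elim0 : Fin 1 → Fin d) x - grad (polyFun p) i x) ≤
      ENNReal.ofReal (2 * (2 ^ (d + 2)) ^ k * K * h ^ (2 * s)) * jetNormSq U s G := by
    intro p hp hpn
    have e : scaledSq U h (fun x => u x - polyFun p x)
        (fun i x => G 1 (Fin.cons i Fin.elim0 : Fin 1 → Fin d) x - grad (polyFun p) i x) =
        diffSq U G p 0 + ENNReal.ofReal (h ^ 2) * diffSq U G p 1 := by
      unfold scaledSq diffSq
      rw [sum_words_zero, sum_words_succ]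
      congr 1
      · refine nsq_congr ?_
        filter_upwards [hG.zero] with x hx
        rw [hx]; rfl
      · simp only [sum_words_zero, grad_polyFun, wordDeriv_cons]
        rfl
    have a0 := hG.diffSq_le_pow hU hUb hUc hd hp (Nat.zero_le n)
    have a1 := hG.diffSq_le_pow hU hUb hUc hd hp hn1
    have e2 : ENNReal.ofReal (h ^ 2) * 2 ^ (d + 2) = ENNReal.ofReal (h ^ 2 * 2 ^ (d + 2)) := by
      rw [ENNReal.ofReal_mul (sq_nonneg h), ENNReal.ofReal_pow (n := d + 2) zero_le_two]
      simp
    rw [e2, ← ENNReal.ofReal_pow (by positivity)] at a0 a1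
    rw [e]
    have h1c : (1 : ℝ) ≤ 2 ^ (d + 2) := one_le_pow₀ (by norm_num)
    have hpk : ∀ m ≤ n, ((2 : ℝ) ^ (d + 2)) ^ m ≤ (2 ^ (d + 2)) ^ k := fun m hm =>
      pow_le_pow_right₀ h1c (hm.trans hnk)
    have hh : h ^ (2 * s) = (h ^ 2) ^ n * h ^ (2 * (s - n)) := by
      rw [← pow_mul, ← Real.rpow_natCast, ← Real.rpow_add h0]
      congr 1
      push_cast
      ring
    calc _ ≤ ENNReal.ofReal ((h ^ 2 * 2 ^ (d + 2)) ^ (n - 0)) * diffSq U G p n +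
          ENNReal.ofReal (h ^ 2) * (ENNReal.ofReal ((h ^ 2 * 2 ^ (d + 2)) ^ (n - 1)) *
            diffSq U G p n) := add_le_add a0 (mul_le_mul' le_rfl a1)
      _ = ENNReal.ofReal ((h ^ 2 * 2 ^ (d + 2)) ^ n + h ^ 2 * (h ^ 2 * 2 ^ (d + 2)) ^ (n - 1)) *
            diffSq U G p n := by
          rw [ENNReal.ofReal_add (by positivity) (by positivity), add_mul,
            ENNReal.ofReal_mul (sq_nonneg h), mul_assoc, Nat.sub_zero]
      _ ≤ ENNReal.ofReal (2 * (2 ^ (d + 2)) ^ k * (h ^ 2) ^ n) *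
            (ENNReal.ofReal (K * h ^ (2 * (s - n))) * jetNormSq U s G) := by
          refine mul_le_mul' (ENNReal.ofReal_le_ofReal ?_) hpn
          have e3 : h ^ 2 * (h ^ 2 * 2 ^ (d + 2)) ^ (n - 1) =
              (2 ^ (d + 2)) ^ (n - 1) * (h ^ 2) ^ n := by
            conv_rhs => rw [← Nat.sub_add_cancel hn1, pow_succ (h ^ 2)]
            rw [mul_pow, Nat.add_sub_cancel]
            ring
          rw [e3, mul_pow]
          have b1 := hpk n le_rfl
          have b2 := hpk (n - 1) (by omega)
          have b3 : 0 ≤ (h ^ 2) ^ n := by positivity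
          nlinarith
      _ = _ := by
          rw [← mul_assoc, ← ENNReal.ofReal_mul (by positivity), hh]
          congr 2
          ring
  rcases eq_or_ne (Int.fract s) 0 with hf | hf
  -- For integer `s` means are matched only up to order `n - 1`: then `p` has degree at most `k - 1`
  -- even when `s = k`, and the derivatives of order `n` of `u - p` are those of `u`.
  · obtain ⟨p, p1, p2, -, p4⟩ := hG.exists_poly hU hUb hne (N := n - 1) (Nat.sub_le _ _)
    refine ⟨p, p1.trans (Nat.sub_le_sub_right hnk 1), main p (fun j hj => p4 j (by omega)) ?_⟩
    have hsn : s - n = 0 := hfr ▸ hf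
    rw [hsn, mul_zero, Real.rpow_zero, mul_one]
    have : diffSq U G p n ≤ jetNormSq U s G := by
      unfold diffSq jetNormSq
      rw [Finset.sum_range_succ]
      refine le_trans (le_of_eq ?_) (le_add_self.trans le_self_add)
      refine Finset.sum_congr rfl fun w _ => ?_
      rw [p2 n (by omega) w]
      simp only [nsq, polyFun, map_zero, sub_zero]
      rfl
    exact this.trans (le_mul_of_one_le_left' (by simpa using hK))
  -- For fractional `s ≤ k` the floor is below `k`, so means of order `n` may be matched too. The
  -- derivatives of `p` of order `n` are constants and cancel in the Gagliardo differences.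
  · have hnk' : n < k := by
      have hlt : (n : ℝ) < s := by
        refine lt_of_le_of_ne hns fun h => hf ?_
        rw [hfr, h, sub_self]
      exact_mod_cast hlt.trans_le hsk
    obtain ⟨p, p1, -, p3, p4⟩ := hG.exists_poly hU hUb hne (le_refl n)
    refine ⟨p, p1.trans (by omega), main p (fun j hj => p4 j hj.le) ?_⟩
    have hθ : 0 ≤ s - n := by linarith
    have hterm : ∀ w : Fin n → Fin d, nsq (volume.restrict U)
        (fun x => G n w x - polyFun (wordDeriv w p) x) ≤
        ENNReal.ofReal (K * h ^ (2 * (s - n))) * gagliardoSq U (s - n) (G n w) := by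
      intro w
      obtain ⟨c, hc⟩ := p3 w
      have hm : MemLp (fun x => G n w x - polyFun (wordDeriv w p) x) 2 (volume.restrict U) :=
        (hG.memLp n le_rfl w).sub ((contDiff_polyFun _).continuous.memLp_of_isBounded hUb 2)
      have a := nsq_le_of_integral_eq_zero hm (p4 n le_rfl w)
      rw [Measure.restrict_apply_univ] at a
      have e : ∀ x y, (G n w x - polyFun (wordDeriv w p) x) -
          (G n w y - polyFun (wordDeriv w p) y) = G n w x - G n w y := by
        intro x y
        simp [hc, polyFun]
      simp only [e] at a
      have b := a.trans (lintegral_sub_sq_le_gagliardoSq hU.measurableSet hd hθ (G n w))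
      -- After multiplication by the volume, `hvol` absorbs the factor `h^d` of `h^(d + 2θ)`; this
      -- is where shape regularity enters.
      rw [← ENNReal.mul_le_mul_iff_right hv0 hvt]
      refine b.trans ?_
      rw [← mul_assoc]
      refine mul_le_mul' ?_ le_rfl
      rw [ENNReal.ofReal_rpow_of_pos h0, Real.rpow_add h0, Real.rpow_natCast,
        ENNReal.ofReal_mul (by positivity), ENNReal.ofReal_mul (by positivity), ← mul_assoc,
        mul_comm (volume U)]
      exact mul_le_mul' hvol le_rfl
    have hj : ∑ w : Fin n → Fin d, gagliardoSq U (s - n) (G n w) ≤ jetNormSq U s G := by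
      unfold jetNormSq
      rw [if_neg hf, hfr]
      exact le_add_self
    calc diffSq U G p n ≤ ∑ w : Fin n → Fin d, ENNReal.ofReal (K * h ^ (2 * (s - n))) *
          gagliardoSq U (s - n) (G n w) := Finset.sum_le_sum fun w _ => hterm w
      _ ≤ _ := by
          rw [← Finset.mul_sum]
          exact mul_le_mul' le_rfl hj

/-- The Bramble-Hilbert lemma: approximation by polynomials of degree at most `k - 1`. -/
theorem exists_poly_scaledSq_le_sobolevNormSq (hU : IsOpen U) (hUb : Bornology.IsBounded U)
    (hUc : Convex ℝ U) (hne : U.Nonempty) {h : ℝ} (h0 : 0 < h)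
    (hd : ∀ x ∈ U, ∀ y ∈ U, ‖y - x‖ ≤ h) {K : ℝ} (hK : 1 ≤ K)
    (hvol : ENNReal.ofReal (h ^ d) ≤ ENNReal.ofReal K * volume U) {s : ℝ} {k : ℕ} (hs : 1 ≤ s)
    (hsk : s ≤ k) {g : Fin d → Vec d → ℝ} (hg : IsWeakGrad U u g) {ε : ℝ≥0∞} (hε : ε ≠ 0) :
    ∃ p : MvPolynomial (Fin d) ℝ, p.totalDegree ≤ k - 1 ∧
      scaledSq U h (fun x => u x - polyFun p x) (fun i x => g i x - grad (polyFun p) i x) ≤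
      ENNReal.ofReal (2 * (2 ^ (d + 2)) ^ k * K * h ^ (2 * s)) * (sobolevNormSq U s u + ε) := by
  have hC : 0 < 2 * (2 ^ (d + 2)) ^ k * K * h ^ (2 * s) := by positivity
  rcases eq_or_ne (sobolevNormSq U s u) ⊤ with ht | ht
  · refine ⟨0, by simp, ?_⟩
    rw [ht, top_add, ENNReal.mul_top (by simpa using hC)]
    exact le_top
  have hlt : sobolevNormSq U s u < sobolevNormSq U s u + ε := ENNReal.lt_add_right ht hε
  conv_lhs at hlt => unfold sobolevNormSq
  simp only [iInf_lt_iff] at hlt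
  obtain ⟨G, hG, hlt⟩ := hlt
  obtain ⟨p, p1, p2⟩ := hG.exists_poly_scaledSq_le hU hUb hUc hne h0 hd hK hvol hs hsk
  refine ⟨p, p1, le_trans (le_of_eq ?_) (p2.trans (mul_le_mul' le_rfl hlt.le))⟩
  have hG' := hG.isWeakGrad ((Nat.one_le_floor_iff _).2 hs)
  unfold scaledSq
  congr 2
  refine Finset.sum_congr rfl fun i _ => nsq_congr ?_
  filter_upwards [(hg.weak i).ae_eq hU hUb.measure_lt_top.ne (hG'.weak i) (hg.memLp_grad i)
    (hG'.memLp_grad i)] with x hx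
  rw [hx]

end BrambleHilbert

/-! ### Bilinear forms on finite-dimensional spaces -/

section Forms

variable {V : Type*} [AddCommGroup V] [Module ℝ V]

/-- The range of a symmetric form lies in the annihilator of its kernel and has the same dimension.
The kernel is allowed because fields that vanish on a facet need not vanish off it. -/
theorem exists_form_eq [FiniteDimensional ℝ V] (B : V →ₗ[ℝ] V →ₗ[ℝ] ℝ) (hB : ∀ v w, B v w = B w v)
    (l : V →ₗ[ℝ] ℝ) (hl : ∀ v, (∀ w, B v w = 0) → l v = 0) : ∃ v, ∀ w, B v w = l w := by
  have h1 : LinearMap.range B ≤ (LinearMap.ker B).dualAnnihilator := by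
    rintro _ ⟨v, rfl⟩
    rw [Submodule.mem_dualAnnihilator]
    intro w hw
    rw [hB, LinearMap.mem_ker.1 hw, LinearMap.zero_apply]
  have h2 : Module.finrank ℝ (LinearMap.range B) =
      Module.finrank ℝ (LinearMap.ker B).dualAnnihilator := by
    have e1 := B.finrank_range_add_finrank_ker
    have e2 := Subspace.finrank_add_finrank_dualAnnihilator_eq (LinearMap.ker B)
    omega
  have h3 : l ∈ LinearMap.range B := by
    rw [Submodule.eq_of_le_of_finrank_eq h1 h2, Submodule.mem_dualAnnihilator]
    exact fun w hw => hl w fun z => by rw [LinearMap.mem_ker.1 hw, LinearMap.zero_apply]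
  obtain ⟨v, hv⟩ := h3
  exact ⟨v, fun w => by rw [hv]⟩

theorem continuous_form_diag {n : ℕ} (B : (Fin n → ℝ) →ₗ[ℝ] (Fin n → ℝ) →ₗ[ℝ] ℝ) :
    Continuous fun x => B x x := by
  have h1 : ∀ x y, B x y = LinearMap.toContinuousLinearMap
      ((LinearMap.toContinuousLinearMap : _ ≃ₗ[ℝ] ((Fin n → ℝ) →L[ℝ] ℝ)).toLinearMap ∘ₗ B) x y :=
    fun _ _ => rfl
  simp only [h1]
  exact (ContinuousLinearMap.continuous _).clm_apply continuous_id

/-- Compactness of the unit sphere in coordinates, and homogeneity of degree two. -/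
theorem exists_form_le_mul [FiniteDimensional ℝ V] (L N : V →ₗ[ℝ] V →ₗ[ℝ] ℝ)
    (hN : ∀ v, v ≠ 0 → 0 < N v v) : ∃ C : ℝ, 0 ≤ C ∧ ∀ v, L v v ≤ C * N v v := by
  set e := (Module.finBasis ℝ V).equivFun.symm
  have hc : ∀ B : V →ₗ[ℝ] V →ₗ[ℝ] ℝ, Continuous fun x => B (e x) (e x) := fun B =>
    continuous_form_diag (B.compl₁₂ e.toLinearMap e.toLinearMap)
  set K := Metric.sphere (0 : Fin (Module.finrank ℝ V) → ℝ) 1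
  have hK : IsCompact K := isCompact_sphere _ _
  -- The sphere is empty precisely when the space is zero.
  rcases K.eq_empty_or_nonempty with h0 | h0
  · refine ⟨0, le_rfl, fun v => ?_⟩
    have : v = 0 := by
      by_contra hv
      have hv' : e.symm v ≠ 0 := by simpa using hv
      have : ‖e.symm v‖⁻¹ • e.symm v ∈ K := by
        rw [mem_sphere_zero_iff_norm, norm_smul, norm_inv, norm_norm,
          inv_mul_cancel₀ (norm_ne_zero_iff.2 hv')]
      rw [h0] at this
      exact this
    simp [this]
  obtain ⟨x0, hx0, hmin⟩ := hK.exists_isMinOn h0 (hc N).continuousOn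
  obtain ⟨x1, hx1, hmax⟩ := hK.exists_isMaxOn h0 (hc L).continuousOn
  set m := N (e x0) (e x0)
  have hm : 0 < m := hN _ fun h => by
    have : x0 = 0 := by simpa using h
    rw [this, mem_sphere_zero_iff_norm, norm_zero] at hx0
    exact zero_ne_one hx0
  refine ⟨|L (e x1) (e x1)| / m, by positivity, fun v => ?_⟩
  rcases eq_or_ne v 0 with rfl | hv
  · simp
  have hv' : e.symm v ≠ 0 := by simpa using hv
  set c := ‖e.symm v‖
  have hcp : 0 < c := norm_pos_iff.2 hv'
  set y := c⁻¹ • e.symm v with hy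
  have hyK : y ∈ K := by
    rw [mem_sphere_zero_iff_norm, hy, norm_smul, norm_inv, norm_norm, inv_mul_cancel₀ hcp.ne']
  have hev : v = c • e y := by
    rw [hy, map_smul, smul_inv_smul₀ hcp.ne', LinearEquiv.apply_symm_apply]
  have e1 : ∀ B : V →ₗ[ℝ] V →ₗ[ℝ] ℝ, B v v = c ^ 2 * B (e y) (e y) := fun B => by
    conv_lhs => rw [hev]
    simp only [map_smul, LinearMap.smul_apply, smul_eq_mul]
    ring
  rw [e1 L, e1 N, mul_left_comm]
  refine mul_le_mul_of_nonneg_left ?_ (sq_nonneg c)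
  calc L (e y) (e y) ≤ |L (e x1) (e x1)| := (hmax hyK).trans (le_abs_self _)
    _ = |L (e x1) (e x1)| / m * m := (div_mul_cancel₀ _ hm.ne').symm
    _ ≤ _ := mul_le_mul_of_nonneg_left (hmin hyK) (by positivity)

theorem form_sq_le (L : V →ₗ[ℝ] V →ₗ[ℝ] ℝ) (hL : ∀ v w, L v w = L w v) (h0 : ∀ v, 0 ≤ L v v)
    (v w : V) : L v w ^ 2 ≤ L v v * L w w := by
  have h : ∀ t : ℝ, 0 ≤ L w w * (t * t) + (2 * L v w) * t + L v v := by
    intro t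
    have := h0 (v + t • w)
    simp only [map_add, map_smul, LinearMap.add_apply, LinearMap.smul_apply, smul_eq_mul] at this
    rw [hL w v] at this
    linarith
  have := discrim_le_zero h
  rw [discrim] at this
  linarith

/-- If `N` is positive semidefinite, then `v` is controlled by `N v v` and by the action of `v` on
the kernel of `N`. -/
theorem exists_form_le [FiniteDimensional ℝ V] (L N : V →ₗ[ℝ] V →ₗ[ℝ] ℝ)
    (hL : ∀ v w, L v w = L w v) (hL0 : ∀ v, 0 ≤ L v v) (hN : ∀ v w, N v w = N w v)
    (hN0 : ∀ v, 0 ≤ N v v) :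
    ∃ C : ℝ, 0 ≤ C ∧ ∀ v (M : ℝ), 0 ≤ M → (∀ b, N b b = 0 → L v b ^ 2 ≤ M * L b b) →
      L v v ≤ C * N v v + 4 * M := by
  -- On a complement of its kernel the semidefinite form `N` is definite, so it controls `L` there.
  obtain ⟨W, hW⟩ := (LinearMap.ker N).exists_isCompl
  have hker : ∀ v, N v v = 0 → v ∈ LinearMap.ker N := by
    intro v hv
    rw [LinearMap.mem_ker]
    ext w
    have := form_sq_le N hN hN0 v w
    rw [hv, zero_mul] at this
    simpa using le_antisymm this (sq_nonneg _)
  obtain ⟨C, hC, h⟩ := exists_form_le_mul (L.domRestrict₁₂ W W) (N.domRestrict₁₂ W W) (by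
    rintro ⟨v, hv⟩ hv0
    refine lt_of_le_of_ne (hN0 v) fun h => hv0 ?_
    have : v ∈ LinearMap.ker N ⊓ W := ⟨hker v h.symm, hv⟩
    rw [hW.inf_eq_bot] at this
    exact Subtype.ext this)
  -- With `X = L v v` and `Y = L w w`, the estimates below give `X ≤ M + (2X + 2Y)/4 + X/4 + Y`,
  -- hence `X ≤ 4M + 6Y`, and `Y ≤ C * N w w`.
  refine ⟨6 * C, by positivity, fun v M hM hb => ?_⟩
  have hv : v ∈ LinearMap.ker N ⊔ W := by rw [hW.sup_eq_top]; trivial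
  obtain ⟨b, hbk, w, hw, rfl⟩ := Submodule.mem_sup.1 hv
  have hNb : N b = 0 := hbk
  have hNbw : N (b + w) (b + w) = N w w := by
    rw [map_add, hN _ b, hN _ w, hNb, LinearMap.zero_apply, zero_add, map_add, hN w b, hNb,
      LinearMap.zero_apply, zero_add]
  have h1 : L w w ≤ C * N w w := h ⟨w, hw⟩
  have h2 := hb b (by rw [hNb, LinearMap.zero_apply])
  rw [hNbw]
  set v := b + w
  have hbv : b = v - w := by simp [v]
  have h3 : L b b ≤ 2 * L v v + 2 * L w w := by
    have := hL0 (v + w)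
    rw [hbv]
    simp only [map_add, map_sub, LinearMap.add_apply, LinearMap.sub_apply] at this ⊢
    linarith
  have h4 := form_sq_le L hL hL0 v w
  have h5 : L v v = L v b + L v w := by rw [← map_add]
  have hX := hL0 v
  have hY := hL0 w
  -- Young's inequality for both terms
  have h6 : L v w ≤ L v v / 4 + L w w := by
    nlinarith [sq_nonneg (L v v / 4 - L w w), sq_nonneg (L v v / 4 + L w w - L v w)]
  have h7 : L v b ≤ M + L b b / 4 := by
    nlinarith [sq_nonneg (M - L b b / 4), hL0 b]
  nlinarith

/-- A bilinear form given by an integral. -/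
def intForm {X : Type*} [MeasurableSpace X] (μ : Measure X) (f : V → V → X → ℝ)
    (h1 : ∀ v v' w x, f (v + v') w x = f v w x + f v' w x)
    (h2 : ∀ (c : ℝ) v w x, f (c • v) w x = c * f v w x)
    (h3 : ∀ v w x, f v w x = f w v x) (h4 : ∀ v w, Integrable (f v w) μ) :
    V →ₗ[ℝ] V →ₗ[ℝ] ℝ :=
  LinearMap.mk₂ ℝ (fun v w => ∫ x, f v w x ∂μ)
    (fun v v' w => by simp only [h1]; exact integral_add (h4 _ _) (h4 _ _))
    (fun c v w => by simp only [h2]; exact integral_const_mul _ _)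
    (fun v w w' => by
      simp only [h3 v, h1]
      exact integral_add (h4 _ _) (h4 _ _))
    (fun c v w => by
      simp only [h3 v, h2]
      exact integral_const_mul _ _)

end Forms

/-! ### Square integrable fields -/

section Fields

variable {d : ℕ} {X : Type*} [MeasurableSpace X] {μ : Measure X}

theorem ddot_comm (A B : Mat d) : ddot A B = ddot B A := by simp only [ddot, mul_comm]

theorem ddot_add (A B C : Mat d) : ddot (A + B) C = ddot A C + ddot B C := by
  simp [ddot, add_mul, Finset.sum_add_distrib]

theorem ddot_sub (A B C : Mat d) : ddot (A - B) C = ddot A C - ddot B C := by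
  simp [ddot, sub_mul, Finset.sum_sub_distrib]

theorem ddot_smul (c : ℝ) (A B : Mat d) : ddot (c • A) B = c * ddot A B := by
  simp [ddot, Finset.mul_sum, mul_assoc]

theorem nt_eq_sum (M : Mat d) (n : Vec d) :
    nt M n = ∑ a, ∑ b, M a b • nt (Matrix.single a b (1 : ℝ)) n := by
  conv_lhs => rw [Matrix.matrix_eq_sum_single M]
  simp only [nt_sum]
  refine Finset.sum_congr rfl fun a _ => Finset.sum_congr rfl fun b _ => ?_
  rw [← nt_smul, Matrix.smul_single, smul_eq_mul, mul_one]

theorem nt_apply_eq_sum (M : Mat d) (n : Vec d) (c : Fin d) :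
    nt M n c = ∑ a, ∑ b, M a b * nt (Matrix.single a b (1 : ℝ)) n c := by
  conv_lhs => rw [nt_eq_sum]
  simp

theorem isPoly_nt {k : ℕ} {M : Vec d → Mat d} (hM : ∀ a b, IsPoly k fun x => M x a b) (n : Vec d)
    (c : Fin d) : IsPoly k fun x => nt (M x) n c := by
  rw [show (fun x => MCS.nt (M x) n c) = _ from funext fun x => nt_apply_eq_sum _ _ _]
  exact IsPoly.sum _ fun a _ => IsPoly.sum _ fun b _ => (hM a b).mul_const _

theorem continuous_vec {f : Vec d → Vec d} (hf : ∀ a, Continuous fun x => f x a) : Continuous f :=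
  (PiLp.continuous_toLp 2 _).comp (continuous_pi hf)

/-- The vector field has square integrable entries. -/
def VecL2 (μ : Measure X) (f : X → Vec d) : Prop := ∀ a, MemLp (fun x => f x a) 2 μ

/-- The matrix field has square integrable entries. -/
def MatL2 (μ : Measure X) (M : X → Mat d) : Prop := ∀ a b, MemLp (fun x => M x a b) 2 μ

theorem VecL2.sub {f g : X → Vec d} (hf : VecL2 μ f) (hg : VecL2 μ g) :
    VecL2 μ fun x => f x - g x := fun a => (hf a).sub (hg a)

theorem MatL2.sub {f g : X → Mat d} (hf : MatL2 μ f) (hg : MatL2 μ g) :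
    MatL2 μ fun x => f x - g x := fun a b => (hf a b).sub (hg a b)

theorem MatL2.nt {M : X → Mat d} (hM : MatL2 μ M) (n : Vec d) :
    VecL2 μ fun x => MCS.nt (M x) n := fun c => by
  rw [show (fun x => MCS.nt (M x) n c) = _ from funext fun x => nt_apply_eq_sum _ _ _]
  exact memLp_finsetSum _ fun a _ => memLp_finsetSum _ fun b _ => (hM a b).mul_const _

theorem VecL2.integrable_inner {f g : X → Vec d} (hf : VecL2 μ f) (hg : VecL2 μ g) :
    Integrable (fun x => (inner ℝ (f x) (g x) : ℝ)) μ := by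
  simp only [PiLp.inner_apply, RCLike.inner_apply, conj_trivial]
  exact integrable_finsetSum _ fun a _ => (hg a).integrable_mul (hf a)

theorem MatL2.integrable_ddot {f g : X → Mat d} (hf : MatL2 μ f) (hg : MatL2 μ g) :
    Integrable (fun x => ddot (f x) (g x)) μ := by
  simp only [ddot]
  exact integrable_finsetSum _ fun a _ => integrable_finsetSum _ fun b _ =>
    (hf a b).integrable_mul (hg a b)

theorem VecL2.lintegral_eq {f : X → Vec d} (hf : VecL2 μ f) :
    ∫⁻ x, ‖f x‖ₑ ^ 2 ∂μ = ENNReal.ofReal (∫ x, ‖f x‖ ^ 2 ∂μ) := by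
  have h := hf.integrable_inner hf
  simp only [real_inner_self_eq_norm_sq] at h
  rw [ofReal_integral_eq_lintegral_ofReal h (ae_of_all _ fun x => sq_nonneg _)]
  refine lintegral_congr fun x => ?_
  rw [← ofReal_norm, ENNReal.ofReal_pow (norm_nonneg _)]

theorem MatL2.lintegral_eq {f : X → Mat d} (hf : MatL2 μ f) :
    ∫⁻ x, ENNReal.ofReal (frobSq (f x)) ∂μ = ENNReal.ofReal (∫ x, frobSq (f x) ∂μ) := by
  have h := hf.integrable_ddot hf
  simp only [ddot_self] at h
  rw [ofReal_integral_eq_lintegral_ofReal h (ae_of_all _ fun x => frobSq_nonneg _)]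

theorem ofReal_frobSq (M : Mat d) : ENNReal.ofReal (frobSq M) = ∑ a, ∑ b, ‖M a b‖ₑ ^ 2 := by
  refine (ENNReal.ofReal_sum_of_nonneg fun a _ => Finset.sum_nonneg fun b _ => sq_nonneg (M a b)).trans ?_
  refine Finset.sum_congr rfl fun a _ => ?_
  rw [ENNReal.ofReal_sum_of_nonneg fun b _ => sq_nonneg _]
  simp only [enorm_sq_eq_ofReal]

theorem MatL2.lintegral_frobSq {f : X → Mat d} (hf : MatL2 μ f) :
    ∫⁻ x, ENNReal.ofReal (frobSq (f x)) ∂μ = ∑ a, ∑ b, nsq μ fun x => f x a b := by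
  simp only [ofReal_frobSq]
  rw [lintegral_finsetSum' _ fun a _ => Finset.aemeasurable_fun_sum _ fun b _ =>
    (hf a b).1.enorm.pow_const 2]
  refine Finset.sum_congr rfl fun a _ => ?_
  rw [lintegral_finsetSum' _ fun b _ => (hf a b).1.enorm.pow_const 2]
  rfl

theorem frobSq_eq_zero {M : Mat d} (h : frobSq M = 0) : M = 0 := by
  ext a b
  have h1 := (Finset.sum_eq_zero_iff_of_nonneg fun a _ =>
    Finset.sum_nonneg fun b _ => sq_nonneg (M a b)).1 h a (Finset.mem_univ _)
  have := (Finset.sum_eq_zero_iff_of_nonneg fun b _ => sq_nonneg (M a b)).1 h1 b (Finset.mem_univ _)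
  simpa using this

theorem MatL2.ae_eq_zero {f : X → Mat d} (hf : MatL2 μ f) (h : ∫ x, frobSq (f x) ∂μ = 0) :
    ∀ᵐ x ∂μ, f x = 0 := by
  have hi := hf.integrable_ddot hf
  simp only [ddot_self] at hi
  filter_upwards [(integral_eq_zero_iff_of_nonneg (fun x => frobSq_nonneg (f x)) hi).1 h] with x hx
  exact frobSq_eq_zero hx

theorem VecL2.ae_eq_zero {f : X → Vec d} (hf : VecL2 μ f) (h : ∫ x, ‖f x‖ ^ 2 ∂μ = 0) :
    ∀ᵐ x ∂μ, f x = 0 := by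
  have hi := hf.integrable_inner hf
  simp only [real_inner_self_eq_norm_sq] at hi
  filter_upwards [(integral_eq_zero_iff_of_nonneg (fun x => sq_nonneg ‖f x‖) hi).1 h] with x hx
  simpa using hx

end Fields

/-! ### Degrees of freedom on one simplex -/

section Local

variable {d : ℕ} [NeZero d] {k : ℕ} {S : Simp d}

theorem vecL2_surf {f : Vec d → Vec d} (hf : ∀ a, Continuous fun x => f x a) (j : Fin (d + 1)) :
    VecL2 (surf S j) f := fun a => by
  obtain ⟨C, hC⟩ := (isCompact_facet S j).exists_bound_of_continuousOn (hf a).continuousOn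
  exact MemLp.of_bound (hf a).aestronglyMeasurable C
    ((ae_restrict_iff' (isCompact_facet S j).isClosed.measurableSet).2 (ae_of_all _ hC))

theorem matL2_body {f : Vec d → Mat d} (hf : ∀ a b, Continuous fun x => f x a b) :
    MatL2 (volume.restrict (body S)) f := fun a b =>
  (hf a b).memLp_of_isBounded (isCompact_body S).isBounded 2

theorem facet_congr {j : Fin (d + 1)} {f g : Vec d → ℝ} (h : ∀ x ∈ facet S j, f x = g x) :
    ∫ x, f x ∂(surf S j) = ∫ x, g x ∂(surf S j) :=
  setIntegral_congr_fun (isCompact_facet S j).isClosed.measurableSet h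

/-! ### Projection on a facet -/

/-- The polynomial fields which are tangential to a facet. -/
def tangSub (S : Simp d) (j : Fin (d + 1)) (k : ℕ) : Submodule ℝ (Vec d → Vec d) where
  carrier := {r | (∀ a, IsPoly k fun x => r x a) ∧ ∀ x ∈ facet S j, inner ℝ (normal S j) (r x) = (0 : ℝ)}
  add_mem' hf hg := ⟨(polyVec d k).add_mem hf.1 hg.1, fun x hx => by
    rw [Pi.add_apply, inner_add_right, hf.2 x hx, hg.2 x hx, add_zero]⟩
  zero_mem' := ⟨(polyVec d k).zero_mem, fun x _ => by simp⟩
  smul_mem' c _ hf := ⟨(polyVec d k).smul_mem c hf.1, fun x hx => by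
    rw [Pi.smul_apply, inner_smul_right, hf.2 x hx, mul_zero]⟩

instance (j : Fin (d + 1)) : FiniteDimensional ℝ (tangSub S j k) :=
  Submodule.finiteDimensional_of_le (S₂ := polyVec d k) fun _ h => h.1

theorem vecL2_tangSub {j : Fin (d + 1)} {q : Vec d → Vec d} (hq : q ∈ tangSub S j k) :
    VecL2 (surf S j) q := vecL2_surf (fun a => (hq.1 a).continuous) j

/-- The normal equations of the `L²` projection. The Gram form is only semidefinite on fields
defined in the whole space, but a field in its kernel vanishes almost everywhere on the facet and
annihilates the right-hand side. -/
theorem exists_facet_projection {j : Fin (d + 1)} {g : Vec d → Vec d} (hg : VecL2 (surf S j) g) :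
    ∃ q ∈ tangSub S j k, ∀ r ∈ tangSub S j k, ∫ x, inner ℝ (g x - q x) (r x) ∂(surf S j) = 0 := by
  have hint : ∀ v w : tangSub S j k, Integrable (fun x => (inner ℝ (v.1 x) (w.1 x) : ℝ)) (surf S j) :=
    fun v w => (vecL2_tangSub v.2).integrable_inner (vecL2_tangSub w.2)
  have hint' : ∀ v : tangSub S j k, Integrable (fun x => (inner ℝ (g x) (v.1 x) : ℝ)) (surf S j) :=
    fun v => hg.integrable_inner (vecL2_tangSub v.2)
  let B : tangSub S j k →ₗ[ℝ] tangSub S j k →ₗ[ℝ] ℝ := intForm (surf S j)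
    (fun v w x => inner ℝ (v.1 x) (w.1 x))
    (fun v v' w x => inner_add_left _ _ _) (fun c v w x => real_inner_smul_left _ _ _)
    (fun v w x => real_inner_comm _ _) hint
  let l : tangSub S j k →ₗ[ℝ] ℝ :=
    { toFun := fun v => ∫ x, inner ℝ (g x) (v.1 x) ∂(surf S j)
      map_add' := fun v w => by
        rw [← integral_add (hint' v) (hint' w)]
        exact integral_congr_ae (ae_of_all _ fun x => inner_add_right _ _ _)
      map_smul' := fun c v => by
        rw [RingHom.id_apply, smul_eq_mul, ← integral_const_mul]
        exact integral_congr_ae (ae_of_all _ fun x => real_inner_smul_right _ _ _) }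
  obtain ⟨q, hq⟩ := exists_form_eq B (fun v w => integral_congr_ae
    (ae_of_all _ fun x => real_inner_comm _ _)) l (fun v hv => by
      have h0 : ∫ x, ‖v.1 x‖ ^ 2 ∂(surf S j) = 0 := by
        rw [← hv v]
        exact integral_congr_ae (ae_of_all _ fun x => (real_inner_self_eq_norm_sq _).symm)
      have h1 := (vecL2_tangSub v.2).ae_eq_zero h0
      refine integral_eq_zero_of_ae ?_
      filter_upwards [h1] with x hx
      rw [hx, inner_zero_right]; rfl)
  refine ⟨q.1, q.2, fun r hr => ?_⟩
  have h1 : ∫ x, inner ℝ (q.1 x) (r x) ∂(surf S j) = ∫ x, inner ℝ (g x) (r x) ∂(surf S j) :=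
    hq ⟨r, hr⟩
  simp only [inner_sub_left]
  rw [integral_sub (hint' ⟨r, hr⟩) (hint q ⟨r, hr⟩), h1, sub_self]

/-- Pythagoras for the orthogonal splitting `g - p = (g - q) + (q - p)`. The first bound serves the
facet error, the second the facet term in the stability estimate. -/
theorem lintegral_facet_projection_le {j : Fin (d + 1)} {g q p : Vec d → Vec d}
    (hg : VecL2 (surf S j) g) (hq : q ∈ tangSub S j k) (hp : p ∈ tangSub S j k)
    (h : ∀ r ∈ tangSub S j k, ∫ x, inner ℝ (g x - q x) (r x) ∂(surf S j) = 0) :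
    ∫⁻ x, ‖g x - q x‖ₑ ^ 2 ∂(surf S j) ≤ ∫⁻ x, ‖g x - p x‖ₑ ^ 2 ∂(surf S j) ∧
    ∫⁻ x, ‖q x - p x‖ₑ ^ 2 ∂(surf S j) ≤ ∫⁻ x, ‖g x - p x‖ₑ ^ 2 ∂(surf S j) := by
  have h1 := hg.sub (vecL2_tangSub hq)
  have h2 := (vecL2_tangSub hq).sub (vecL2_tangSub hp)
  have h3 := hg.sub (vecL2_tangSub hp)
  have i1 := h1.integrable_inner h1
  have i2 := h2.integrable_inner h2
  have i3 := h1.integrable_inner h2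
  simp only [real_inner_self_eq_norm_sq] at i1 i2
  have e : ∫ x, ‖g x - p x‖ ^ 2 ∂(surf S j) =
      ∫ x, ‖g x - q x‖ ^ 2 ∂(surf S j) + ∫ x, ‖q x - p x‖ ^ 2 ∂(surf S j) := by
    have h0 : ∫ x, inner ℝ (g x - q x) (q x - p x) ∂(surf S j) = 0 :=
      h (q - p) ((tangSub S j k).sub_mem hq hp)
    have e1 : ∀ x, ‖g x - p x‖ ^ 2 =
        (‖g x - q x‖ ^ 2 + 2 * inner ℝ (g x - q x) (q x - p x)) + ‖q x - p x‖ ^ 2 := fun x => by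
      rw [← norm_add_sq_real, sub_add_sub_cancel]
    simp only [e1]
    have i4 : Integrable (fun x => ‖g x - q x‖ ^ 2 + 2 * inner ℝ (g x - q x) (q x - p x)) (surf S j) :=
      i1.add (i3.const_mul 2)
    rw [integral_add i4 i2, integral_add i1 (i3.const_mul 2), integral_const_mul, h0, mul_zero,
      add_zero]
  rw [h1.lintegral_eq, h2.lintegral_eq, h3.lintegral_eq, e]
  exact ⟨ENNReal.ofReal_le_ofReal (le_add_of_nonneg_right (integral_nonneg fun x => sq_nonneg _)),
    ENNReal.ofReal_le_ofReal (le_add_of_nonneg_left (integral_nonneg fun x => sq_nonneg _))⟩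

/-! ### The local spaces -/

/-- `Σ_k(S)` as a subspace. -/
def sigmaSub (k : ℕ) (S : Simp d) : Submodule ℝ (Vec d → Mat d) where
  carrier := {τ | MemSigma k S τ}
  add_mem' {f g} hf hg := by
    refine ⟨(polyMat d k).add_mem hf.poly hg.poly, fun x => ?_, fun j => ?_⟩
    · rw [Pi.add_apply, Matrix.trace_add, hf.traceFree, hg.traceFree, add_zero]
    · obtain ⟨q, hq, hq'⟩ := hf.ntPoly j
      obtain ⟨r, hr, hr'⟩ := hg.ntPoly j
      exact ⟨q + r, (polyVec d (k - 1)).add_mem hq hr, fun x hx => by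
        rw [Pi.add_apply, nt_add, hq' x hx, hr' x hx, Pi.add_apply]⟩
  zero_mem' := ⟨(polyMat d k).zero_mem, fun x => by simp, fun j =>
    ⟨0, (polyVec d (k - 1)).zero_mem, fun x _ => nt_zero _⟩⟩
  smul_mem' c f hf := by
    refine ⟨(polyMat d k).smul_mem c hf.poly, fun x => ?_, fun j => ?_⟩
    · rw [Pi.smul_apply, Matrix.trace_smul, hf.traceFree, smul_zero]
    · obtain ⟨q, hq, hq'⟩ := hf.ntPoly j
      exact ⟨c • q, (polyVec d (k - 1)).smul_mem c hq, fun x hx => by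
        rw [Pi.smul_apply, nt_smul, hq' x hx, Pi.smul_apply]⟩

instance : FiniteDimensional ℝ (sigmaSub k S) :=
  Submodule.finiteDimensional_of_le (S₂ := polyMat d k) fun _ h => h.poly

/-- `B_k(S)` as a subspace. -/
def bubbleSub (k : ℕ) (S : Simp d) : Submodule ℝ (Vec d → Mat d) where
  carrier := {τ | MemBubble k S τ}
  add_mem' {f g} hf hg := ⟨(sigmaSub k S).add_mem hf.mem hg.mem, fun j x hx => by
    rw [Pi.add_apply, nt_add, hf.ntZero j x hx, hg.ntZero j x hx, add_zero]⟩
  zero_mem' := ⟨(sigmaSub k S).zero_mem, fun j x _ => nt_zero _⟩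
  smul_mem' c f hf := ⟨(sigmaSub k S).smul_mem c hf.mem, fun j x hx => by
    rw [Pi.smul_apply, nt_smul, hf.ntZero j x hx, smul_zero]⟩

instance : FiniteDimensional ℝ (bubbleSub k S) :=
  Submodule.finiteDimensional_of_le (S₂ := polyMat d k) fun _ h => h.mem.poly

theorem MemSigma.matL2 {τ : Vec d → Mat d} (h : MemSigma k S τ) (S' : Simp d) :
    MatL2 (volume.restrict (body S')) τ := matL2_body fun a b => (h.poly a b).continuous

/-- The normal-tangential component on a facet, as a tangential polynomial field. -/
theorem MemSigma.exists_nt {τ : Vec d → Mat d} (h : MemSigma k S τ) (j : Fin (d + 1)) :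
    ∃ q ∈ tangSub S j (k - 1), ∀ x ∈ facet S j, nt (τ x) (normal S j) = q x := by
  obtain ⟨q, hq, hq'⟩ := h.ntPoly j
  exact ⟨q, ⟨hq, fun x hx => by rw [← hq' x hx, inner_nt (norm_normal S j)]⟩, hq'⟩

theorem continuous_toRef (S : Simp d) : Continuous (toRef S) := by
  rw [funext (toRef_eq S)]; exact continuous_affMap

/-- The test fields of the interior moments, in terms of the unit simplex. -/
theorem ddot_conj_jac (τ η : Vec d → Mat d) (x : Vec d) :
    ddot (τ x) (jac S * η (toRef S x) * (jac S)⁻¹) =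
      ddot (pull (refSimplex d) S (jac S) (jac S)⁻¹ τ (toRef S x)) (η (toRef S x)) := by
  rw [ddot_conj, pull, toRef_eq, (affPair_ref S).symm.left_inv]

theorem matL2_conj_jac {η : Vec d → Mat d} (hη : MemBubble k (refSimplex d) η) :
    MatL2 (volume.restrict (body S)) fun x => jac S * η (toRef S x) * (jac S)⁻¹ := by
  refine matL2_body fun a b => ?_
  simp only [Matrix.mul_apply]
  exact continuous_finsetSum _ fun c _ => (continuous_finsetSum _ fun e _ => continuous_const.mul
    ((hη.mem.poly e c).continuous.comp (continuous_toRef S))).mul continuous_const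

/-- Written through the pull-back to the unit simplex, the interior moments of a bubble are its `L²`
products with reference bubbles. The square system to solve is thus a Gram system. -/
theorem exists_bubble {f : Vec d → Mat d} (hf : MatL2 (volume.restrict (body S)) f) :
    ∃ β, MemBubble k S β ∧ ∀ η, MemBubble k (refSimplex d) η →
      ∫ x in body S, ddot (f x - β x) (jac S * η (toRef S x) * (jac S)⁻¹) = 0 := by
  have hc : ∀ v : bubbleSub k (refSimplex d), MatL2 (volume.restrict (body S))
      (fun x => v.1 (toRef S x)) := fun v =>
    matL2_body fun a b => (v.2.mem.poly a b).continuous.comp (continuous_toRef S)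
  have hD : ∀ v : bubbleSub k (refSimplex d), Integrable
      (fun x => ddot (f x) (jac S * v.1 (toRef S x) * (jac S)⁻¹)) (volume.restrict (body S)) :=
    fun v => hf.integrable_ddot (matL2_conj_jac v.2)
  let B : bubbleSub k (refSimplex d) →ₗ[ℝ] bubbleSub k (refSimplex d) →ₗ[ℝ] ℝ :=
    intForm (volume.restrict (body S)) (fun v w x => ddot (v.1 (toRef S x)) (w.1 (toRef S x)))
    (fun v v' w x => ddot_add _ _ _) (fun c v w x => ddot_smul _ _ _)
    (fun v w x => ddot_comm _ _) (fun v w => (hc v).integrable_ddot (hc w))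
  let l : bubbleSub k (refSimplex d) →ₗ[ℝ] ℝ :=
    { toFun := fun v => ∫ x in body S, ddot (f x) (jac S * v.1 (toRef S x) * (jac S)⁻¹)
      map_add' := fun v w => by
        rw [← integral_add (hD v) (hD w)]
        refine integral_congr_ae (ae_of_all _ fun x => ?_)
        change ddot (f x) (jac S * (v.1 (toRef S x) + w.1 (toRef S x)) * (jac S)⁻¹) = _
        rw [Matrix.mul_add, Matrix.add_mul, ddot_comm, ddot_add]
        exact congrArg₂ _ (ddot_comm _ _) (ddot_comm _ _)
      map_smul' := fun c v => by
        rw [RingHom.id_apply, smul_eq_mul, ← integral_const_mul]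
        refine integral_congr_ae (ae_of_all _ fun x => ?_)
        change ddot (f x) (jac S * (c • v.1 (toRef S x)) * (jac S)⁻¹) = _
        rw [Matrix.mul_smul, Matrix.smul_mul, ddot_comm, ddot_smul, ddot_comm] }
  obtain ⟨β, hβ⟩ := exists_form_eq B (fun v w => integral_congr_ae
    (ae_of_all _ fun x => ddot_comm _ _)) l (fun v hv => by
      have h0 : ∫ x in body S, frobSq (v.1 (toRef S x)) = 0 := by
        rw [← hv v]
        exact integral_congr_ae (ae_of_all _ fun x => (ddot_self _).symm)
      refine integral_eq_zero_of_ae ?_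
      filter_upwards [(hc v).ae_eq_zero h0] with x hx
      rw [hx, Matrix.mul_zero, Matrix.zero_mul]
      simp [ddot])
  have hP := (affPair_ref S).symm
  refine ⟨pull S (refSimplex d) (jac S)⁻¹ (jac S) β.1, hP.memBubble_pull β.2, fun η hη => ?_⟩
  have h1 : ∫ x in body S, ddot (β.1 (toRef S x)) (η (toRef S x)) =
      ∫ x in body S, ddot (f x) (jac S * η (toRef S x) * (jac S)⁻¹) := hβ ⟨η, hη⟩
  simp only [ddot_sub]
  rw [integral_sub (hD ⟨η, hη⟩)]
  · simp only [ddot_conj_jac _ η, hP.pull_pull]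
    rw [h1]
    simp only [ddot_conj_jac f η, sub_self]
  · simp only [ddot_conj_jac _ η, hP.pull_pull]
    exact (hc β).integrable_ddot (hc ⟨η, hη⟩)

/-! ### The local interpolant -/

variable {σ τ : Vec d → Mat d}

/-- The facet moments are met by lifting the projected data facet by facet. The interior moments are
then corrected by a bubble, which leaves the facets untouched. -/
theorem exists_isLocalInterpolant (hσ : MatL2 (volume.restrict (body S)) σ)
    (ht : ∀ j, MatL2 (surf S j) (matTrace S j σ)) : ∃ τ, IsLocalInterpolant k S σ τ := by
  have h1 : ∀ j, ∃ q ∈ tangSub S j (k - 1), ∀ r ∈ tangSub S j (k - 1),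
      ∫ x, inner ℝ (nt (matTrace S j σ x) (normal S j) - q x) (r x) ∂(surf S j) = 0 := fun j =>
    exists_facet_projection ((ht j).nt _)
  choose q hq hqr using h1
  -- The lift acts by constant coefficients, so `τ0` has degree at most `k - 1`, and its component
  -- on the `j`-th facet is `q j`.
  let τ0 : Vec d → Mat d := fun x => ∑ j, ntLift S j (q j x)
  have hp0 : ∀ a b, IsPoly k fun x => τ0 x a b := fun a b => by
    simp only [τ0, Matrix.sum_apply]
    exact IsPoly.sum _ fun j _ => (isPoly_ntLift S j (hq j).1 a b).mono (Nat.sub_le _ _)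
  have hnt0 : ∀ j, ∀ x ∈ facet S j, nt (τ0 x) (normal S j) = q j x := by
    intro j x hx
    simp only [τ0]
    rw [nt_sum, Finset.sum_eq_single j, nt_ntLift_self, tang_of_inner_eq_zero ((hq j).2 x hx)]
    · intro i _ hi
      exact nt_ntLift_of_ne S hi.symm _
    · simp
  have hτ0 : MemSigma k S τ0 := ⟨hp0, fun x => by
    simp only [τ0, Matrix.trace_sum, trace_ntLift, Finset.sum_const_zero], fun j =>
    ⟨q j, (hq j).1, hnt0 j⟩⟩
  obtain ⟨β, hβ, hβη⟩ := exists_bubble (k := k) (hσ.sub (hτ0.matL2 S))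
  refine ⟨τ0 + β, (sigmaSub k S).add_mem hτ0 hβ.mem, fun j r hr hr' => ?_, fun η hη => ?_⟩
  · rw [← hqr j r ⟨hr, hr'⟩]
    refine facet_congr fun x hx => ?_
    rw [nt_sub, Pi.add_apply, nt_add, hnt0 j x hx, hβ.ntZero j x hx, add_zero]
  · rw [← hβη η hη]
    simp only [Pi.add_apply, sub_add_eq_sub_sub]

/-- The facet moments restated: the component of `τ` is the `L²` projection of that of `σ`. -/
theorem IsLocalInterpolant.facet_orthogonal (h : IsLocalInterpolant k S σ τ) {j : Fin (d + 1)}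
    {q : Vec d → Vec d} (hq : ∀ x ∈ facet S j, nt (τ x) (normal S j) = q x) :
    ∀ r ∈ tangSub S j (k - 1),
      ∫ x, inner ℝ (nt (matTrace S j σ x) (normal S j) - q x) (r x) ∂(surf S j) = 0 := by
  intro r hr
  rw [← h.facetDof j r hr.1 hr.2]
  refine facet_congr fun x hx => ?_
  rw [nt_sub, hq x hx]

theorem MemSigma.eq_zero_of_ae (h : MemSigma k S τ)
    (h0 : ∀ᵐ x ∂(volume.restrict (body S)), τ x = 0) : τ = 0 := by
  have h1 : ∀ a b, ∀ x ∈ interior (body S), τ x a b = 0 := by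
    intro a b
    have h2 : (fun x => τ x a b) =ᵐ[volume.restrict (interior (body S))] fun _ => 0 := by
      rw [restrict_interior_body]
      filter_upwards [h0] with x hx
      rw [hx]; rfl
    exact Measure.eqOn_open_of_ae_eq h2 isOpen_interior (h.poly a b).continuous.continuousOn
      continuousOn_const
  ext x a b
  exact congrFun ((h.poly a b).eq_zero_of_interior (s := interior (body S))
    (by rw [interior_interior]; exact interior_body_nonempty S) (h1 a b)) x

end Local

/-! ### Uniqueness and stability of the local interpolant -/

section Stability

variable {d : ℕ} [NeZero d] {k : ℕ} {S : Simp d} {σ τ : Vec d → Mat d}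

theorem continuous_nt_tangSub {j : Fin (d + 1)} {q : Vec d → Vec d} (hq : q ∈ tangSub S j k) :
    Continuous q := continuous_vec fun a => (hq.1 a).continuous

theorem eqOn_zero_of_integral {j : Fin (d + 1)} {q : Vec d → Vec d} (hq : q ∈ tangSub S j k)
    (h : ∫ x, ‖q x‖ ^ 2 ∂(surf S j) = 0) : ∀ x ∈ facet S j, q x = 0 :=
  eqOn_facet_of_ae S j (continuous_nt_tangSub hq) continuous_const ((vecL2_tangSub hq).ae_eq_zero h)

/-- On each facet both components are the same projection, so the difference is a bubble. Its
pull-back is an admissible interior test field, and the moment against it is the squared norm of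
that pull-back. -/
theorem IsLocalInterpolant.unique (hσ : MatL2 (volume.restrict (body S)) σ)
    (ht : ∀ j, MatL2 (surf S j) (matTrace S j σ)) {τ' : Vec d → Mat d}
    (h : IsLocalInterpolant k S σ τ) (h' : IsLocalInterpolant k S σ τ') : τ' = τ := by
  set δ : Vec d → Mat d := τ' - τ with hδ
  have hδm : MemSigma k S δ := (sigmaSub k S).sub_mem h'.mem h.mem
  have hδb : MemBubble k S δ := by
    refine ⟨hδm, fun j => ?_⟩
    obtain ⟨q, hq, hq'⟩ := h.mem.exists_nt j
    obtain ⟨r, hr, hr'⟩ := h'.mem.exists_nt j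
    have hrq := (tangSub S j (k - 1)).sub_mem hr hq
    have hg := (ht j).nt (normal S j)
    have a1 := h.facet_orthogonal hq' _ hrq
    have a2 := h'.facet_orthogonal hr' _ hrq
    have i1 := (hg.sub (vecL2_tangSub hq)).integrable_inner (vecL2_tangSub hrq)
    have i2 := (hg.sub (vecL2_tangSub hr)).integrable_inner (vecL2_tangSub hrq)
    have h0 : ∫ x, ‖(r - q) x‖ ^ 2 ∂(surf S j) = 0 := by
      refine Eq.trans ?_ ((congrArg₂ (· - ·) a1 a2).trans (sub_zero 0))
      refine Eq.trans ?_ (integral_sub i1 i2)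
      refine integral_congr_ae (ae_of_all _ fun x => ?_)
      simp only [Pi.sub_apply]
      rw [← inner_sub_left, ← real_inner_self_eq_norm_sq]
      congr 1
      abel
    intro x hx
    have := eqOn_zero_of_integral hrq h0 x hx
    rw [hδ, Pi.sub_apply, nt_sub, hq' x hx, hr' x hx]
    exact this
  have hP := affPair_ref S
  set η := pull (refSimplex d) S (jac S) (jac S)⁻¹ δ with hη
  have hηb : MemBubble k (refSimplex d) η := hP.memBubble_pull hδb
  have hηL : MatL2 (volume.restrict (body S)) fun x => η (toRef S x) :=
    matL2_body fun a b => (hηb.mem.poly a b).continuous.comp (continuous_toRef S)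
  have b1 := h.interiorDof η hηb
  have b2 := h'.interiorDof η hηb
  have h0 : ∫ x in body S, frobSq (η (toRef S x)) = 0 := by
    refine Eq.trans ?_ ((congrArg₂ (· - ·) b1 b2).trans (sub_zero 0))
    refine Eq.trans ?_ (integral_sub ((hσ.sub (h.mem.matL2 S)).integrable_ddot (matL2_conj_jac hηb))
      ((hσ.sub (h'.mem.matL2 S)).integrable_ddot (matL2_conj_jac hηb)))
    refine integral_congr_ae (ae_of_all _ fun x => ?_)
    have e := ddot_conj_jac (S := S) δ η x
    rw [← hη, ddot_self] at e
    change frobSq (η (toRef S x)) = ddot _ _ - ddot _ _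
    rw [← ddot_sub, ← e]
    congr 1
    rw [hδ, Pi.sub_apply]
    abel
  have h1 : ∀ᵐ x ∂(volume.restrict (body S)), δ x = 0 := by
    filter_upwards [hηL.ae_eq_zero h0] with x hx
    have : δ = pull S (refSimplex d) (jac S)⁻¹ (jac S) η := (hP.pull_pull δ).symm
    rw [this, pull, ← toRef_eq, hx, Matrix.mul_zero, Matrix.zero_mul]
  exact sub_eq_zero.1 (hδm.eq_zero_of_ae h1)

theorem MatL2.integral_ddot_sq_le {X : Type*} [MeasurableSpace X] {μ : Measure X} {f g : X → Mat d}
    (hf : MatL2 μ f) (hg : MatL2 μ g) :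
    (∫ x, ddot (f x) (g x) ∂μ) ^ 2 ≤ (∫ x, frobSq (f x) ∂μ) * ∫ x, frobSq (g x) ∂μ := by
  have i1 := hf.integrable_ddot hf
  have i2 := hf.integrable_ddot hg
  have i3 := hg.integrable_ddot hg
  simp only [ddot_self] at i1 i3
  have h : ∀ t : ℝ, 0 ≤ (∫ x, frobSq (g x) ∂μ) * (t * t) + (2 * ∫ x, ddot (f x) (g x) ∂μ) * t +
      ∫ x, frobSq (f x) ∂μ := by
    intro t
    have h0 : 0 ≤ ∫ x, frobSq (f x + t • g x) ∂μ := integral_nonneg fun x => frobSq_nonneg _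
    have e : ∀ x, frobSq (f x + t • g x) =
        (t * t) * frobSq (g x) + (2 * t) * ddot (f x) (g x) + frobSq (f x) := fun x => by
      rw [← ddot_self, ddot_add, ddot_smul, ddot_comm (f x), ddot_comm (g x), ddot_add, ddot_add,
        ddot_smul, ddot_smul, ddot_self, ddot_self, ddot_comm (g x)]
      ring
    simp only [e] at h0
    have i4 : Integrable (fun x => (t * t) * frobSq (g x) + (2 * t) * ddot (f x) (g x)) μ :=
      (i3.const_mul _).add (i2.const_mul _)
    rw [integral_add i4 i1, integral_add (i3.const_mul _) (i2.const_mul _), integral_const_mul,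
      integral_const_mul] at h0
    linarith
  have := discrim_le_zero h
  rw [discrim] at this
  linarith

/-- An instance of `exists_form_le` with the `L²` product as `L` and the sum of the facet products
as `N`. Being on one fixed simplex, its constant depends on `d` and `k` only. -/
theorem exists_stability_ref (d k : ℕ) [NeZero d] : ∃ C : ℝ, 0 ≤ C ∧
    ∀ v : Vec d → Mat d, MemSigma k (refSimplex d) v → ∀ M : ℝ, 0 ≤ M →
      (∀ b, MemBubble k (refSimplex d) b → (∫ x in body (refSimplex d), ddot (v x) (b x)) ^ 2 ≤
        M * ∫ x in body (refSimplex d), frobSq (b x)) →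
      ∫ x in body (refSimplex d), frobSq (v x) ≤
        C * ∑ j, ∫ x, ‖nt (v x) (normal (refSimplex d) j)‖ ^ 2 ∂(surf (refSimplex d) j) + 4 * M := by
  set R := refSimplex d
  have hm : ∀ v : sigmaSub k R, MatL2 (volume.restrict (body R)) v.1 := fun v => v.2.matL2 R
  have hn : ∀ (v : sigmaSub k R) (j : Fin (d + 1)), VecL2 (surf R j)
      (fun x => nt (v.1 x) (normal R j)) := fun v j =>
    vecL2_surf (fun a => (isPoly_nt v.2.poly _ a).continuous) j
  let L : sigmaSub k R →ₗ[ℝ] sigmaSub k R →ₗ[ℝ] ℝ :=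
    intForm (volume.restrict (body R)) (fun v w x => ddot (v.1 x) (w.1 x))
    (fun v v' w x => ddot_add _ _ _) (fun c v w x => ddot_smul _ _ _)
    (fun v w x => ddot_comm _ _) (fun v w => (hm v).integrable_ddot (hm w))
  let N : Fin (d + 1) → sigmaSub k R →ₗ[ℝ] sigmaSub k R →ₗ[ℝ] ℝ := fun j =>
    intForm (surf R j) (fun v w x => inner ℝ (nt (v.1 x) (normal R j)) (nt (w.1 x) (normal R j)))
    (fun v v' w x => by
      change inner ℝ (nt (v.1 x + v'.1 x) (normal R j)) _ = _
      rw [nt_add, inner_add_left])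
    (fun c v w x => by
      change inner ℝ (nt (c • v.1 x) (normal R j)) _ = _
      rw [nt_smul, real_inner_smul_left])
    (fun v w x => real_inner_comm _ _) (fun v w => (hn v j).integrable_inner (hn w j))
  have hNa : ∀ v w, (∑ j, N j) v w = ∑ j, N j v w := fun v w => by
    simp only [LinearMap.sum_apply]
  have hNv : ∀ j v, N j v v = ∫ x, ‖nt (v.1 x) (normal R j)‖ ^ 2 ∂(surf R j) := fun j v =>
    integral_congr_ae (ae_of_all _ fun x => real_inner_self_eq_norm_sq _)
  have hLv : ∀ v, L v v = ∫ x in body R, frobSq (v.1 x) := fun v =>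
    integral_congr_ae (ae_of_all _ fun x => ddot_self _)
  have hN0 : ∀ j v, 0 ≤ N j v v := fun j v => by
    rw [hNv]
    exact integral_nonneg fun x => sq_nonneg _
  obtain ⟨C, hC, h⟩ := exists_form_le L (∑ j, N j)
    (fun v w => integral_congr_ae (ae_of_all _ fun x => ddot_comm _ _))
    (fun v => by rw [hLv]; exact integral_nonneg fun x => frobSq_nonneg _)
    (fun v w => by
      rw [hNa, hNa]
      exact Finset.sum_congr rfl fun j _ => integral_congr_ae (ae_of_all _ fun x => real_inner_comm _ _))
    (fun v => by rw [hNa]; exact Finset.sum_nonneg fun j _ => hN0 j v)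
  refine ⟨C, hC, fun v hv M hM hb => ?_⟩
  have := h ⟨v, hv⟩ M hM (fun b hb0 => ?_)
  · rw [hLv, hNa] at this
    simpa only [hNv] using this
  -- The kernel of the facet form consists of the bubbles: a polynomial component that vanishes in
  -- `L²` of a facet vanishes on it pointwise.
  · rw [hNa, Finset.sum_eq_zero_iff_of_nonneg fun j _ => hN0 j b] at hb0
    have hbb : MemBubble k R b.1 := by
      refine ⟨b.2, fun j x hx => ?_⟩
      obtain ⟨q, hq, hq'⟩ := b.2.exists_nt j
      have h0 := hb0 j (Finset.mem_univ _)
      rw [hNv] at h0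
      rw [hq' x hx]
      refine eqOn_zero_of_integral hq ?_ x hx
      rw [← h0]
      exact facet_congr fun y hy => by rw [hq' y hy]
    rw [hLv]
    exact hb b.1 hbb

theorem AffPair.frobSq_le {S' : Simp d} {A B : Mat d} (H : AffPair S S' A B) (M : Mat d) :
    frobSq M ≤ frobSq A * frobSq B * frobSq (A.transpose * M * B.transpose) := by
  have e : M = B.transpose * (A.transpose * M * B.transpose) * A.transpose := by
    have h1 : B.transpose * A.transpose = 1 := by
      rw [← Matrix.transpose_mul, H.mul_inv, Matrix.transpose_one]
    calc M = (B.transpose * A.transpose) * M * (B.transpose * A.transpose) := by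
          rw [h1, Matrix.one_mul, Matrix.mul_one]
      _ = _ := by simp only [Matrix.mul_assoc]
  conv_lhs => rw [e]
  refine (frobSq_mul_le _ _).trans ?_
  refine (mul_le_mul_of_nonneg_right (frobSq_mul_le _ _) (frobSq_nonneg _)).trans (le_of_eq ?_)
  rw [frobSq_transpose, frobSq_transpose]
  ring

theorem frobSq_conj_le (A B M : Mat d) :
    frobSq (A.transpose * M * B.transpose) ≤ frobSq A * frobSq B * frobSq M := by
  refine (frobSq_mul_le _ _).trans ?_
  refine (mul_le_mul_of_nonneg_right (frobSq_mul_le _ _) (frobSq_nonneg _)).trans (le_of_eq ?_)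
  rw [frobSq_transpose, frobSq_transpose]
  ring

theorem AffPair.matL2_pull {S' : Simp d} {A B : Mat d} (H : AffPair S S' A B) {f : Vec d → Mat d}
    (hf : MatL2 (volume.restrict (body S')) f) :
    MatL2 (volume.restrict (body S)) (pull S S' A B f) := by
  have h1 : ∀ a b, MemLp (fun x => f (affMap S S' A x) a b) 2 (volume.restrict (body S)) := by
    intro a b
    refine (H.measurableEmbedding.memLp_map_measure_iff (g := fun x => f x a b)).1 ?_
    rw [H.map_volume_body]
    exact (hf a b).smul_measure ENNReal.ofReal_ne_top
  intro a b
  simp only [pull, Matrix.mul_apply]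
  exact memLp_finsetSum _ fun c _ => (memLp_finsetSum _ fun e _ => (h1 e c).const_mul _).mul_const _

/-- The reference estimate transported by the pull-back. Here `f` is any field with the same
interior moments as `e`; by Cauchy-Schwarz its norm bounds the action of `e` on bubbles. -/
theorem exists_stability (d k : ℕ) [NeZero d] (Γ : ℝ) : ∃ C : ℝ, 0 ≤ C ∧
    ∀ (S : Simp d) (x : Vec d) (ρ h : ℝ), 0 < ρ → Metric.closedBall x ρ ⊆ body S →
      Metric.diam (body S) ≤ h → h ≤ Γ * ρ → ∀ e f : Vec d → Mat d, MemSigma k S e →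
      MatL2 (volume.restrict (body S)) f →
      (∀ η, MemBubble k (refSimplex d) η →
        ∫ x in body S, ddot (f x - e x) (jac S * η (toRef S x) * (jac S)⁻¹) = 0) →
      ∫⁻ x in body S, ENNReal.ofReal (frobSq (e x)) ≤ ENNReal.ofReal C * (ENNReal.ofReal h *
        ∑ j, ∫⁻ x, ‖nt (e x) (normal S j)‖ₑ ^ 2 ∂(surf S j) +
        ∫⁻ x in body S, ENNReal.ofReal (frobSq (f x))) := by
  obtain ⟨C0, hC0, hstab⟩ := exists_stability_ref d k
  -- Bound for the product of the squared Frobenius norms of `F` and `F⁻¹`, at most `d h²` and `d /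
  -- ρ²`.
  set K0 : ℝ := (d : ℝ) ^ 2 * Γ ^ 2
  set C1 : ℝ := d.factorial * (√d * Γ) ^ (d - 1)
  -- The absolute value covers negative `Γ`, for which `C1` may be negative; no simplex satisfies
  -- the hypotheses then.
  refine ⟨|K0 * (C0 * (K0 * C1))| + 4 * (K0 * K0), by positivity,
    fun S x ρ h hρ hball hdiam hh e f he hf hη => ?_⟩
  have hh0 : 0 ≤ h := Metric.diam_nonneg.trans hdiam
  have hΓ : 0 ≤ Γ := nonneg_of_mul_nonneg_left (hh0.trans hh) hρ
  set A := jac S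
  set B := (jac S)⁻¹
  have H : AffPair (refSimplex d) S A B := affPair_ref S
  have hA : frobSq A ≤ d * h ^ 2 := frobSq_jac_le S hdiam
  have hB : frobSq B ≤ d / ρ ^ 2 := frobSq_jac_inv_le S hρ hball
  have hK : frobSq A * frobSq B ≤ K0 := by
    calc frobSq A * frobSq B ≤ (d * h ^ 2) * (d / ρ ^ 2) :=
          mul_le_mul hA hB (frobSq_nonneg _) (by positivity)
      _ ≤ (d * (Γ * ρ) ^ 2) * (d / ρ ^ 2) := by gcongr
      _ = K0 := by simp only [K0]; field_simp
  have hK0 : 0 ≤ K0 := by positivity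
  set D := |A.det|
  have hD : 0 < D := abs_pos.2 H.det_ne_zero
  set R := refSimplex d
  set ê := pull R S A B e
  set f' := pull R S A B f
  have hê : MemSigma k R ê := H.memSigma_pull he
  have hf' : MatL2 (volume.restrict (body R)) f' := H.matL2_pull hf
  have hêL := hê.matL2 R
  -- the estimate on the unit simplex
  have hmom : ∀ b, MemBubble k R b → ∫ x in body R, ddot (ê x) (b x) =
      ∫ x in body R, ddot (f' x) (b x) := by
    intro b hb
    let g : Vec d → ℝ := fun z => ddot (f' z) (b z) - ddot (ê z) (b z)
    have e1 : ∀ y, ddot (f y - e y) (A * b (toRef S y) * B) =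
        g (affMap S R B y) := by
      intro y
      have := ddot_conj_jac (S := S) (fun y => f y - e y) b y
      refine this.trans ?_
      rw [← toRef_eq]
      change _ = ddot (f' _) _ - ddot (ê _) _
      rw [← ddot_sub]
      congr 1
      simp only [f', ê, pull, A, B, R]
      rw [Matrix.mul_sub, Matrix.sub_mul]
    have h1 : ∫ y in body S, g (affMap S R B y) = 0 :=
      (integral_congr_ae (ae_of_all _ fun y => (e1 y).symm)).trans (hη b hb)
    rw [H.symm.integral_body, mul_eq_zero, integral_sub (hf'.integrable_ddot (hb.mem.matL2 R))
      (hêL.integrable_ddot (hb.mem.matL2 R))] at h1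
    rcases h1 with h1 | h1
    · exact absurd h1 (inv_ne_zero (abs_pos.2 H.symm.det_ne_zero).ne')
    · linarith
  have href := hstab ê hê (∫ x in body R, frobSq (f' x))
    (integral_nonneg fun x => frobSq_nonneg _) (fun b hb => by
      rw [hmom b hb]
      exact hf'.integral_ddot_sq_le (hb.mem.matL2 R))
  have hnL : ∀ j, VecL2 (surf R j) (fun x => nt (ê x) (normal R j)) := fun j =>
    vecL2_surf (fun a => (isPoly_nt hê.poly _ a).continuous) j
  have href' : ∫⁻ x in body R, ENNReal.ofReal (frobSq (ê x)) ≤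
      ENNReal.ofReal C0 * ∑ j, ∫⁻ x, ‖nt (ê x) (normal R j)‖ₑ ^ 2 ∂(surf R j) +
      4 * ∫⁻ x in body R, ENNReal.ofReal (frobSq (f' x)) := by
    rw [hêL.lintegral_eq, hf'.lintegral_eq]
    simp only [(hnL _).lintegral_eq]
    rw [← ENNReal.ofReal_sum_of_nonneg fun j _ => integral_nonneg fun x => sq_nonneg _,
      ← ENNReal.ofReal_mul hC0, show (4 : ℝ≥0∞) = ENNReal.ofReal 4 by simp,
      ← ENNReal.ofReal_mul (by norm_num), ← ENNReal.ofReal_add]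
    · exact ENNReal.ofReal_le_ofReal href
    · exact mul_nonneg hC0 (Finset.sum_nonneg fun j _ => integral_nonneg fun x => sq_nonneg _)
    · exact mul_nonneg (by norm_num) (integral_nonneg fun x => frobSq_nonneg _)
  -- scaling of the three terms
  have hvol : ∀ F : Vec d → ℝ≥0∞, ENNReal.ofReal D * ∫⁻ x in body R, F (affMap R S A x) =
      ∫⁻ x in body S, F x := by
    intro F
    rw [H.lintegral_body, ← mul_assoc, ← ENNReal.ofReal_mul hD.le, mul_inv_cancel₀ hD.ne',
      ENNReal.ofReal_one, one_mul]
  have s1 : ∫⁻ x in body S, ENNReal.ofReal (frobSq (e x)) ≤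
      ENNReal.ofReal D * (ENNReal.ofReal K0 * ∫⁻ x in body R, ENNReal.ofReal (frobSq (ê x))) := by
    rw [← hvol]
    refine mul_le_mul' le_rfl ?_
    rw [← lintegral_const_mul' _ _ ENNReal.ofReal_ne_top]
    refine lintegral_mono fun y => ?_
    rw [← ENNReal.ofReal_mul hK0]
    exact ENNReal.ofReal_le_ofReal ((H.frobSq_le _).trans
      (mul_le_mul_of_nonneg_right hK (frobSq_nonneg _)))
  have s2 : ENNReal.ofReal D * ∫⁻ x in body R, ENNReal.ofReal (frobSq (f' x)) ≤
      ENNReal.ofReal K0 * ∫⁻ x in body S, ENNReal.ofReal (frobSq (f x)) := by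
    rw [← hvol fun x => ENNReal.ofReal (frobSq (f x)), mul_left_comm]
    refine mul_le_mul' le_rfl ?_
    rw [← lintegral_const_mul' _ _ ENNReal.ofReal_ne_top]
    refine lintegral_mono fun y => ?_
    rw [← ENNReal.ofReal_mul hK0]
    exact ENNReal.ofReal_le_ofReal ((frobSq_conj_le _ _ _).trans
      (mul_le_mul_of_nonneg_right hK (frobSq_nonneg _)))
  -- A Lipschitz constant of the inverse affine map.
  set L : ℝ := √d / ρ
  have hL0 : 0 ≤ L := by positivity
  -- Volume scales like `h^d` and area like `ρ^(d-1)`; the quotient leaves the weight `h` of the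
  -- facet terms.
  have hDL : D * L ^ (d - 1) ≤ C1 * h := by
    have hdet : D ≤ d.factorial * h ^ d := abs_det_jac_le S hdiam
    have hd1 : h ^ d = h * h ^ (d - 1) := by
      rw [← pow_succ', Nat.sub_add_cancel (NeZero.one_le)]
    calc D * L ^ (d - 1) ≤ (d.factorial * h ^ d) * L ^ (d - 1) := by gcongr
      _ = d.factorial * (√d * (h / ρ)) ^ (d - 1) * h := by
          rw [hd1]
          simp only [L, mul_pow, div_pow]
          ring
      _ ≤ d.factorial * (√d * Γ) ^ (d - 1) * h := by
          gcongr
          rwa [div_le_iff₀ hρ]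
      _ = _ := rfl
  have s3 : ∀ j, ENNReal.ofReal D * ∫⁻ x, ‖nt (ê x) (normal R j)‖ₑ ^ 2 ∂(surf R j) ≤
      ENNReal.ofReal (K0 * C1) * (ENNReal.ofReal h * ∫⁻ x, ‖nt (e x) (normal S j)‖ₑ ^ 2 ∂(surf S j)) := by
    intro j
    have hm : Measurable fun x => ‖nt (e x) (normal S j)‖ₑ ^ 2 :=
      ((continuous_vec fun a => (isPoly_nt he.poly (normal S j) a).continuous).measurable.enorm).pow_const 2
    have a1 := H.lintegral_surf_le j hm (L := L.toNNReal) (by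
      rw [Real.coe_toNNReal _ hL0]
      refine hB.trans (le_of_eq ?_)
      simp only [L]
      rw [div_pow, Real.sq_sqrt (Nat.cast_nonneg _)])
    have a2 : ∫⁻ x, ‖nt (ê x) (normal R j)‖ₑ ^ 2 ∂(surf R j) ≤
        ENNReal.ofReal K0 * ∫⁻ x, ‖nt (e (affMap R S A x)) (normal S j)‖ₑ ^ 2 ∂(surf R j) := by
      rw [← lintegral_const_mul' _ _ ENNReal.ofReal_ne_top]
      refine lintegral_mono fun y => ?_
      have hn : ∀ v : Vec d, ‖v‖ₑ ^ 2 = ENNReal.ofReal (‖v‖ ^ 2) := fun v => by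
        rw [← ofReal_norm, ENNReal.ofReal_pow (norm_nonneg _)]
      rw [hn, hn, ← ENNReal.ofReal_mul hK0]
      exact ENNReal.ofReal_le_ofReal ((H.norm_nt_conj_sq_le j _).trans
        (mul_le_mul_of_nonneg_right hK (sq_nonneg _)))
    have hLe : ((L.toNNReal : ℝ≥0∞)) ^ (d - 1) = ENNReal.ofReal (L ^ (d - 1)) := by
      rw [ENNReal.ofReal_pow hL0]; rfl
    rw [hLe] at a1
    calc _ ≤ ENNReal.ofReal D * (ENNReal.ofReal K0 * (ENNReal.ofReal (L ^ (d - 1)) *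
          ∫⁻ x, ‖nt (e x) (normal S j)‖ₑ ^ 2 ∂(surf S j))) := by
          exact mul_le_mul' le_rfl (a2.trans (mul_le_mul' le_rfl a1))
      _ = ENNReal.ofReal (K0 * (D * L ^ (d - 1))) *
          ∫⁻ x, ‖nt (e x) (normal S j)‖ₑ ^ 2 ∂(surf S j) := by
          rw [ENNReal.ofReal_mul hK0, ENNReal.ofReal_mul hD.le]; ring
      _ ≤ ENNReal.ofReal (K0 * (C1 * h)) * ∫⁻ x, ‖nt (e x) (normal S j)‖ₑ ^ 2 ∂(surf S j) := by
          gcongr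
      _ = _ := by
          rw [← mul_assoc K0, ENNReal.ofReal_mul (by positivity), mul_assoc]
  calc _ ≤ ENNReal.ofReal D * (ENNReal.ofReal K0 * (ENNReal.ofReal C0 *
        ∑ j, ∫⁻ x, ‖nt (ê x) (normal R j)‖ₑ ^ 2 ∂(surf R j) +
        4 * ∫⁻ x in body R, ENNReal.ofReal (frobSq (f' x)))) :=
        s1.trans (mul_le_mul' le_rfl (mul_le_mul' le_rfl href'))
    _ = ENNReal.ofReal K0 * (ENNReal.ofReal C0 *
        ∑ j, ENNReal.ofReal D * ∫⁻ x, ‖nt (ê x) (normal R j)‖ₑ ^ 2 ∂(surf R j) +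
        4 * (ENNReal.ofReal D * ∫⁻ x in body R, ENNReal.ofReal (frobSq (f' x)))) := by
        rw [← Finset.mul_sum]; ring
    _ ≤ ENNReal.ofReal K0 * (ENNReal.ofReal C0 *
        ∑ j, ENNReal.ofReal (K0 * C1) * (ENNReal.ofReal h *
          ∫⁻ x, ‖nt (e x) (normal S j)‖ₑ ^ 2 ∂(surf S j)) +
        4 * (ENNReal.ofReal K0 * ∫⁻ x in body S, ENNReal.ofReal (frobSq (f x)))) := by
        refine mul_le_mul' le_rfl (add_le_add (mul_le_mul' le_rfl
          (Finset.sum_le_sum fun j _ => s3 j)) (mul_le_mul' le_rfl s2))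
    _ = ENNReal.ofReal (K0 * (C0 * (K0 * C1))) * (ENNReal.ofReal h *
        ∑ j, ∫⁻ x, ‖nt (e x) (normal S j)‖ₑ ^ 2 ∂(surf S j)) +
        ENNReal.ofReal (4 * (K0 * K0)) * ∫⁻ x in body S, ENNReal.ofReal (frobSq (f x)) := by
        have e2 : ENNReal.ofReal (K0 * (C0 * (K0 * C1))) =
            ENNReal.ofReal K0 * (ENNReal.ofReal C0 * ENNReal.ofReal (K0 * C1)) := by
          rw [ENNReal.ofReal_mul hK0, ENNReal.ofReal_mul hC0]
        have e3 : ENNReal.ofReal (4 * (K0 * K0)) = 4 * (ENNReal.ofReal K0 * ENNReal.ofReal K0) := by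
          rw [ENNReal.ofReal_mul zero_le_four, ENNReal.ofReal_mul hK0]
          simp
        rw [← Finset.mul_sum, ← Finset.mul_sum, e2, e3]
        ring
    _ ≤ _ := by
        rw [mul_add]
        refine add_le_add (mul_le_mul' (ENNReal.ofReal_le_ofReal ?_) le_rfl)
          (mul_le_mul' (ENNReal.ofReal_le_ofReal ?_) le_rfl)
        · have := le_abs_self (K0 * (C0 * (K0 * C1)))
          nlinarith [mul_nonneg hK0 hK0]
        · have := abs_nonneg (K0 * (C0 * (K0 * C1)))
          linarith

end Stability

/-! ### Error estimate on one element -/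

section LocalEstimate

variable {d : ℕ} {S : Simp d}

/-- The trace-free part of a matrix. -/
def dev (M : Mat d) : Mat d := M - (M.trace / d) • 1

theorem ddot_one (M : Mat d) : ddot M 1 = M.trace := by
  rw [ddot_eq_trace, Matrix.transpose_one, Matrix.mul_one]

theorem trace_dev [NeZero d] (M : Mat d) : (dev M).trace = 0 := by
  have : (d : ℝ) ≠ 0 := Nat.cast_ne_zero.2 (NeZero.ne d)
  rw [dev, Matrix.trace_sub, Matrix.trace_smul, Matrix.trace_one, Fintype.card_fin, smul_eq_mul,
    div_mul_cancel₀ _ this, sub_self]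

/-- The trace-free part is the orthogonal projection onto the complement of the identity in the
Frobenius product. -/
theorem frobSq_dev_le [NeZero d] (M : Mat d) : frobSq (dev M) ≤ frobSq M := by
  have h1 : frobSq (dev M) = ddot M (dev M) := by
    calc frobSq (dev M) = ddot (dev M) (dev M) := (ddot_self _).symm
      _ = ddot M (dev M) - M.trace / d * ddot 1 (dev M) := by rw [← ddot_smul, ← ddot_sub]; rfl
      _ = _ := by rw [ddot_comm 1, ddot_one, trace_dev, mul_zero, sub_zero]
  have h2 := ddot_sq_le M (dev M)
  rw [← h1] at h2
  have h3 := frobSq_nonneg M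
  have h4 := frobSq_nonneg (dev M)
  by_contra h
  push Not at h
  nlinarith

theorem nt_dev {n : Vec d} (hn : ‖n‖ = 1) (M : Mat d) : nt (dev M) n = nt M n := by
  rw [dev, nt_sub, nt_smul, nt_one hn, smul_zero, sub_zero]

theorem dev_sub_of_trace_eq_zero {M : Mat d} (hM : M.trace = 0) (P : Mat d) :
    M - dev P = dev (M - P) := by
  rw [dev, dev, Matrix.trace_sub, hM, zero_sub, neg_div, neg_smul]
  abel

theorem isPoly_dev {k : ℕ} {p : Vec d → Mat d} (hp : ∀ a b, IsPoly k fun x => p x a b)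
    (a b : Fin d) : IsPoly k fun x => dev (p x) a b := by
  have h : (fun x => dev (p x) a b) = fun x => p x a b -
      (∑ c, p x c c) * ((d : ℝ)⁻¹ * (1 : Mat d) a b) := by
    ext x
    simp [dev, Matrix.trace, div_eq_mul_inv, mul_assoc]
  rw [h]
  exact (hp a b).sub ((IsPoly.sum _ fun c _ => hp c c).mul_const _)

theorem frobSq_sub_le (A B C : Mat d) :
    frobSq (A - C) ≤ 2 * frobSq (A - B) + 2 * frobSq (B - C) := by
  unfold frobSq
  rw [Finset.mul_sum, Finset.mul_sum, ← Finset.sum_add_distrib]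
  refine Finset.sum_le_sum fun a _ => ?_
  rw [Finset.mul_sum, Finset.mul_sum, ← Finset.sum_add_distrib]
  refine Finset.sum_le_sum fun b _ => ?_
  simp only [Matrix.sub_apply]
  nlinarith [sq_nonneg ((A a b - B a b) - (B a b - C a b))]

theorem enorm_nt_sq_le (M : Mat d) {n : Vec d} (hn : ‖n‖ = 1) :
    ‖nt M n‖ₑ ^ 2 ≤ ENNReal.ofReal (frobSq M) := by
  rw [← ofReal_norm, ← ENNReal.ofReal_pow (norm_nonneg _)]
  exact ENNReal.ofReal_le_ofReal (norm_nt_sq_le M hn)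

theorem inner_normal_mem_Icc [NeZero d] (S : Simp d) (j : Fin (d + 1)) {x : Vec d}
    (hx : x ∈ body S) :
    (inner ℝ (normal S j) (x - S.points j) : ℝ) ∈ Set.Icc 0 (S.height j) := by
  have hc : Convex ℝ {x : Vec d | (inner ℝ (normal S j) (x - S.points j) : ℝ) ∈
      Set.Icc 0 (S.height j)} := by
    have : {x : Vec d | (inner ℝ (normal S j) (x - S.points j) : ℝ) ∈ Set.Icc 0 (S.height j)} =
        innerSL ℝ (normal S j) ⁻¹' Set.Icc (inner ℝ (normal S j) (S.points j))
          (inner ℝ (normal S j) (S.points j) + S.height j) := by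
      ext x
      simp only [inner_sub_right, Set.mem_Icc, Set.mem_ofPred_eq, Set.mem_preimage,
        innerSL_apply_apply]
      constructor <;> rintro ⟨h1, h2⟩ <;> constructor <;> linarith
    rw [this]
    exact (convex_Icc _ _).linear_preimage (innerSL ℝ (normal S j)).toLinearMap
  refine convexHull_min ?_ hc hx
  rintro _ ⟨i, rfl⟩
  rcases eq_or_ne i j with rfl | h
  · simp [(S.height_pos i).le]
  · rw [Set.mem_ofPred_eq, inner_normal_sub S h]
    exact ⟨(S.height_pos j).le, le_rfl⟩

/-- The distance to the parallel of the facet through its opposite vertex lies between `0` and the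
height on the simplex, and grows by `ρ` from the centre of the ball in the direction of the normal.
-/
theorem le_height [NeZero d] (S : Simp d) (j : Fin (d + 1)) {x : Vec d} {ρ : ℝ} (hρ : 0 < ρ)
    (hS : Metric.closedBall x ρ ⊆ body S) : ρ ≤ S.height j := by
  have h1 := (inner_normal_mem_Icc S j (hS (Metric.mem_closedBall_self hρ.le))).1
  have h2 : x + ρ • normal S j ∈ body S := hS (by
    rw [Metric.mem_closedBall, dist_eq_norm, add_sub_cancel_left, norm_smul, norm_normal,
      mul_one, Real.norm_of_nonneg hρ.le])
  have h3 := (inner_normal_mem_Icc S j h2).2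
  rw [add_sub_right_comm, inner_add_right, inner_smul_right, inner_normal_self, mul_one] at h3
  linarith

theorem ofReal_mul_traceConst_le [NeZero d] (S : Simp d) (j : Fin (d + 1)) {x : Vec d} {ρ h Γ : ℝ}
    (hρ : 0 < ρ) (hS : Metric.closedBall x ρ ⊆ body S) (h0 : 0 ≤ h) (hh : h ≤ Γ * ρ) :
    ENNReal.ofReal h * traceConst S j ≤ ENNReal.ofReal (4 * 2 ^ (d - 1) * Γ) := by
  have h1 := le_height S j hρ hS
  rw [traceConst, mul_left_comm, ← ENNReal.ofReal_mul h0, show (4 : ℝ≥0∞) = ENNReal.ofReal 4 by simp,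
    ← ENNReal.ofReal_mul (by norm_num)]
  refine ENNReal.ofReal_le_ofReal ?_
  rw [mul_assoc, mul_div_left_comm]
  refine mul_le_mul_of_nonneg_left (mul_le_mul_of_nonneg_left ?_ (by positivity)) (by norm_num)
  rw [div_le_iff₀ (hρ.trans_le h1)]
  have hΓ : 0 ≤ Γ := nonneg_of_mul_nonneg_left (h0.trans hh) hρ
  exact hh.trans (mul_le_mul_of_nonneg_left h1 hΓ)

theorem exists_volume_const (d : ℕ) (Γ : ℝ) : ∃ K : ℝ, 1 ≤ K ∧
    ∀ (S : Simp d) (x : Vec d) (ρ h : ℝ), 0 < ρ → Metric.closedBall x ρ ⊆ body S → 0 ≤ h →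
      h ≤ Γ * ρ → ENNReal.ofReal (h ^ d) ≤ ENNReal.ofReal K * volume (interior (body S)) := by
  set v := (volume (Metric.ball (0 : Vec d) 1)).toReal
  have hvt : volume (Metric.ball (0 : Vec d) 1) ≠ ⊤ := measure_ball_lt_top.ne
  have hv : 0 < v := ENNReal.toReal_pos (Metric.measure_ball_pos volume _ one_pos).ne' hvt
  -- Comparison with the inscribed ball, of volume `ρ^d v`; the added `1` and the absolute value
  -- ensure `1 ≤ K` for every `Γ`.
  refine ⟨1 + |Γ ^ d / v|, by simp, fun S x ρ h hρ hS h0 hh => ?_⟩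
  have h1 : Metric.ball x ρ ⊆ interior (body S) :=
    interior_maximal (Metric.ball_subset_closedBall.trans hS) Metric.isOpen_ball
  refine le_trans ?_ (mul_le_mul' le_rfl (measure_mono h1))
  rw [Measure.addHaar_ball_of_pos _ _ hρ, finrank_euclideanSpace_fin, ← ENNReal.ofReal_toReal hvt,
    ← ENNReal.ofReal_mul (by positivity), ← ENNReal.ofReal_mul (by positivity)]
  refine ENNReal.ofReal_le_ofReal ?_
  calc h ^ d ≤ (Γ * ρ) ^ d := pow_le_pow_left₀ h0 hh d
    _ = Γ ^ d / v * (ρ ^ d * v) := by rw [mul_pow]; field_simp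
    _ ≤ (1 + |Γ ^ d / v|) * (ρ ^ d * v) := by
        refine mul_le_mul_of_nonneg_right ?_ (by positivity)
        linarith [le_abs_self (Γ ^ d / v)]

variable {k : ℕ} {σ τ : Vec d → Mat d}

/-- The error of the local interpolant, in terms of that of a polynomial approximation. -/
theorem IsLocalInterpolant.facet_error_le [NeZero d] {h Γ ρ : ℝ} {x : Vec d}
    (hρ : 0 < ρ)
    (hS : Metric.closedBall x ρ ⊆ body S) (hdiam : Metric.diam (body S) ≤ h) (hh : h ≤ Γ * ρ)
    {g : Fin d → Fin d → Fin d → Vec d → ℝ}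
    (hg : ∀ a b, IsWeakGrad (interior (body S)) (fun x => σ x a b) (g a b))
    (hτ : IsLocalInterpolant k S σ τ) {P : Fin d → Fin d → MvPolynomial (Fin d) ℝ}
    (hP : ∀ a b, (P a b).totalDegree ≤ k - 1) (j : Fin (d + 1)) :
    ENNReal.ofReal h * ∫⁻ x, ‖nt (matTrace S j σ x - τ x) (normal S j)‖ₑ ^ 2 ∂(surf S j) ≤
      ENNReal.ofReal (16 * 2 ^ (d - 1) * Γ) * ∑ a, ∑ b, scaledSq (interior (body S)) h
        (fun x => σ x a b - polyFun (P a b) x) (fun i x => g a b i x - grad (polyFun (P a b)) i x) ∧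
    ENNReal.ofReal h * ∫⁻ x, ‖nt (τ x - Matrix.of (fun a b => polyFun (P a b) x)) (normal S j)‖ₑ ^ 2
        ∂(surf S j) ≤
      ENNReal.ofReal (16 * 2 ^ (d - 1) * Γ) * ∑ a, ∑ b, scaledSq (interior (body S)) h
        (fun x => σ x a b - polyFun (P a b) x) (fun i x => g a b i x - grad (polyFun (P a b)) i x) := by
  set n := normal S j
  have hn : ‖n‖ = 1 := norm_normal S j
  set R := ∑ a, ∑ b, scaledSq (interior (body S)) h
        (fun x => σ x a b - polyFun (P a b) x) (fun i x => g a b i x - grad (polyFun (P a b)) i x)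
  have htr : ∀ a b, IsTrace S j (fun x => σ x a b) (fun x => matTrace S j σ x a b) := fun a b =>
    (hg a b).isTrace_trace j
  have htL : MatL2 (surf S j) (matTrace S j σ) := fun a b => (htr a b).1
  set p : Vec d → Mat d := fun x => Matrix.of fun a b => polyFun (P a b) x
  have hp : ∀ a b, IsPoly (k - 1) fun x => p x a b := fun a b => isPoly_polyFun (hP a b)
  obtain ⟨q, hq, hq'⟩ := hτ.mem.exists_nt j
  -- The component of the polynomial approximation competes with the projection `q`.
  have hpt : (fun x => nt (p x) n) ∈ tangSub S j (k - 1) :=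
    ⟨isPoly_nt hp n, fun x _ => inner_nt hn _⟩
  obtain ⟨b1, b2⟩ := lintegral_facet_projection_le (htL.nt n) hq hpt (hτ.facet_orthogonal hq')
  have hpL : MatL2 (surf S j) p := fun a b => by
    have := vecL2_surf (S := S) (f := fun x => WithLp.toLp 2 fun _ => p x a b)
      (fun _ => (hp a b).continuous) j
    exact this a
  -- The constant is `4` from the trace estimate times `4 * 2 ^ (d - 1) * Γ` from `h` times the
  -- constant of the trace inequality.
  have hmain : ENNReal.ofReal h * ∫⁻ x, ‖nt (matTrace S j σ x) n - nt (p x) n‖ₑ ^ 2 ∂(surf S j) ≤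
      ENNReal.ofReal (16 * 2 ^ (d - 1) * Γ) * R := by
    have c1 : ∫⁻ x, ‖nt (matTrace S j σ x) n - nt (p x) n‖ₑ ^ 2 ∂(surf S j) ≤
        4 * (traceConst S j * R) := by
      calc _ ≤ ∫⁻ x, ENNReal.ofReal (frobSq (matTrace S j σ x - p x)) ∂(surf S j) := by
            refine lintegral_mono fun x => ?_
            rw [← nt_sub]
            exact enorm_nt_sq_le _ hn
        _ = ∑ a, ∑ b, nsq (surf S j) fun x => matTrace S j σ x a b - p x a b :=
            (htL.sub hpL).lintegral_frobSq
        _ ≤ ∑ a, ∑ b, 4 * (traceConst S j * scaledSq (interior (body S)) h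
              (fun x => σ x a b - polyFun (P a b) x)
              (fun i x => g a b i x - grad (polyFun (P a b)) i x)) :=
            Finset.sum_le_sum fun a _ => Finset.sum_le_sum fun b _ =>
              IsTrace.nsq_sub_le (hg a b) (htr a b) hdiam (contDiff_polyFun _)
        _ = _ := by simp only [← Finset.mul_sum, R]
    have hh0 : 0 ≤ h := Metric.diam_nonneg.trans hdiam
    have hΓ : 0 ≤ Γ := nonneg_of_mul_nonneg_left (hh0.trans hh) hρ
    calc _ ≤ ENNReal.ofReal h * (4 * (traceConst S j * R)) := mul_le_mul' le_rfl c1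
      _ = 4 * (ENNReal.ofReal h * traceConst S j) * R := by ring
      _ ≤ 4 * ENNReal.ofReal (4 * 2 ^ (d - 1) * Γ) * R :=
          mul_le_mul' (mul_le_mul' le_rfl (ofReal_mul_traceConst_le S j hρ hS hh0 hh)) le_rfl
      _ = _ := by
          rw [show (4 : ℝ≥0∞) = ENNReal.ofReal 4 by simp, ← ENNReal.ofReal_mul (by norm_num)]
          congr 2
          ring
  have hF : MeasurableSet (facet S j) := (isCompact_facet S j).isClosed.measurableSet
  constructor
  · refine le_trans (mul_le_mul' le_rfl (le_trans (le_of_eq ?_) b1)) hmain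
    refine setLIntegral_congr_fun hF fun x hx => ?_
    simp only [nt_sub]
    rw [hq' x hx]
  · refine le_trans (mul_le_mul' le_rfl (le_trans (le_of_eq ?_) b2)) hmain
    refine setLIntegral_congr_fun hF fun x hx => ?_
    simp only [nt_sub]
    rw [hq' x hx]

/-- The comparison fields are Bramble-Hilbert polynomials of the entries of `σ`. The facet bound is
then the best approximation property, the interior bound the stability of `τ - q` for the trace-free
part `q` of the approximation. -/
theorem exists_local_estimate (d k : ℕ) [NeZero d] (Γ : ℝ) : ∃ C : ℝ, 0 < C ∧
    ∀ (S : Simp d) (x : Vec d) (ρ h : ℝ), 0 < ρ → Metric.closedBall x ρ ⊆ body S →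
      Metric.diam (body S) ≤ h → h ≤ Γ * ρ → ∀ (s : ℝ), 1 ≤ s → s ≤ k →
      ∀ σ τ : Vec d → Mat d,
      (∀ a b, ∃ g, IsWeakGrad (interior (body S)) (fun x => σ x a b) g) →
      IsLocalInterpolant k S σ τ →
      (∀ j, ENNReal.ofReal h * ∫⁻ x, ‖nt (matTrace S j σ x - τ x) (normal S j)‖ₑ ^ 2 ∂(surf S j) ≤
        ENNReal.ofReal (C * h ^ (2 * s)) *
          ∑ a, ∑ b, sobolevNormSq (interior (body S)) s (fun x => σ x a b)) ∧
      ((∀ᵐ x ∂(volume.restrict (body S)), (σ x).trace = 0) →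
        ∑ a, ∑ b, ∫⁻ x in body S, ‖σ x a b - τ x a b‖ₑ ^ 2 ≤ ENNReal.ofReal (C * h ^ (2 * s)) *
          ∑ a, ∑ b, sobolevNormSq (interior (body S)) s (fun x => σ x a b)) := by
  obtain ⟨C1, hC1, hstab⟩ := exists_stability d k Γ
  obtain ⟨K, hK, hvol⟩ := exists_volume_const d Γ
  set c0 : ℝ := 2 * (2 ^ (d + 2)) ^ k * K
  have hc0 : 0 < c0 := by positivity
  set cF : ℝ := 16 * 2 ^ (d - 1) * |Γ|
  have hcF : 0 ≤ cF := by positivity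
  -- From `‖σ - τ‖² ≤ 2‖σ - q‖² + 2‖τ - q‖²`: stability bounds the last term by `d + 1` facet terms
  -- and one further `‖σ - q‖²`.
  set cL : ℝ := 2 + 2 * (C1 * ((d + 1) * cF + 1))
  have hcL : 0 < cL := by positivity
  refine ⟨(cF + cL) * c0, by positivity,
    fun S x ρ h hρ hS hdiam hh s hs hsk σ τ hg hτ => ?_⟩
  choose g hg using hg
  have hne := interior_body_nonempty S
  have h0' : 0 ≤ h := Metric.diam_nonneg.trans hdiam
  have h0 : 0 < h := by
    have h1 := le_height S 0 hρ hS
    have h2 := hρ.trans_le h1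
    have h3 : S.height 0 ≤ h := by
      obtain ⟨l, hl⟩ : ∃ l : Fin (d + 1), l ≠ 0 := exists_ne 0
      rw [← inner_normal_sub S hl]
      refine (real_inner_le_norm _ _).trans ?_
      rw [norm_normal, one_mul]
      exact norm_sub_le_of_diam S hdiam (point_mem_body S 0) (point_mem_body S l)
    linarith
  have hΓ : 0 ≤ Γ := nonneg_of_mul_nonneg_left (h0'.trans hh) hρ
  have hcFΓ : 16 * 2 ^ (d - 1) * Γ = cF := by simp only [cF, abs_of_nonneg hΓ]
  have hσL : MatL2 (volume.restrict (body S)) σ := fun a b => by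
    rw [← restrict_interior_body]
    exact (hg a b).memLp
  set N := ∑ a, ∑ b, sobolevNormSq (interior (body S)) s (fun x => σ x a b) with hN
  -- passage to the limit in the approximation of the infimum
  have hlim : ∀ (Q : ℝ≥0∞) (c : ℝ), 0 ≤ c → c ≤ cF + cL →
      (∀ ε : ℝ≥0∞, ε ≠ 0 → Q ≤ ENNReal.ofReal c *
        (ENNReal.ofReal (c0 * h ^ (2 * s)) * ∑ a : Fin d, ∑ b : Fin d,
          (sobolevNormSq (interior (body S)) s (fun x => σ x a b) + ε))) →
      Q ≤ ENNReal.ofReal ((cF + cL) * c0 * h ^ (2 * s)) * N := by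
    intro Q c hc hcc hQ
    have hs0 : ∀ ε : ℝ≥0∞, ∑ a : Fin d, ∑ b : Fin d,
        (sobolevNormSq (interior (body S)) s (fun x => σ x a b) + ε) = N + d * (d * ε) := by
      intro ε
      simp only [Finset.sum_add_distrib, hN, Finset.sum_const, Finset.card_univ, Fintype.card_fin,
        nsmul_eq_mul]
    have ht : Tendsto (fun l : ℕ => ENNReal.ofReal c * (ENNReal.ofReal (c0 * h ^ (2 * s)) *
        (N + d * (d * (l : ℝ≥0∞)⁻¹)))) atTop (𝓝 (ENNReal.ofReal c * (ENNReal.ofReal (c0 * h ^ (2 * s)) *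
        (N + d * (d * 0))))) := by
      refine ENNReal.Tendsto.const_mul (ENNReal.Tendsto.const_mul ?_ (Or.inr ENNReal.ofReal_ne_top))
        (Or.inr ENNReal.ofReal_ne_top)
      refine tendsto_const_nhds.add (ENNReal.Tendsto.const_mul (ENNReal.Tendsto.const_mul
        ENNReal.tendsto_inv_nat_nhds_zero (Or.inr (by simp))) (Or.inr (by simp)))
    refine (ge_of_tendsto' ht fun l => ?_).trans ?_
    · rw [← hs0]
      exact hQ _ (by simp)
    · rw [mul_zero, mul_zero, add_zero, ← mul_assoc, ← ENNReal.ofReal_mul hc, mul_assoc (cF + cL)]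
      refine mul_le_mul' (ENNReal.ofReal_le_ofReal ?_) le_rfl
      exact mul_le_mul_of_nonneg_right hcc (by positivity)
  have happrox : ∀ ε : ℝ≥0∞, ε ≠ 0 → ∃ P : Fin d → Fin d → MvPolynomial (Fin d) ℝ,
      (∀ a b, (P a b).totalDegree ≤ k - 1) ∧ ∑ a, ∑ b, scaledSq (interior (body S)) h
        (fun x => σ x a b - polyFun (P a b) x) (fun i x => g a b i x - grad (polyFun (P a b)) i x) ≤
        ENNReal.ofReal (c0 * h ^ (2 * s)) * ∑ a : Fin d, ∑ b : Fin d,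
          (sobolevNormSq (interior (body S)) s (fun x => σ x a b) + ε) := by
    intro ε hε
    have : ∀ a b, ∃ p : MvPolynomial (Fin d) ℝ, p.totalDegree ≤ k - 1 ∧
        scaledSq (interior (body S)) h (fun x => σ x a b - polyFun p x)
          (fun i x => g a b i x - grad (polyFun p) i x) ≤ ENNReal.ofReal (c0 * h ^ (2 * s)) *
          (sobolevNormSq (interior (body S)) s (fun x => σ x a b) + ε) := fun a b =>
      exists_poly_scaledSq_le_sobolevNormSq isOpen_interior (isBounded_interior_body S)
        (convex_body S).interior hne h0
        (fun x hx y hy => norm_sub_le_of_diam S hdiam (interior_subset hx) (interior_subset hy))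
        hK (hvol S x ρ h hρ hS h0' hh) hs hsk (hg a b) hε
    choose P hP1 hP2 using this
    refine ⟨P, hP1, ?_⟩
    simp only [Finset.mul_sum]
    exact Finset.sum_le_sum fun a _ => Finset.sum_le_sum fun b _ => hP2 a b
  refine ⟨fun j => hlim _ cF hcF (by linarith) fun ε hε => ?_, fun htr =>
    hlim _ cL hcL.le (by linarith) fun ε hε => ?_⟩
  · obtain ⟨P, hP1, hP2⟩ := happrox ε hε
    have := (hτ.facet_error_le hρ hS hdiam hh hg hP1 j).1
    rw [hcFΓ] at this
    exact this.trans (mul_le_mul' le_rfl hP2)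
  · obtain ⟨P, hP1, hP2⟩ := happrox ε hε
    refine le_trans ?_ (mul_le_mul' le_rfl hP2)
    set R := ∑ a, ∑ b, scaledSq (interior (body S)) h
        (fun x => σ x a b - polyFun (P a b) x) (fun i x => g a b i x - grad (polyFun (P a b)) i x)
    set p : Vec d → Mat d := fun x => Matrix.of fun a b => polyFun (P a b) x
    have hp : ∀ a b, IsPoly (k - 1) fun x => p x a b := fun a b => isPoly_polyFun (hP1 a b)
    set q : Vec d → Mat d := fun x => dev (p x)
    -- Degree `k - 1` makes the facet condition of `Σ_k` automatic.
    have hq : MemSigma k S q := ⟨fun a b => (isPoly_dev hp a b).mono (Nat.sub_le _ _),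
      fun x => trace_dev _, fun j => ⟨fun x => nt (p x) (normal S j), isPoly_nt hp _,
        fun x _ => nt_dev (norm_normal S j) _⟩⟩
    have hpL : MatL2 (volume.restrict (body S)) p := matL2_body fun a b => (hp a b).continuous
    have hqL := hq.matL2 S
    have hτL := hτ.mem.matL2 S
    have hσp : ∫⁻ x in body S, ENNReal.ofReal (frobSq (σ x - p x)) ≤ R := by
      rw [(hσL.sub hpL).lintegral_frobSq]
      refine Finset.sum_le_sum fun a _ => Finset.sum_le_sum fun b _ => ?_
      unfold scaledSq
      rw [restrict_interior_body]
      exact le_self_add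
    -- The only place where `tr σ = 0` is used: it makes `σ - q` the trace-free part of `σ - p`.
    have hσq : ∫⁻ x in body S, ENNReal.ofReal (frobSq (σ x - q x)) ≤ R := by
      refine le_trans (lintegral_mono_ae ?_) hσp
      filter_upwards [htr] with x hx
      simp only [q]
      rw [dev_sub_of_trace_eq_zero hx]
      exact ENNReal.ofReal_le_ofReal (frobSq_dev_le _)
    -- The interior moments of `τ - q` and `σ - q` agree because those of `τ` and `σ` do.
    have hst := hstab S x ρ h hρ hS hdiam hh (τ - q) (fun x => σ x - q x)
      ((sigmaSub k S).sub_mem hτ.mem hq) (hσL.sub hqL) (fun η hη => by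
        rw [← hτ.interiorDof η hη]
        refine integral_congr_ae (ae_of_all _ fun y => ?_)
        simp only [Pi.sub_apply, sub_sub_sub_cancel_right])
    have hfac : ENNReal.ofReal h * ∑ j, ∫⁻ x, ‖nt ((τ - q) x) (normal S j)‖ₑ ^ 2 ∂(surf S j) ≤
        ENNReal.ofReal ((d + 1) * cF) * R := by
      rw [Finset.mul_sum]
      calc _ ≤ ∑ _j : Fin (d + 1), ENNReal.ofReal cF * R := by
            refine Finset.sum_le_sum fun j _ => ?_
            have := (hτ.facet_error_le hρ hS hdiam hh hg hP1 j).2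
            rw [hcFΓ] at this
            refine le_trans (le_of_eq ?_) this
            refine congrArg _ (lintegral_congr fun y => ?_)
            rw [Pi.sub_apply, nt_sub, nt_sub, nt_dev (norm_normal S j)]
        _ = _ := by
            have e : ENNReal.ofReal ((d + 1) * cF) = ((d + 1 : ℕ) : ℝ≥0∞) * ENNReal.ofReal cF := by
              rw [ENNReal.ofReal_mul (by positivity), ← Nat.cast_succ, ENNReal.ofReal_natCast]
            rw [Finset.sum_const, Finset.card_univ, Fintype.card_fin, nsmul_eq_mul, e, mul_assoc]
    have hτq : ∫⁻ x in body S, ENNReal.ofReal (frobSq ((τ - q) x)) ≤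
        ENNReal.ofReal (C1 * ((d + 1) * cF + 1)) * R := by
      refine hst.trans ((mul_le_mul' le_rfl (add_le_add hfac hσq)).trans (le_of_eq ?_))
      rw [ENNReal.ofReal_mul hC1, ENNReal.ofReal_add (by positivity) zero_le_one,
        ENNReal.ofReal_one]
      ring
    have hm : AEMeasurable (fun x => ENNReal.ofReal (frobSq (σ x - q x)))
        (volume.restrict (body S)) := by
      have := (hσL.sub hqL).integrable_ddot (hσL.sub hqL)
      simp only [ddot_self] at this
      exact this.1.aemeasurable.ennreal_ofReal
    calc ∑ a, ∑ b, ∫⁻ x in body S, ‖σ x a b - τ x a b‖ₑ ^ 2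
        = ∫⁻ x in body S, ENNReal.ofReal (frobSq (σ x - τ x)) :=
          (hσL.sub hτL).lintegral_frobSq.symm
      _ ≤ ∫⁻ x in body S, (2 * ENNReal.ofReal (frobSq (σ x - q x)) +
            2 * ENNReal.ofReal (frobSq ((τ - q) x))) := by
          refine lintegral_mono fun x => ?_
          rw [show (2 : ℝ≥0∞) = ENNReal.ofReal 2 by simp, ← ENNReal.ofReal_mul zero_le_two,
            ← ENNReal.ofReal_mul zero_le_two, ← ENNReal.ofReal_add
            (mul_nonneg zero_le_two (frobSq_nonneg _)) (mul_nonneg zero_le_two (frobSq_nonneg _))]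
          refine ENNReal.ofReal_le_ofReal ((frobSq_sub_le _ (q x) _).trans (le_of_eq ?_))
          congr 2
          unfold frobSq
          refine Finset.sum_congr rfl fun a _ => Finset.sum_congr rfl fun b _ => ?_
          simp only [Pi.sub_apply, Matrix.sub_apply]
          ring
      _ = 2 * (∫⁻ x in body S, ENNReal.ofReal (frobSq (σ x - q x))) +
            2 * ∫⁻ x in body S, ENNReal.ofReal (frobSq ((τ - q) x)) := by
          rw [lintegral_add_left' (hm.const_mul 2), lintegral_const_mul' _ _ (by simp),
            lintegral_const_mul' _ _ (by simp)]
      _ ≤ 2 * R + 2 * (ENNReal.ofReal (C1 * ((d + 1) * cF + 1)) * R) := by gcongr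
      _ = _ := by
          simp only [cL]
          rw [ENNReal.ofReal_add zero_le_two (by positivity), ENNReal.ofReal_mul zero_le_two]
          simp only [ENNReal.ofReal_ofNat]
          ring

end LocalEstimate

/-! ### From the elements to the triangulation -/

section Global

variable {d : ℕ} {Ω : Set (Vec d)}

/-- Near a boundary point the points strictly below the graph form an open set that misses the
domain, hence its closure. A slit is thereby excluded, and open elements lie in the domain itself.
-/
theorem IsLipschitzDomain.interior_closure_subset (hΩ : IsLipschitzDomain Ω) :
    interior (closure Ω) ⊆ Ω := by
  intro x hx
  by_contra hxΩ
  have hfr : x ∈ frontier Ω := ⟨interior_subset hx, by rwa [hΩ.isOpen.interior_eq]⟩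
  obtain ⟨e, r, K, γ, he, hr, hγ, hinv, hball⟩ := hΩ.lipschitz x hfr
  have hx0 : (inner ℝ e x : ℝ) ≤ γ x :=
    not_lt.1 fun h => hxΩ ((hball x (Metric.mem_ball_self hr)).2 h)
  obtain ⟨ε, hε, hεs⟩ := Metric.isOpen_iff.1 isOpen_interior x hx
  set t := min (ε / 2) (r / 2)
  have ht : 0 < t := by positivity
  -- A downward shift keeps `γ` and lowers the height, so `y` is strictly below the graph.
  set y := x + (-t) • e
  have hyd : dist y x = t := by
    rw [dist_eq_norm, add_sub_cancel_left, norm_smul, he, mul_one, norm_neg,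
      Real.norm_of_nonneg ht.le]
  have hyc : y ∈ closure Ω := interior_subset (hεs (by
    rw [Metric.mem_ball, hyd]
    exact (min_le_left _ _).trans_lt (half_lt_self hε)))
  have hyr : y ∈ Metric.ball x r := by
    rw [Metric.mem_ball, hyd]
    exact (min_le_right _ _).trans_lt (half_lt_self hr)
  have hyγ : (inner ℝ e y : ℝ) < γ y := by
    rw [hinv, inner_add_right, inner_smul_right, real_inner_self_eq_norm_sq, he]
    linarith
  have hopen : IsOpen (Metric.ball x r ∩ {z | (inner ℝ e z : ℝ) < γ z}) :=
    Metric.isOpen_ball.inter (isOpen_lt (by fun_prop) hγ.continuous)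
  obtain ⟨z, ⟨hz1, hz2⟩, hz3⟩ := mem_closure_iff.1 hyc _ hopen ⟨hyr, hyγ⟩
  exact lt_asymm hz2 ((hball z hz1).1 hz3)

variable [NeZero d]

theorem inner_normal_sub_facet {S : Simp d} {j : Fin (d + 1)} {x y : Vec d} (hx : x ∈ facet S j)
    (hy : y ∈ facet S j) : inner ℝ (normal S j) (x - y) = (0 : ℝ) := by
  have h1 := inner_normal_of_mem_affineSpan S j (convexHull_subset_affineSpan _ hx)
  have h2 := inner_normal_of_mem_affineSpan S j (convexHull_subset_affineSpan _ hy)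
  rw [← sub_sub_sub_cancel_right x y (S.altitudeFoot j), inner_sub_right, h1, h2, sub_zero]

/-- Normals on a common facet are parallel. -/
theorem exists_normal_eq_smul {S S' : Simp d} {j j' : Fin (d + 1)} (hF : facet S j = facet S' j') :
    ∃ c : ℝ, normal S' j' = c • normal S j := by
  refine ⟨_, exists_eq_smul_normal S j fun i l hi hl => inner_normal_sub_facet ?_ ?_⟩
  · rw [← hF]
    exact subset_convexHull ℝ _ ⟨i, hi, rfl⟩
  · rw [← hF]
    exact subset_convexHull ℝ _ ⟨l, hl, rfl⟩

theorem tangSub_congr {S S' : Simp d} {j j' : Fin (d + 1)} (hF : facet S j = facet S' j') {k : ℕ}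
    {q : Vec d → Vec d} (hq : q ∈ tangSub S j k) : q ∈ tangSub S' j' k := by
  obtain ⟨c, hc⟩ := exists_normal_eq_smul hF
  refine ⟨hq.1, fun x hx => ?_⟩
  rw [hc, real_inner_smul_left, hq.2 x (hF ▸ hx), mul_zero]

/-- The normals on a common facet are parallel, so both sides share one test space. The sum of the
two projections is tested with itself; since the jump of `σ` vanishes, its norm is zero. -/
theorem IsLocalInterpolant.nt_jump {S S' : Simp d} {j j' : Fin (d + 1)} {k : ℕ}
    {σ τ τ' : Vec d → Mat d} (hF : facet S j = facet S' j') (h : IsLocalInterpolant k S σ τ)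
    (h' : IsLocalInterpolant k S' σ τ') (ht : MatL2 (surf S j) (matTrace S j σ))
    (ht' : MatL2 (surf S' j') (matTrace S' j' σ))
    (hj : ∀ᵐ x ∂(surf S j), nt (matTrace S j σ x) (normal S j) +
      nt (matTrace S' j' σ x) (normal S' j') = 0) :
    ∀ᵐ x ∂(surf S j), nt (τ x) (normal S j) + nt (τ' x) (normal S' j') = 0 := by
  obtain ⟨q, hq, hq'⟩ := h.mem.exists_nt j
  obtain ⟨r, hr, hr'⟩ := h'.mem.exists_nt j'
  have hs : surf S' j' = surf S j := by rw [surf, surf, hF]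
  have hqr : q + r ∈ tangSub S j (k - 1) :=
    (tangSub S j (k - 1)).add_mem hq (tangSub_congr hF.symm hr)
  have a1 := h.facet_orthogonal hq' _ hqr
  have a2 := h'.facet_orthogonal hr' _ (tangSub_congr hF hqr)
  have i1 := ((ht.nt (normal S j)).sub (vecL2_tangSub hq)).integrable_inner (vecL2_tangSub hqr)
  have i2 := ((ht'.nt (normal S' j')).sub (vecL2_tangSub hr)).integrable_inner
    (vecL2_tangSub (tangSub_congr hF hqr))
  rw [hs] at a2 i2
  have h0 : ∫ x, ‖(q + r) x‖ ^ 2 ∂(surf S j) = 0 := by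
    have e : ∫ x, (inner ℝ (nt (matTrace S j σ x) (normal S j) - q x) ((q + r) x) +
        inner ℝ (nt (matTrace S' j' σ x) (normal S' j') - r x) ((q + r) x)) ∂(surf S j) =
        -∫ x, ‖(q + r) x‖ ^ 2 ∂(surf S j) := by
      rw [← integral_neg]
      refine integral_congr_ae ?_
      filter_upwards [hj] with x hx
      rw [← inner_add_left, ← real_inner_self_eq_norm_sq, ← inner_neg_left]
      congr 1
      rw [sub_add_sub_comm, hx, zero_sub, Pi.add_apply]
    rw [integral_add i1 i2, a1, a2, add_zero] at e
    linarith
  have hz := eqOn_zero_of_integral hqr h0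
  refine (ae_restrict_iff' (isCompact_facet S j).isClosed.measurableSet).2 (ae_of_all _ fun x hx => ?_)
  rw [hq' x hx, hr' x (hF ▸ hx)]
  exact hz x hx

namespace Triangulation

variable (𝒯 : Triangulation Ω)

theorem h_nonneg : 0 ≤ 𝒯.h := Real.iSup_nonneg fun _ => Metric.diam_nonneg

theorem diam_le_h (i : Fin 𝒯.N) : Metric.diam (body (𝒯.elem i)) ≤ 𝒯.h :=
  le_ciSup (f := fun i => Metric.diam (body (𝒯.elem i))) (Set.finite_range _).bddAbove i

theorem exists_ball {γ κ : ℝ} (hγ : 𝒯.ShapeRegular γ) (hκ : 𝒯.QuasiUniform κ) (i : Fin 𝒯.N) :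
    ∃ (x : Vec d) (ρ : ℝ), 0 < ρ ∧ Metric.closedBall x ρ ⊆ body (𝒯.elem i) ∧
      𝒯.h ≤ |κ| * |γ| * ρ := by
  obtain ⟨x, ρ, hρ, hb, hd⟩ := hγ i
  refine ⟨x, ρ, hρ, hb, (hκ i).trans ?_⟩
  calc κ * Metric.diam (body (𝒯.elem i)) ≤ |κ| * Metric.diam (body (𝒯.elem i)) :=
        mul_le_mul_of_nonneg_right (le_abs_self κ) Metric.diam_nonneg
    _ ≤ |κ| * (|γ| * ρ) := mul_le_mul_of_nonneg_left
        (hd.trans (mul_le_mul_of_nonneg_right (le_abs_self γ) hρ.le)) (abs_nonneg κ)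
    _ = _ := (mul_assoc _ _ _).symm

/-- The supremum over the elements adjacent to a facet is at most the sum over them, and each pair
of an element and a local facet belongs to exactly one facet of the mesh. -/
theorem sum_facets_le (σ : Vec d → Mat d) (τ : Fin 𝒯.N → Vec d → Mat d) :
    ∑ F ∈ 𝒯.facets, ENNReal.ofReal 𝒯.h * 𝒯.ntErrSq σ τ F ≤
      ∑ i, ∑ j, ENNReal.ofReal 𝒯.h * ∫⁻ x, ‖nt (matTrace (𝒯.elem i) j σ x - τ i x)
        (normal (𝒯.elem i) j)‖ₑ ^ 2 ∂(surf (𝒯.elem i) j) := by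
  classical
  set E : Fin 𝒯.N × Fin (d + 1) → ℝ≥0∞ := fun q => ENNReal.ofReal 𝒯.h *
    ∫⁻ x, ‖nt (matTrace (𝒯.elem q.1) q.2 σ x - τ q.1 x) (normal (𝒯.elem q.1) q.2)‖ₑ ^ 2
      ∂(surf (𝒯.elem q.1) q.2)
  have h1 : ∑ F ∈ 𝒯.facets, ENNReal.ofReal 𝒯.h * 𝒯.ntErrSq σ τ F ≤
      ∑ F ∈ 𝒯.facets, ∑ q with facet (𝒯.elem q.1) q.2 = F, E q := by
    refine Finset.sum_le_sum fun F _ => ?_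
    rw [ntErrSq, ENNReal.mul_iSup]
    refine iSup_le fun i => ?_
    rw [ENNReal.mul_iSup]
    refine iSup_le fun j => ?_
    rw [ENNReal.mul_iSup]
    refine iSup_le fun hF => ?_
    exact Finset.single_le_sum (f := E) (fun _ _ => zero_le) (a := (i, j))
      (Finset.mem_filter.2 ⟨Finset.mem_univ _, hF⟩)
  refine h1.trans (le_of_eq ?_)
  have hmaps : ∀ q ∈ (Finset.univ : Finset (Fin 𝒯.N × Fin (d + 1))),
      facet (𝒯.elem q.1) q.2 ∈ 𝒯.facets := fun q _ => by
    rw [facets, Finset.mem_image]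
    exact ⟨q, Finset.mem_univ _, rfl⟩
  exact (Finset.sum_fiberwise_of_maps_to hmaps E).trans (Fintype.sum_prod_type E)

end Triangulation

theorem rpow_half_le {Q N : ℝ≥0∞} {c h s : ℝ} (hc : 0 ≤ c) (hh : 0 ≤ h)
    (hQ : Q ≤ ENNReal.ofReal (c * h ^ (2 * s)) * N) :
    Q ^ (1 / 2 : ℝ) ≤ ENNReal.ofReal (√c * h ^ s) * N ^ (1 / 2 : ℝ) := by
  refine (ENNReal.rpow_le_rpow hQ (by norm_num)).trans (le_of_eq ?_)
  rw [ENNReal.mul_rpow_of_nonneg _ _ (by norm_num),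
    ENNReal.ofReal_rpow_of_nonneg (by positivity) (by norm_num),
    Real.mul_rpow hc (by positivity), ← Real.rpow_mul hh, Real.sqrt_eq_rpow]
  congr 4
  ring

end Global

end MCS

end

theorem mainTheorem7 (d : ℕ) [NeZero d] (hd : d = 2 ∨ d = 3) (k : ℕ) (hk : 1 ≤ k) (γ κ : ℝ) :
    ∃ C : ℝ, 0 < C ∧
      ∀ (Ω : Set (MCS.Vec d)), MCS.IsLipschitzDomain Ω →
      ∀ (𝒯 : MCS.Triangulation Ω), 𝒯.ShapeRegular γ → 𝒯.QuasiUniform κ →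
      ∀ (m : ℝ), 1 ≤ m →
      ∀ (σ : MCS.Vec d → MCS.Mat d), 𝒯.MemBroken m σ →
        𝒯.NTContinuous (fun i j => MCS.matTrace (𝒯.elem i) j σ) →
        -- the traces of `σ` on the facets of each element exist and are unique
        (∀ i j a b, ∃ g, MCS.IsTrace (𝒯.elem i) j (fun x => σ x a b) g ∧
          ∀ g', MCS.IsTrace (𝒯.elem i) j (fun x => σ x a b) g' →
            g' =ᵐ[MCS.surf (𝒯.elem i) j] g) ∧
        -- the interpolant exists and is unique
        ∃ τ : Fin 𝒯.N → MCS.Vec d → MCS.Mat d, 𝒯.IsInterpolant k σ τ ∧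
          (∀ τ', 𝒯.IsInterpolant k σ τ' → τ' = τ) ∧
          ∀ s : ℝ, 1 ≤ s → s ≤ min (k : ℝ) m →
            𝒯.facetErr σ τ ≤
              ENNReal.ofReal (C * 𝒯.h ^ s) * 𝒯.brokenNormSq s σ ^ (1 / 2 : ℝ) ∧
            ((∀ᵐ x ∂(volume.restrict Ω), (σ x).trace = 0) →
              𝒯.l2Err σ τ + 𝒯.facetErr σ τ ≤
                ENNReal.ofReal (C * 𝒯.h ^ s) * 𝒯.brokenNormSq s σ ^ (1 / 2 : ℝ)) := by
  -- Shape regularity and quasi-uniformity combine to `h ≤ |κ| |γ| ρ` on every element; the absolute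
  -- values spare sign conditions on the constants.
  obtain ⟨C, hC, hest⟩ := MCS.exists_local_estimate d k (|κ| * |γ|)
  -- The square roots of the squared estimates: `C` for the volume term and `(d + 1) * C` for the `d
  -- + 1` facets of each element.
  refine ⟨√C + √((d + 1) * C), by positivity,
    fun Ω hΩ 𝒯 hγ hκ m hm σ hσ hjump => ?_⟩
  have hg : ∀ i a b, ∃ g, MCS.IsWeakGrad (interior (MCS.body (𝒯.elem i))) (fun x => σ x a b) g :=
    fun i a b => (hσ i a b).exists_grad hm
  have htr : ∀ i j a b, MCS.IsTrace (𝒯.elem i) j (fun x => σ x a b)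
      (MCS.trace (𝒯.elem i) j fun x => σ x a b) := fun i j a b => by
    obtain ⟨g, hg⟩ := hg i a b
    exact hg.isTrace_trace j
  refine ⟨fun i j a b => ⟨_, htr i j a b, fun g' hg' => ?_⟩, ?_⟩
  · obtain ⟨g, hg⟩ := hg i a b
    exact MCS.IsTrace.ae_eq hg (htr i j a b) hg'
  have hσL : ∀ i, MCS.MatL2 (volume.restrict (MCS.body (𝒯.elem i))) σ := fun i a b => by
    obtain ⟨g, hg⟩ := hg i a b
    rw [← MCS.restrict_interior_body]
    exact hg.memLp
  have htL : ∀ i j, MCS.MatL2 (MCS.surf (𝒯.elem i) j) (MCS.matTrace (𝒯.elem i) j σ) :=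
    fun i j a b => (htr i j a b).1
  have hloc : ∀ i, ∃ τ, MCS.IsLocalInterpolant k (𝒯.elem i) σ τ := fun i =>
    MCS.exists_isLocalInterpolant (hσL i) (htL i)
  choose τ hτ using hloc
  refine ⟨τ, ⟨⟨fun i => (hτ i).mem, fun i j i' j' hi hF => ?_⟩, hτ⟩, fun τ' hτ' => ?_,
    fun s hs hsm => ?_⟩
  · exact (hτ i).nt_jump hF (hτ i') (htL i j) (htL i' j') (hjump i j i' j' hi hF)
  · exact funext fun i => (hτ i).unique (hσL i) (htL i) (hτ'.dof i)
  have hsk : s ≤ k := hsm.trans (min_le_left _ _)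
  have hh := 𝒯.h_nonneg
  have hE : ∀ i, (∀ j, ENNReal.ofReal 𝒯.h * ∫⁻ x, ‖MCS.nt (MCS.matTrace (𝒯.elem i) j σ x - τ i x)
        (MCS.normal (𝒯.elem i) j)‖ₑ ^ 2 ∂(MCS.surf (𝒯.elem i) j) ≤
        ENNReal.ofReal (C * 𝒯.h ^ (2 * s)) * ∑ a, ∑ b,
          MCS.sobolevNormSq (interior (MCS.body (𝒯.elem i))) s (fun x => σ x a b)) ∧
      ((∀ᵐ x ∂(volume.restrict (MCS.body (𝒯.elem i))), (σ x).trace = 0) →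
        ∑ a, ∑ b, ∫⁻ x in MCS.body (𝒯.elem i), ‖σ x a b - τ i x a b‖ₑ ^ 2 ≤
        ENNReal.ofReal (C * 𝒯.h ^ (2 * s)) * ∑ a, ∑ b,
          MCS.sobolevNormSq (interior (MCS.body (𝒯.elem i))) s (fun x => σ x a b)) := fun i => by
    obtain ⟨x, ρ, hρ, hb, hd⟩ := 𝒯.exists_ball hγ hκ i
    exact hest (𝒯.elem i) x ρ 𝒯.h hρ hb (𝒯.diam_le_h i) hd s hs hsk σ (τ i) (hg i) (hτ i)
  have hfacet : 𝒯.facetErr σ τ ≤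
      ENNReal.ofReal (√((d + 1) * C) * 𝒯.h ^ s) * 𝒯.brokenNormSq s σ ^ (1 / 2 : ℝ) := by
    refine MCS.rpow_half_le (by positivity) hh ((𝒯.sum_facets_le σ τ).trans ?_)
    rw [MCS.Triangulation.brokenNormSq, Finset.mul_sum]
    refine Finset.sum_le_sum fun i _ => (Finset.sum_le_sum fun j _ => (hE i).1 j).trans ?_
    have hd1 : ((d + 1 : ℕ) : ℝ≥0∞) = ENNReal.ofReal ((d : ℝ) + 1) := by
      rw [← ENNReal.ofReal_natCast, Nat.cast_succ]
    rw [Finset.sum_const, Finset.card_univ, Fintype.card_fin, nsmul_eq_mul, mul_assoc ((d : ℝ) + 1),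
      ENNReal.ofReal_mul (p := (d : ℝ) + 1) (by positivity), hd1, mul_assoc (ENNReal.ofReal _)]
  have hpos : 0 ≤ 𝒯.h ^ s := Real.rpow_nonneg hh s
  refine ⟨hfacet.trans (mul_le_mul' (ENNReal.ofReal_le_ofReal ?_) le_rfl), fun h0 => ?_⟩
  · exact mul_le_mul_of_nonneg_right (le_add_of_nonneg_left (Real.sqrt_nonneg C)) hpos
  have hl2 : 𝒯.l2Err σ τ ≤
      ENNReal.ofReal (√C * 𝒯.h ^ s) * 𝒯.brokenNormSq s σ ^ (1 / 2 : ℝ) := by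
    refine MCS.rpow_half_le hC.le hh ?_
    rw [MCS.Triangulation.brokenNormSq, Finset.mul_sum]
    refine Finset.sum_le_sum fun i _ => (hE i).2 ?_
    -- The elements cover only the closure of the domain, whose boundary is not known to be a null
    -- set here; the Lipschitz property places their interiors in the domain, where the trace
    -- vanishes almost everywhere.
    have hsub : interior (MCS.body (𝒯.elem i)) ⊆ Ω := by
      refine subset_trans (interior_mono ?_) hΩ.interior_closure_subset
      rw [← 𝒯.cover]
      exact Set.subset_iUnion (fun i => MCS.body (𝒯.elem i)) i
    rw [← MCS.restrict_interior_body]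
    exact ae_restrict_of_ae_restrict_of_subset hsub h0
  refine (add_le_add hl2 hfacet).trans (le_of_eq ?_)
  rw [← add_mul, ← ENNReal.ofReal_add (by positivity) (by positivity), ← add_mul]
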